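/- Let $S$ be a smooth complex algebraic surface (an integral separated scheme of finite type over $\mathbb{C}$, smooth of dimension $2$), let $P\in S$ be a closed point, and let $g\colon S'\to S$ be the blow-up of $P$. Let $C$ be an effective divisor on $S$, not necessarily reduced, and put $C'=g^*C$. For $t\in(0,1)$ let $\Theta_t=\lceil tC\rceil$ and $\Theta'_t=\lceil tC'\rceil$, where a divisor with real coefficients is rounded up coefficient by coefficient along its prime components. Write $C=\sum_i n_iC_i$ near $P$ for the decomposition of $C$ into its distinct irreducible analytic branches $C_i$ at $P$, with $n_i\ge 1$. Assume that at least one of the following holds: (a) $C$ is a normal crossing divisor, i.e. at every closed point of $S$ there are analytic (formal) local coordinates $x,y$ in which $C$ is given by $x^my^n=0$ for some integers $m,n\ge 0$; (b) $C$ has exactly two analytic branches at $P$, both smooth (with arbitrary coefficients $n_1,n_2\geq 1$, and possibly tangent to each other); (c) $C$ has exactly one analytic branch $C_1$ at $P$, with $n_1=1$ and $\operatorname{mult}_P(C_1)=2$. Then $h^0(S,K_S+\Theta_t)=h^0(S',K_{S'}+\Theta'_t)$ for every $t\in(0,1)$. (If $S$ is not projective, $h^0$ denotes the possibly infinite dimension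 of the space of global sections over $\mathbb{C}$.) -/

import Mathlib

open CategoryTheory AlgebraicGeometry

noncomputable section

namespace BlowUpRoundUp

/-! ### Surfaces over the complex numbers -/

/-- The base scheme `Spec ℂ`. -/
abbrev SpecC : Scheme.{0} := Spec (CommRingCat.of ℂ)

/-- A smooth (connected, complex algebraic) surface: an integral separated scheme of finite type
over `ℂ`, smooth of relative dimension `2`. Finite type is smoothness (locally of finite
presentation) together with quasi-compactness. -/
class IsSmoothSurface (S : Scheme.{0}) [S.Over SpecC] : Prop where
  isIntegral : IsIntegral S
  quasiCompact : QuasiCompact (S ↘ SpecC)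
  isSeparated : IsSeparated (S ↘ SpecC)
  smooth : SmoothOfRelativeDimension 2 (S ↘ SpecC)

instance (S : Scheme.{0}) [S.Over SpecC] [h : IsSmoothSurface S] : IsIntegral S := h.isIntegral

/-- The function field of an integral `ℂ`-scheme as a `ℂ`-algebra. -/
instance functionFieldAlgebra (S : Scheme.{0}) [S.Over SpecC] [IsIntegral S] :
    Algebra ℂ S.functionField :=
  ((Scheme.ΓSpecIso (CommRingCat.of ℂ)).inv ≫ (S ↘ SpecC).appTop ≫
    S.presheaf.germ ⊤ (genericPoint S) trivial).hom.toAlgebra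

/-! ### Effective Weil divisors -/

/-- Prime divisors, given by their generic points: the points of codimension one. -/
def PrimeDivisor (S : Scheme.{0}) : Type := {x : S // Order.coheight x = 1}

/-- The local ring of `S` along a prime divisor. -/
abbrev PrimeDivisor.localRing {S : Scheme.{0}} (x : PrimeDivisor S) : CommRingCat.{0} :=
  S.presheaf.stalk x.1

/-- Effective Weil divisors: finite sums of prime divisors with natural number coefficients. -/
abbrev EffDivisor (S : Scheme.{0}) : Type := PrimeDivisor S →₀ ℕ

/-- The round up `⌈t C⌉` of the real divisor `t C`, taken coefficientwise. -/
def roundUp {S : Scheme.{0}} (t : ℝ) (C : EffDivisor S) : EffDivisor S :=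
  C.mapRange (fun n : ℕ => ⌈t * (n : ℝ)⌉₊) (by simp)

/-- `a ∈ 𝒪_{S,p}` is a local equation of `C` at the point `p`: for every prime divisor through `p`
the order of vanishing of `a` along it is its coefficient in `C`. -/
def IsLocalEquation {S : Scheme.{0}} (C : EffDivisor S) (p : S) (a : S.presheaf.stalk p) : Prop :=
  a ≠ 0 ∧ ∀ (x : PrimeDivisor S) (hx : x.1 ⤳ p),
    Ring.ord x.localRing ((S.presheaf.stalkSpecializes hx).hom a) = (C x : ℕ∞)

/-- `C'` is the pull-back `g^* C`: its coefficient along a prime divisor `x'` of `S'` is the order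
of vanishing along `x'` of the pull-back of a local equation of `C` at `g x'`. -/
def IsPullback {S' S : Scheme.{0}} (g : S' ⟶ S) (C : EffDivisor S) (C' : EffDivisor S') : Prop :=
  ∀ x' : PrimeDivisor S', ∃ a : S.presheaf.stalk (g x'.1),
    IsLocalEquation C (g x'.1) a ∧ Ring.ord x'.localRing ((g.stalkMap x'.1).hom a) = (C' x' : ℕ∞)

/-! ### Rational two-forms and `h⁰(K + D)` -/

/-- Rational two-forms on `S` over `ℂ`. -/
abbrev RationalTwoForm (S : Scheme.{0}) [S.Over SpecC] [IsIntegral S] : Type :=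
  ⋀[S.functionField]^2 (KaehlerDifferential ℂ S.functionField)

/-- The local ring of `S` at `x`, as a subring of the function field. -/
def localSubring (S : Scheme.{0}) [IsIntegral S] (x : S) : Subring S.functionField :=
  (algebraMap (S.presheaf.stalk x) S.functionField).range

/-- The two-form `da ∧ db`. -/
def wedgeD (S : Scheme.{0}) [S.Over SpecC] [IsIntegral S] (a b : S.functionField) :
    RationalTwoForm S :=
  exteriorPower.ιMulti S.functionField 2
    ![KaehlerDifferential.D ℂ S.functionField a, KaehlerDifferential.D ℂ S.functionField b]

/-- The rational two-forms regular at `x`: the image of `⋀² Ω_{𝒪_{S,x}/ℂ}`, that is, the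
`𝒪_{S,x}`-span of the forms `da ∧ db` with `a, b ∈ 𝒪_{S,x}`. -/
def regularTwoForms (S : Scheme.{0}) [S.Over SpecC] [IsIntegral S] (x : S) :
    Submodule (localSubring S x) (RationalTwoForm S) :=
  Submodule.span (localSubring S x)
    {ω | ∃ a ∈ localSubring S x, ∃ b ∈ localSubring S x, ω = wedgeD S a b}

theorem constant_mem_localSubring (S : Scheme.{0}) [S.Over SpecC] [IsIntegral S] (x : S) (c : ℂ) :
    algebraMap ℂ S.functionField c ∈ localSubring S x := by
  refine ⟨((Scheme.ΓSpecIso (CommRingCat.of ℂ)).inv ≫ (S ↘ SpecC).appTop ≫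
    S.presheaf.germ ⊤ x trivial).hom c, ?_⟩
  have h : S.presheaf.germ ⊤ x trivial ≫ S.presheaf.stalkSpecializes
      ((genericPoint_spec S).specializes (Set.mem_univ x)) =
      S.presheaf.germ ⊤ (genericPoint S) trivial :=
    S.presheaf.germ_stalkSpecializes _ _
  change (S.presheaf.stalkSpecializes _).hom (((Scheme.ΓSpecIso (CommRingCat.of ℂ)).inv ≫
    (S ↘ SpecC).appTop ≫ S.presheaf.germ ⊤ x trivial).hom c) =
    ((Scheme.ΓSpecIso (CommRingCat.of ℂ)).inv ≫ (S ↘ SpecC).appTop ≫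
      S.presheaf.germ ⊤ (genericPoint S) trivial).hom c
  rw [← h]
  rfl

/-- The space `H⁰(S, 𝒪_S(K_S + D))`: the rational two-forms `ω` with `div ω + D ≥ 0`. Along the
prime divisor `x` the condition says that `ω` has a pole of order at most `D x`, that is,
`𝔪_x ^ (D x)` carries `ω` into the forms regular at `x`. -/
def adjointSections (S : Scheme.{0}) [S.Over SpecC] [IsIntegral S] (D : EffDivisor S) :
    Submodule ℂ (RationalTwoForm S) where
  carrier := {ω | ∀ x : PrimeDivisor S, ∀ a ∈ IsLocalRing.maximalIdeal x.localRing ^ D x,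
    algebraMap x.localRing S.functionField a • ω ∈ regularTwoForms S x.1}
  add_mem' := fun h₁ h₂ x a ha => by
    rw [smul_add]
    exact add_mem (h₁ x a ha) (h₂ x a ha)
  zero_mem' := fun x a _ => by
    rw [smul_zero]
    exact zero_mem _
  smul_mem' := fun c ω h x a ha => by
    have key := (regularTwoForms S x.1).smul_mem
      ⟨algebraMap ℂ S.functionField c, constant_mem_localSubring S x.1 c⟩ (h x a ha)
    rw [← algebraMap_smul S.functionField c ω, smul_comm]
    exact key

/-- `h⁰(K_S + D)`, as a cardinal; it is finite if `S` is projective. -/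
def h0K (S : Scheme.{0}) [S.Over SpecC] [IsIntegral S] (D : EffDivisor S) : Cardinal.{0} :=
  Module.rank ℂ (adjointSections S D)

/-! ### Blowing up a point -/

/-- The ideal sheaf of the closed point `P` pulls back along `f : T ⟶ S` to an invertible ideal
sheaf: it is locally generated by one nonzerodivisor. (Off the fibre of `P` it is the unit
ideal.) -/
def PullsBackToInvertible {T S : Scheme.{0}} (f : T ⟶ S) (P : S) : Prop :=
  ∀ y : T, f y = P → ∃ a ∈ nonZeroDivisors (T.presheaf.stalk y),
    (IsLocalRing.maximalIdeal (S.presheaf.stalk (f y))).map (f.stalkMap y).hom = Ideal.span {a}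

/-- `g : S' ⟶ S` is the blow-up of the closed point `P`: it is universal among the morphisms to
`S` along which the ideal sheaf of `P` becomes invertible. -/
structure IsBlowUp {S' S : Scheme.{0}} (g : S' ⟶ S) (P : S) : Prop where
  isClosed : IsClosed ({P} : Set S)
  invertible : PullsBackToInvertible g P
  universal : ∀ (T : Scheme.{0}) (f : T ⟶ S), PullsBackToInvertible f P → ∃! h : T ⟶ S', h ≫ g = f

/-! ### Analytic branches and normal crossings -/

/-- The completed local ring of `S` at `p`. -/
abbrev CompletedStalk (S : Scheme.{0}) (p : S) : Type :=
  AdicCompletion (IsLocalRing.maximalIdeal (S.presheaf.stalk p)) (S.presheaf.stalk p)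

/-- The maximal ideal of the completed local ring at `p`. -/
def completedMaximalIdeal (S : Scheme.{0}) (p : S) : Ideal (CompletedStalk S p) :=
  (IsLocalRing.maximalIdeal (S.presheaf.stalk p)).map
    (algebraMap (S.presheaf.stalk p) (CompletedStalk S p))

/-- The germ `f = 0` has multiplicity `m` at `p`. -/
def HasMultiplicity {S : Scheme.{0}} {p : S} (f : CompletedStalk S p) (m : ℕ) : Prop :=
  f ∈ completedMaximalIdeal S p ^ m ∧ f ∉ completedMaximalIdeal S p ^ (m + 1)

/-- `C = ∑ nᵢ Cᵢ` with `Cᵢ = {fᵢ = 0}` is the decomposition of `C` at `p` into distinct irreducible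
analytic branches: a local equation of `C` is, up to a unit of the completed local ring, the
product of the `fᵢ ^ nᵢ`, with the `fᵢ` irreducible and pairwise non-associated. -/
structure IsBranchDecomposition {S : Scheme.{0}} (C : EffDivisor S) (p : S) {r : ℕ}
    (f : Fin r → CompletedStalk S p) (n : Fin r → ℕ) : Prop where
  irreducible : ∀ i, Irreducible (f i)
  distinct : Pairwise fun i j => ¬ Associated (f i) (f j)
  pos : ∀ i, 0 < n i
  equation : ∃ a : S.presheaf.stalk p, IsLocalEquation C p a ∧
    Associated (algebraMap (S.presheaf.stalk p) (CompletedStalk S p) a) (∏ i, f i ^ n i)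

/-- `C` has at `P` exactly two analytic branches, both smooth (with any coefficients, and possibly
tangent to each other). -/
def HasTwoSmoothBranches {S : Scheme.{0}} (C : EffDivisor S) (P : S) : Prop :=
  ∃ (f : Fin 2 → CompletedStalk S P) (n : Fin 2 → ℕ),
    IsBranchDecomposition C P f n ∧ ∀ i, HasMultiplicity (f i) 1

/-- `C` has at `P` exactly one analytic branch; it has coefficient one and multiplicity two. -/
def HasOneDoubleBranch {S : Scheme.{0}} (C : EffDivisor S) (P : S) : Prop :=
  ∃ f : CompletedStalk S P,
    IsBranchDecomposition C P (fun _ : Fin 1 => f) (fun _ => 1) ∧ HasMultiplicity f 2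

/-- `C` is a normal crossing divisor: at every closed point there are formal coordinates `x, y` in
which `C` is given by `x ^ m * y ^ n` for some `m, n ≥ 0`. -/
def IsNormalCrossing {S : Scheme.{0}} (C : EffDivisor S) : Prop :=
  ∀ p : S, IsClosed ({p} : Set S) →
    ∃ (x y : CompletedStalk S p) (m n : ℕ) (a : S.presheaf.stalk p),
      Ideal.span {x, y} = completedMaximalIdeal S p ∧ IsLocalEquation C p a ∧
      Associated (algebraMap (S.presheaf.stalk p) (CompletedStalk S p) a) (x ^ m * y ^ n)

end BlowUpRoundUp

end

/-! A blow-up does not change the function field, so rational two-forms on S and on S' are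
identified, and the claim becomes that the two pole conditions cut out the same forms. Off P the map
g is an isomorphism on local rings and rounding is done coefficientwise, so only the exceptional
curve E matters. As P is not a prime divisor of S, forms descend from S' to S at once. The content
is that an adjoint form ω on S has no excess pole along E.

Near P write ω = z dx ∧ dy with local coordinates x, y. The local ring is factorial, so a local
equation θ of ⌈tC⌉ clears the denominator of z. In the chart y = xw one has dx ∧ dy = x dx ∧ dw, and
it suffices that ord_E(θ) ≤ 1 + ⌈t ord_E(C)⌉. If C = ∑ cᵢDᵢ near P with prime divisors Dᵢ and μᵢ =
mult_P(Dᵢ) = ord_E(Dᵢ), then ∑ ⌈tcᵢ⌉μᵢ < t ∑ cᵢμᵢ + ∑ μᵢ as soon as some Dᵢ occurs. So the bound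
holds whenever ∑ μᵢ ≤ 2, that is, when the reduction of C has multiplicity at most two at P
(`sum_ceil_mul_le`).

Each of (a), (b), (c) gives this (`primeProd_not_mem_of_cases`). In (c) the reduced equation divides
an equation of multiplicity two. In (a) and (b) the equation of C is, in the completed local ring, a
unit times f^m g^n with f, g of order one, hence prime. It remains to see that a squarefree element
b of the local ring has no multiple factor in the completion. In characteristic zero b and its two
partial derivatives generate an ideal containing a power of the maximal ideal, and this prevents b
from being close to any f²g (`exists_sub_sq_mul_not_mem_pow`).

The blow-up is given by its universal property only. Its local ring at E is recovered by minimality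
as a localization of R[y/x] (`exists_isExceptionalChart`), and ord_E is the order at P because the
associated graded ring of R is a polynomial ring (`binaryForm_mem_pow_succ_iff`). -/

set_option linter.unusedSectionVars false

/-! ### Two-dimensional regular local rings -/

section RegularPair

open IsLocalRing

variable {R : Type*} [CommRing R] [IsLocalRing R]

/-- Two generators of the maximal ideal of a local ring in which no power of the maximal ideal
lies in a proper principal ideal: a regular system of parameters in dimension two. -/
structure IsRegularPair (x y : R) : Prop where
  span_eq : Ideal.span {x, y} = maximalIdeal R
  not_le : ∀ f ∈ maximalIdeal R, ∀ k : ℕ, ¬ maximalIdeal R ^ k ≤ Ideal.span {f}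

/-- Krull's intersection theorem in `R ⧸ J`: ideals are closed in the adic topology. -/
theorem mem_ideal_of_forall_mem_sup_pow [IsNoetherianRing R] (J : Ideal R) (z : R)
    (h : ∀ n : ℕ, z ∈ J ⊔ maximalIdeal R ^ n) : z ∈ J := by
  rw [← Ideal.Quotient.eq_zero_iff_mem, ← Submodule.mem_bot R,
    ← Ideal.iInf_pow_smul_eq_bot_of_isLocalRing (M := R ⧸ J) (maximalIdeal R)
      (Ideal.IsPrime.ne_top inferInstance), Submodule.mem_iInf]
  intro n
  obtain ⟨a, ha, b, hb, rfl⟩ := Submodule.mem_sup.1 (h n)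
  have h1 : Ideal.Quotient.mk J (a + b) = b • (1 : R ⧸ J) := by
    rw [map_add, Ideal.Quotient.eq_zero_iff_mem.2 ha, zero_add, Algebra.smul_def, mul_one]
    rfl
  rw [h1]
  exact Submodule.smul_mem_smul hb Submodule.mem_top

theorem Ideal.span_pair_pow_le {R : Type*} [CommRing R] (x y : R) (n : ℕ) :
    Ideal.span {x, y} ^ n ≤ Ideal.span {x} ⊔ Ideal.span {y ^ n} := by
  induction n with
  | zero => simp
  | succ n ih =>
    rw [pow_succ, Ideal.mul_le]
    intro r hr s hs
    obtain ⟨a, ha, b, hb, rfl⟩ := Submodule.mem_sup.1 (ih hr)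
    obtain ⟨c, d, rfl⟩ := Ideal.mem_span_pair.1 hs
    obtain ⟨a, rfl⟩ := Ideal.mem_span_singleton'.1 ha
    obtain ⟨b, rfl⟩ := Ideal.mem_span_singleton'.1 hb
    have : (a * x + b * y ^ n) * (c * x + d * y) =
      (a * (c * x + d * y) + b * y ^ n * c) * x + b * d * y ^ (n + 1) := by ring
    rw [this]
    exact Submodule.add_mem_sup (Ideal.mul_mem_left _ _ (Ideal.mem_span_singleton_self _))
      (Ideal.mul_mem_left _ _ (Ideal.mem_span_singleton_self _))

namespace IsRegularPair

variable {x y : R}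

theorem symm (h : IsRegularPair x y) : IsRegularPair y x :=
  ⟨by rw [Set.pair_comm, h.span_eq], h.not_le⟩

theorem left_mem (h : IsRegularPair x y) : x ∈ maximalIdeal R :=
  h.span_eq ▸ Ideal.subset_span (by simp)

theorem right_mem (h : IsRegularPair x y) : y ∈ maximalIdeal R := h.symm.left_mem

theorem pow_le (h : IsRegularPair x y) (n : ℕ) :
    maximalIdeal R ^ n ≤ Ideal.span {x} ⊔ Ideal.span {y ^ n} :=
  h.span_eq ▸ Ideal.span_pair_pow_le x y n

theorem pow_not_mem (h : IsRegularPair x y) (n : ℕ) : y ^ n ∉ Ideal.span {x} := fun hn =>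
  h.not_le x h.left_mem n <| (h.pow_le n).trans <|
    sup_le le_rfl (Ideal.span_le.2 (by simpa using hn))

/-- Modulo x the ring behaves like a discrete valuation ring with uniformizer y. Closedness of (x)
is assumed in place of Noetherianity, so that the argument serves both a Noetherian ring and its
completion. -/
theorem exists_eq_of_closed (h : IsRegularPair x y)
    (hcl : ∀ z : R, (∀ n : ℕ, z ∈ Ideal.span {x} ⊔ maximalIdeal R ^ n) → z ∈ Ideal.span {x})
    {z : R} (hz : z ∉ Ideal.span {x}) :
    ∃ (n : ℕ) (u a : R), IsUnit u ∧ z = u * y ^ n + a * x := by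
  have h1 : ∃ n, z ∉ Ideal.span {x} ⊔ Ideal.span {y ^ n} := by
    by_contra! hc
    refine hz (hcl _ fun n => ?_)
    have hle : Ideal.span {y ^ n} ≤ maximalIdeal R ^ n :=
      Ideal.span_le.2 (by simpa using Ideal.pow_mem_pow h.right_mem n)
    exact sup_le_sup_left hle _ (hc n)
  classical
  obtain ⟨n, hn⟩ : ∃ n, Nat.find h1 = n + 1 :=
    Nat.exists_eq_succ_of_ne_zero fun h0 => Nat.find_spec h1 (by simp [h0])
  have hlt := Nat.find_min h1 (m := n) (by lia)
  have hspec := Nat.find_spec h1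
  rw [hn] at hspec
  rw [not_not] at hlt
  obtain ⟨a, ha, b, hb, rfl⟩ := Submodule.mem_sup.1 hlt
  obtain ⟨a, rfl⟩ := Ideal.mem_span_singleton'.1 ha
  obtain ⟨b, rfl⟩ := Ideal.mem_span_singleton'.1 hb
  -- Were b in the maximal ideal (x, y), then z would lie in (x, yⁿ⁺¹), against the choice of n + 1
  -- as the least exponent that fails.
  refine ⟨n, b, a, ?_, add_comm _ _⟩
  by_contra hb
  have hb : b ∈ maximalIdeal R := hb
  rw [← h.span_eq] at hb
  obtain ⟨c, d, rfl⟩ := Ideal.mem_span_pair.1 hb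
  refine hspec ?_
  have : a * x + (c * x + d * y) * y ^ n = (a + c * y ^ n) * x + d * y ^ (n + 1) := by ring
  rw [this]
  exact Submodule.add_mem_sup (Ideal.mul_mem_left _ _ (Ideal.mem_span_singleton_self _))
      (Ideal.mul_mem_left _ _ (Ideal.mem_span_singleton_self _))

theorem isPrime_span_of_closed (h : IsRegularPair x y)
    (hcl : ∀ z : R, (∀ n : ℕ, z ∈ Ideal.span {x} ⊔ maximalIdeal R ^ n) → z ∈ Ideal.span {x}) :
    (Ideal.span {x}).IsPrime := by
  refine ⟨fun ht => h.pow_not_mem 0 (by rw [ht]; trivial), fun {z w} hzw => ?_⟩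
  by_contra! hc
  obtain ⟨n, u, a, hu, rfl⟩ := h.exists_eq_of_closed hcl hc.1
  obtain ⟨k, v, b, hv, rfl⟩ := h.exists_eq_of_closed hcl hc.2
  refine h.pow_not_mem (n + k) ?_
  rw [← Ideal.unit_mul_mem_iff_mem _ (hu.mul hv)]
  have : u * v * y ^ (n + k) = (u * y ^ n + a * x) * (v * y ^ k + b * x) -
      (a * (v * y ^ k + b * x) + b * u * y ^ n) * x := by ring
  rw [this]
  exact Ideal.sub_mem _ hzw (Ideal.mul_mem_left _ _ (Ideal.mem_span_singleton_self _))

theorem left_ne_zero_of_closed (h : IsRegularPair x y)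
    (hcl : ∀ z : R, (∀ n : ℕ, z ∈ Ideal.span {x} ⊔ maximalIdeal R ^ n) → z ∈ Ideal.span {x}) :
    x ≠ 0 := by
  rintro rfl
  obtain ⟨n, hn⟩ : ∃ n, y ^ n = 0 := by
    by_contra! hc
    refine h.not_le y h.right_mem 1 ?_
    have hp := h.isPrime_span_of_closed hcl
    intro z hz
    rw [pow_one, ← h.span_eq] at hz
    simpa [Ideal.span_insert] using hz
  exact h.pow_not_mem n (by simp [hn])

theorem prime_left_of_closed (h : IsRegularPair x y)
    (hcl : ∀ z : R, (∀ n : ℕ, z ∈ Ideal.span {x} ⊔ maximalIdeal R ^ n) → z ∈ Ideal.span {x}) : Prime x :=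
  (Ideal.span_singleton_prime (h.left_ne_zero_of_closed hcl)).1 (h.isPrime_span_of_closed hcl)

variable [IsNoetherianRing R]

theorem exists_eq (h : IsRegularPair x y) {z : R} (hz : z ∉ Ideal.span {x}) :
    ∃ (n : ℕ) (u a : R), IsUnit u ∧ z = u * y ^ n + a * x :=
  h.exists_eq_of_closed (mem_ideal_of_forall_mem_sup_pow _) hz

theorem prime_left (h : IsRegularPair x y) : Prime x :=
  h.prime_left_of_closed (mem_ideal_of_forall_mem_sup_pow _)

theorem left_ne_zero (h : IsRegularPair x y) : x ≠ 0 := h.prime_left.ne_zero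

/-- A prime ideal avoiding one of the parameters is principal. -/
theorem exists_eq_span (h : IsRegularPair x y) (q : Ideal R) [hq : q.IsPrime] (hx : x ∉ q) :
    ∃ p, q = Ideal.span {p} := by
  by_cases hqx : q ≤ Ideal.span {x}
  -- As x ∉ q, an ideal q inside (x) satisfies q = xq and vanishes by Nakayama.
  · refine ⟨0, ?_⟩
    rw [Ideal.span_singleton_eq_bot.2 rfl]
    refine Submodule.eq_bot_of_le_smul_of_le_jacobson_bot (maximalIdeal R) q
      (IsNoetherian.noetherian q) (fun z hz => ?_) (maximalIdeal_le_jacobson _)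
    obtain ⟨w, rfl⟩ := Ideal.mem_span_singleton'.1 (hqx hz)
    rw [mul_comm]
    exact Submodule.smul_mem_smul h.left_mem ((hq.mem_or_mem hz).resolve_right hx)
  have hex : ∃ n : ℕ, y ^ n ∈ q ⊔ Ideal.span {x} := by
    obtain ⟨z, hz, hzx⟩ := Set.not_subset.1 hqx
    obtain ⟨n, u, a, hu, rfl⟩ := h.exists_eq hzx
    refine ⟨n, ?_⟩
    rw [← Ideal.unit_mul_mem_iff_mem _ hu]
    have := Submodule.add_mem_sup hz (Ideal.mul_mem_left (Ideal.span {x}) (-a)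
      (Ideal.mem_span_singleton_self x))
    convert! this using 1
    ring
  classical
  -- The generator is an element p of q congruent modulo x to the least power of y that occurs.
  -- Every element of q is then congruent modulo x to a multiple of p, so q = (p) + xq and Nakayama
  -- applies.
  obtain ⟨p, hp, b, hb, hpb⟩ := Submodule.mem_sup.1 (Nat.find_spec hex)
  refine ⟨p, le_antisymm ?_ (Ideal.span_le.2 (by simpa using hp))⟩
  refine Submodule.le_of_le_smul_of_le_jacobson_bot (I := maximalIdeal R)
    (IsNoetherian.noetherian q) (maximalIdeal_le_jacobson _) fun z hz => ?_
  obtain ⟨c, hc⟩ : ∃ c, z - c * p ∈ Ideal.span {x} := by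
    by_cases hzx : z ∈ Ideal.span {x}
    · exact ⟨0, by simpa using hzx⟩
    obtain ⟨n, u, a, hu, rfl⟩ := h.exists_eq hzx
    have hle : Nat.find hex ≤ n := by
      refine Nat.find_min' hex ?_
      rw [← Ideal.unit_mul_mem_iff_mem _ hu]
      have := Submodule.add_mem_sup hz (Ideal.mul_mem_left (Ideal.span {x}) (-a)
        (Ideal.mem_span_singleton_self x))
      convert! this using 1
      ring
    obtain ⟨k, hk⟩ := Nat.exists_eq_add_of_le hle
    refine ⟨u * y ^ k, ?_⟩
    have : u * y ^ n + a * x - u * y ^ k * p = a * x + u * y ^ k * b := by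
      rw [hk, pow_add, ← hpb]
      ring
    rw [this]
    exact Ideal.add_mem _ (Ideal.mul_mem_left _ _ (Ideal.mem_span_singleton_self _))
      (Ideal.mul_mem_left _ _ hb)
  obtain ⟨w, hw⟩ := Ideal.mem_span_singleton'.1 hc
  have hwq : w ∈ q := by
    refine (hq.mem_or_mem (?_ : w * x ∈ q)).resolve_right hx
    rw [hw]
    exact Ideal.sub_mem _ hz (Ideal.mul_mem_left _ _ hp)
  have : z = c * p + x * w := by rw [mul_comm x, hw]; ring
  rw [this]
  exact Submodule.add_mem_sup (Ideal.mul_mem_left _ _ (Ideal.mem_span_singleton_self _))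
    (Submodule.smul_mem_smul h.left_mem hwq)

theorem eq_maximalIdeal_or_exists (h : IsRegularPair x y) (q : Ideal R) [hq : q.IsPrime] :
    q = maximalIdeal R ∨ ∃ p, q = Ideal.span {p} := by
  by_cases hx : x ∈ q
  · by_cases hy : y ∈ q
    · refine .inl (le_antisymm (le_maximalIdeal hq.ne_top) ?_)
      rw [← h.span_eq, Ideal.span_le]
      simp [Set.insert_subset_iff, hx, hy]
    · exact .inr (h.symm.exists_eq_span q hy)
  · exact .inr (h.exists_eq_span q hx)

/-- Kaplansky's criterion: every nonzero prime ideal contains a prime element. Factoriality is what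
provides equations for the divisors through P. -/
theorem uniqueFactorizationMonoid [IsDomain R] (h : IsRegularPair x y) :
    UniqueFactorizationMonoid R := by
  rw [UniqueFactorizationMonoid.iff_exists_prime_mem_of_isPrime]
  intro q hq0 hq
  rcases h.eq_maximalIdeal_or_exists q with rfl | ⟨p, rfl⟩
  · exact ⟨x, h.left_mem, h.prime_left⟩
  · exact ⟨p, Ideal.mem_span_singleton_self p, (Ideal.span_singleton_prime
      fun h0 => hq0 (by simp [h0])).1 hq⟩

end IsRegularPair

end RegularPair

/-! ### Binary forms and the associated graded ring. -/

section Forms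

open IsLocalRing Polynomial

variable {R : Type*} [CommRing R]

/-- The binary form `∑ Pᵢ yⁱ xⁿ⁻ⁱ` with the coefficients of the polynomial `P`. -/
noncomputable def binaryForm (x y : R) (n : ℕ) (P : R[X]) : R := (P.homogenize n).eval ![y, x]

theorem binaryForm_eq_sum (x y : R) (n : ℕ) (P : R[X]) :
    binaryForm x y n P = ∑ i ∈ Finset.range (n + 1), P.coeff i * (y ^ i * x ^ (n - i)) := by
  rw [binaryForm, homogenize, map_sum, Finset.Nat.antidiagonal_eq_map, Finset.sum_map]
  refine Finset.sum_congr rfl fun i _ => ?_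
  rw [MvPolynomial.eval_monomial, Finsupp.prod_fintype _ _ (by simp)]
  simp [Finsupp.update_apply]
  rfl

theorem binaryForm_sub (x y : R) (n : ℕ) (P Q : R[X]) :
    binaryForm x y n (P - Q) = binaryForm x y n P - binaryForm x y n Q := by
  simp only [binaryForm_eq_sum, coeff_sub, sub_mul, Finset.sum_sub_distrib]

theorem binaryForm_mul (x y : R) {m n : ℕ} {P Q : R[X]} (hP : P.natDegree ≤ m)
    (hQ : Q.natDegree ≤ n) :
    binaryForm x y (m + n) (P * Q) = binaryForm x y m P * binaryForm x y n Q := by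
  rw [binaryForm, homogenize_mul _ _ hP hQ, map_mul]
  rfl

theorem mem_span_pair_pow_iff {x y : R} {n : ℕ} {z : R} :
    z ∈ Ideal.span {x, y} ^ n ↔ ∃ P : R[X], P.natDegree ≤ n ∧ binaryForm x y n P = z := by
  have hr : ({x, y} : Set R) = Set.range ![y, x] := by
    rw [Matrix.range_cons, Matrix.range_cons, Matrix.range_empty, Set.union_empty,
      Set.union_comm]
    rfl
  rw [hr, Ideal.mem_span_pow_iff_exists_isHomogeneous]
  constructor
  · rintro ⟨p, hp, rfl⟩
    set Q : R[X] := MvPolynomial.aeval ![X, 1] p with hQ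
    refine ⟨∑ i ∈ Finset.range (n + 1), monomial i (Q.coeff i),
      natDegree_sum_le_of_forall_le _ _ fun i hi =>
        (natDegree_monomial_le _).trans (Nat.lt_succ_iff.1 (Finset.mem_range.1 hi)), ?_⟩
    rw [← homogenize_eq_of_isHomogeneous hp rfl, ← hQ]
    change _ = binaryForm x y n Q
    simp only [binaryForm_eq_sum]
    refine Finset.sum_congr rfl fun i hi => ?_
    simp only [finsetSum_coeff, coeff_monomial, Finset.sum_ite_eq', if_pos hi]
  · rintro ⟨P, -, rfl⟩
    exact ⟨_, isHomogeneous_homogenize P, rfl⟩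

/-- In the chart y = xw a form of degree n splits off xⁿ; this relates the order at P to the order
along E. -/
theorem aeval_binaryForm {A : Type*} [CommRing A] [Algebra R A] {x y : R} {w : A}
    (hw : algebraMap R A y = algebraMap R A x * w) {n : ℕ} {P : R[X]} (hP : P.natDegree ≤ n) :
    algebraMap R A (binaryForm x y n P) = algebraMap R A x ^ n * aeval w P := by
  rw [binaryForm_eq_sum, map_sum, aeval_eq_sum_range' (Nat.lt_succ_of_le hP), Finset.mul_sum]
  refine Finset.sum_congr rfl fun i hi => ?_
  have hi : i ≤ n := Nat.lt_succ_iff.1 (Finset.mem_range.1 hi)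
  rw [map_mul, map_mul, map_pow, map_pow, hw, Algebra.smul_def, mul_pow,
    ← Nat.sub_add_cancel hi, pow_add, Nat.sub_add_cancel hi]
  ring

namespace IsRegularPair

variable [IsLocalRing R] {x y : R}

theorem mem_pow_iff (h : IsRegularPair x y) {n : ℕ} {z : R} :
    z ∈ maximalIdeal R ^ n ↔ ∃ P : R[X], P.natDegree ≤ n ∧ binaryForm x y n P = z := by
  rw [← h.span_eq, mem_span_pair_pow_iff]

theorem binaryForm_mem_pow (h : IsRegularPair x y) {n : ℕ} {P : R[X]} :
    binaryForm x y n P ∈ maximalIdeal R ^ n := by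
  rw [binaryForm_eq_sum]
  refine Ideal.sum_mem _ fun i hi => Ideal.mul_mem_left _ _ ?_
  rw [← Nat.add_sub_of_le (Nat.lt_succ_iff.1 (Finset.mem_range.1 hi)), pow_add,
    Nat.add_sub_of_le (Nat.lt_succ_iff.1 (Finset.mem_range.1 hi))]
  exact Ideal.mul_mem_mul (Ideal.pow_mem_pow h.right_mem _) (Ideal.pow_mem_pow h.left_mem _)

theorem exists_mem_pow_not_mem {z : R} {n : ℕ}
    (hz : z ∉ maximalIdeal R ^ (n + 1)) :
    ∃ k ≤ n, z ∈ maximalIdeal R ^ k ∧ z ∉ maximalIdeal R ^ (k + 1) := by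
  induction n with
  | zero => exact ⟨0, le_rfl, by simp, hz⟩
  | succ n ih =>
    by_cases h : z ∈ maximalIdeal R ^ (n + 1)
    · exact ⟨n + 1, le_rfl, h, hz⟩
    · obtain ⟨k, hk, h⟩ := ih h
      exact ⟨k, by lia, h⟩

variable [IsNoetherianRing R]

theorem exists_not_mem_pow {z : R} (hz : z ≠ 0) : ∃ n, z ∉ maximalIdeal R ^ (n + 1) := by
  by_contra! hc
  refine hz ?_
  have : z ∈ (⊥ : Ideal R) := mem_ideal_of_forall_mem_sup_pow _ _ fun n => by
    rw [bot_sup_eq]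
    exact Ideal.pow_le_pow_right n.le_succ (hc n)
  simpa using this

variable [IsDomain R]

/-- Quasi-regularity of the sequence x, y. Modulo the prime x only the pure power of y survives, so
its coefficient is divisible by x; then x is cancelled and the degree drops. -/
theorem coeff_mem_of_sum_eq_zero (h : IsRegularPair x y) (n : ℕ) (c : ℕ → R)
    (hc : ∑ i ∈ Finset.range (n + 1), c i * (y ^ i * x ^ (n - i)) = 0) :
    ∀ i ≤ n, c i ∈ maximalIdeal R := by
  induction n generalizing c with
  | zero =>
    intro i hi
    obtain rfl : i = 0 := by lia
    simp at hc
    simp [hc]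
  | succ n ih =>
    rw [Finset.sum_range_succ, Nat.sub_self, pow_zero, mul_one] at hc
    have hs : ∑ i ∈ Finset.range (n + 1), c i * (y ^ i * x ^ (n + 1 - i)) =
        x * ∑ i ∈ Finset.range (n + 1), c i * (y ^ i * x ^ (n - i)) := by
      rw [Finset.mul_sum]
      refine Finset.sum_congr rfl fun i hi => ?_
      rw [Nat.succ_sub (Nat.lt_succ_iff.1 (Finset.mem_range.1 hi)), pow_succ]
      ring
    rw [hs] at hc
    have hd : x ∣ c (n + 1) := by
      have h1 : x ∣ c (n + 1) * y ^ (n + 1) := (Dvd.intro _ rfl).trans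
        (⟨-1, by linear_combination hc⟩ : x * ∑ i ∈ Finset.range (n + 1),
          c i * (y ^ i * x ^ (n - i)) ∣ c (n + 1) * y ^ (n + 1))
      refine (h.prime_left.dvd_or_dvd h1).resolve_right fun h2 => h.pow_not_mem (n + 1) ?_
      exact Ideal.mem_span_singleton.2 h2
    obtain ⟨d, hd⟩ := hd
    -- With c (n + 1) = xd, the term d yⁿ⁺¹ left after cancelling x is absorbed into the coefficient
    -- of yⁿ.
    have key := ih (fun i => if i = n then c n + d * y else c i) (by
      refine (mul_eq_zero.1 (?_ : x * _ = 0)).resolve_left h.left_ne_zero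
      rw [← hc, hd, Finset.sum_range_succ, Finset.sum_range_succ]
      have : ∑ i ∈ Finset.range n, (if i = n then c n + d * y else c i) * (y ^ i * x ^ (n - i)) =
          ∑ i ∈ Finset.range n, c i * (y ^ i * x ^ (n - i)) :=
        Finset.sum_congr rfl fun i hi => by rw [if_neg (Finset.mem_range.1 hi).ne]
      rw [this]
      simp
      ring)
    intro i hi
    rcases Nat.lt_or_eq_of_le hi with hi | rfl
    · have := key i (by lia)
      split_ifs at this with hin
      · subst hin
        exact (Ideal.add_mem_iff_left _ (Ideal.mul_mem_left _ _ h.right_mem)).1 this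
      · exact this
    · rw [hd]
      exact Ideal.mul_mem_right _ _ h.left_mem

theorem coeff_mem_of_binaryForm_eq_zero (h : IsRegularPair x y) {n : ℕ} {P : R[X]}
    (hP : P.natDegree ≤ n) (h0 : binaryForm x y n P = 0) :
    P ∈ (maximalIdeal R).map (C : R →+* R[X]) := by
  rw [Ideal.mem_map_C_iff]
  intro i
  by_cases hi : i ≤ n
  · rw [binaryForm_eq_sum] at h0
    exact h.coeff_mem_of_sum_eq_zero n _ h0 i hi
  · rw [coeff_eq_zero_of_natDegree_lt (by lia)]
    exact zero_mem _

/-- The associated graded ring is a polynomial ring in two variables over the residue field. An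
element of the (n+1)-st power is also a form of degree n with coefficients in the maximal ideal, and
two representations differ by a relation. -/
theorem binaryForm_mem_pow_succ_iff (h : IsRegularPair x y) {n : ℕ} {P : R[X]}
    (hP : P.natDegree ≤ n) : binaryForm x y n P ∈ maximalIdeal R ^ (n + 1) ↔
      P ∈ (maximalIdeal R).map (C : R →+* R[X]) := by
  constructor
  · intro hz
    obtain ⟨Q, hQ, hQz⟩ : ∃ Q : R[X], Q.natDegree ≤ n ∧
        binaryForm x y n Q = binaryForm x y n P ∧ Q ∈ (maximalIdeal R).map (C : R →+* R[X]) := by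
      generalize binaryForm x y n P = z at hz
      rw [pow_succ'] at hz
      refine Submodule.mul_induction_on hz ?_ ?_
      · intro a ha b hb
        obtain ⟨Q, hQ, rfl⟩ := h.mem_pow_iff.1 hb
        refine ⟨C a * Q, (natDegree_C_mul_le _ _).trans hQ, ?_,
          Ideal.mul_mem_right _ _ (Ideal.mem_map_of_mem _ ha)⟩
        simp only [binaryForm_eq_sum, coeff_C_mul, Finset.mul_sum, mul_assoc]
      · rintro _ _ ⟨Q, hQ, rfl, hQm⟩ ⟨Q', hQ', rfl, hQm'⟩
        refine ⟨Q + Q', natDegree_add_le_of_degree_le hQ hQ', ?_, Ideal.add_mem _ hQm hQm'⟩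
        simp only [binaryForm_eq_sum, coeff_add, add_mul, Finset.sum_add_distrib]
    have := h.coeff_mem_of_binaryForm_eq_zero (max_self n ▸ natDegree_sub_le_of_le hP hQ)
      (by rw [binaryForm_sub, hQz.1, sub_self])
    simpa using Ideal.add_mem _ this hQz.2
  · intro hP'
    rw [Ideal.mem_map_C_iff] at hP'
    rw [binaryForm_eq_sum, pow_succ']
    refine Ideal.sum_mem _ fun i hi => Ideal.mul_mem_mul (hP' i) ?_
    rw [← Nat.add_sub_of_le (Nat.lt_succ_iff.1 (Finset.mem_range.1 hi)), pow_add,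
      Nat.add_sub_of_le (Nat.lt_succ_iff.1 (Finset.mem_range.1 hi))]
    exact Ideal.mul_mem_mul (Ideal.pow_mem_pow h.right_mem _) (Ideal.pow_mem_pow h.left_mem _)

/-- The order of vanishing is additive. -/
theorem mul_not_mem_pow (h : IsRegularPair x y) {m n : ℕ} {a b : R}
    (ha : a ∉ maximalIdeal R ^ (m + 1)) (hb : b ∉ maximalIdeal R ^ (n + 1)) :
    a * b ∉ maximalIdeal R ^ (m + n + 1) := by
  obtain ⟨k, hk, hak, hak'⟩ := exists_mem_pow_not_mem ha
  obtain ⟨l, hl, hbl, hbl'⟩ := exists_mem_pow_not_mem hb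
  obtain ⟨P, hP, rfl⟩ := h.mem_pow_iff.1 hak
  obtain ⟨Q, hQ, rfl⟩ := h.mem_pow_iff.1 hbl
  rw [h.binaryForm_mem_pow_succ_iff hP] at hak'
  rw [h.binaryForm_mem_pow_succ_iff hQ] at hbl'
  intro hc
  have hc := Ideal.pow_le_pow_right (show k + l + 1 ≤ m + n + 1 by lia) hc
  rw [← binaryForm_mul x y hP hQ,
    h.binaryForm_mem_pow_succ_iff (natDegree_mul_le_of_le hP hQ)] at hc
  -- Leading forms multiply to a nonzero form because polynomials over the residue field have no
  -- zero divisors.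
  have := Ideal.isPrime_map_C_of_isPrime (P := maximalIdeal R)
  exact (this.mem_or_mem hc).elim hak' hbl'

end IsRegularPair

end Forms

/-! ### Derivations and reduced curve germs in characteristic zero. -/

section Derivations

open IsLocalRing

variable {k R : Type*} [CommRing k] [CommRing R] [Algebra k R]

theorem Derivation.apply_mem_pow (d : Derivation k R R) (I : Ideal R) (n : ℕ) {z : R}
    (hz : z ∈ I ^ (n + 1)) : d z ∈ I ^ n := by
  induction n generalizing z with
  | zero => simp
  | succ n ih =>
    rw [pow_succ'] at hz
    refine Submodule.mul_induction_on hz (fun a ha b hb => ?_) fun a b ha hb => ?_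
    · rw [d.leibniz, smul_eq_mul, smul_eq_mul]
      refine Ideal.add_mem _ ?_ (Ideal.mul_mem_right _ _ hb)
      rw [pow_succ']
      exact Ideal.mul_mem_mul ha (ih hb)
    · rw [map_add]
      exact Ideal.add_mem _ ha hb

/-- A derivation that scales two elements scales the powers of the ideal they generate, to first
order. -/
theorem Derivation.sub_natCast_mul_mem_pow (E : Derivation k R R) {x y : R} (hx : E x = x)
    (hy : E y = y) (hE : ∀ z, E z ∈ Ideal.span {x, y}) (n : ℕ) {z : R}
    (hz : z ∈ Ideal.span {x, y} ^ n) : E z - n * z ∈ Ideal.span {x, y} ^ (n + 1) := by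
  induction n generalizing z with
  | zero => simpa using hE z
  | succ n ih =>
    rw [pow_succ'] at hz
    refine Submodule.mul_induction_on hz (fun a ha b hb => ?_) fun a b ha hb => ?_
    · have ha' : E a - a ∈ Ideal.span {x, y} ^ 2 := by
        obtain ⟨c, d, rfl⟩ := Ideal.mem_span_pair.1 ha
        have : E (c * x + d * y) - (c * x + d * y) = E c * x + E d * y := by
          simp only [map_add, E.leibniz, smul_eq_mul, hx, hy]
          ring
        rw [this, pow_two]
        exact Ideal.add_mem _ (Ideal.mul_mem_mul (hE c) (Ideal.subset_span (by simp)))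
          (Ideal.mul_mem_mul (hE d) (Ideal.subset_span (by simp)))
      have : E (a * b) - ((n + 1 : ℕ) : R) * (a * b) = a * (E b - n * b) + (E a - a) * b := by
        rw [E.leibniz, smul_eq_mul, smul_eq_mul]
        push_cast
        ring
      rw [this]
      refine Ideal.add_mem _ ?_ ?_
      · rw [pow_succ']
        exact Ideal.mul_mem_mul ha (ih hb)
      · rw [show n + 1 + 1 = 2 + n by ring, pow_add]
        exact Ideal.mul_mem_mul ha' hb
    · rw [map_add, mul_add, add_sub_add_comm]
      exact Ideal.add_mem _ ha hb

namespace IsRegularPair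

variable [IsLocalRing R] [IsNoetherianRing R] {x y : R}

/-- By Nakayama. Unlike `not_le`, this depends on f only modulo the (n+1)-st power, so it can be
tested on approximations. -/
theorem not_pow_le_sup (h : IsRegularPair x y) {f : R} (hf : f ∈ maximalIdeal R) (n : ℕ) :
    ¬ maximalIdeal R ^ n ≤ Ideal.span {f} ⊔ maximalIdeal R ^ (n + 1) := by
  intro hle
  rw [pow_succ'] at hle
  exact h.not_le f hf n (Submodule.le_of_le_smul_of_le_jacobson_bot
    (IsNoetherian.noetherian _) (maximalIdeal_le_jacobson _) hle)

variable [Algebra ℚ R]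

/-- The Euler derivation x d₁ + y d₂ multiplies the leading form of p, of degree M > 0, by M. If p
divided both of its partial derivatives, the Euler derivative would vanish to order M + 1, and so
would p, since M is invertible. -/
theorem not_dvd_derivation (h : IsRegularPair x y) {d₁ d₂ : Derivation k R R}
    (h₁x : d₁ x = 1) (h₁y : d₁ y = 0) (h₂x : d₂ x = 0) (h₂y : d₂ y = 1) {p : R} (hp : Prime p)
    (hd₁ : p ∣ d₁ p) (hd₂ : p ∣ d₂ p) : False := by
  obtain ⟨n, hn⟩ := exists_not_mem_pow hp.ne_zero
  obtain ⟨M, -, hM, hM'⟩ := exists_mem_pow_not_mem hn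
  have hM0 : M ≠ 0 := by
    rintro rfl
    rw [zero_add, pow_one] at hM'
    exact hM' hp.not_isUnit
  refine hM' ?_
  set E : Derivation k R R := x • d₁ + y • d₂ with hE
  have hE' : ∀ z, E z = x * d₁ z + y * d₂ z := fun z => by simp [hE]
  have key := E.sub_natCast_mul_mem_pow (x := x) (y := y) (by simp [hE', h₁x, h₂x])
    (by simp [hE', h₁y, h₂y]) (fun z => ?_) M (z := p) (by rwa [h.span_eq])
  · rw [h.span_eq] at key
    obtain ⟨r, hr⟩ := hd₁
    obtain ⟨s, hs⟩ := hd₂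
    have hEp : E p ∈ maximalIdeal R ^ (M + 1) := by
      have : E p = (x * r + y * s) * p := by rw [hE', hr, hs]; ring
      rw [this, pow_succ']
      exact Ideal.mul_mem_mul (Ideal.add_mem _ (Ideal.mul_mem_right _ _ h.left_mem)
        (Ideal.mul_mem_right _ _ h.right_mem)) hM
    rw [← Ideal.neg_mem_iff, neg_sub] at key
    have := Ideal.add_mem _ key hEp
    rw [sub_add_cancel] at this
    refine (Ideal.unit_mul_mem_iff_mem _ ?_).1 this
    rw [← map_natCast (algebraMap ℚ R)]
    exact (IsUnit.mk0 _ (by exact_mod_cast hM0)).map _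
  · rw [hE']
    exact Ideal.add_mem _ (Ideal.mul_mem_right _ _ (Ideal.subset_span (by simp)))
      (Ideal.mul_mem_right _ _ (Ideal.subset_span (by simp)))

/-- The singular locus of a reduced curve germ is a point. -/
theorem exists_pow_le_span_derivation (h : IsRegularPair x y) {d₁ d₂ : Derivation k R R}
    (h₁x : d₁ x = 1) (h₁y : d₁ y = 0) (h₂x : d₂ x = 0) (h₂y : d₂ y = 1) {b : R} (hb0 : b ≠ 0)
    (hb : Squarefree b) : ∃ n, maximalIdeal R ^ n ≤ Ideal.span {b, d₁ b, d₂ b} := by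
  refine Ideal.exists_pow_le_of_le_radical_of_fg ?_ (IsNoetherian.noetherian _)
  rw [Ideal.radical_eq_sInf, le_sInf_iff]
  rintro q ⟨hq, hqp⟩
  rcases h.eq_maximalIdeal_or_exists q with rfl | ⟨p, rfl⟩
  · exact le_rfl
  exfalso
  simp only [Ideal.span_le, Set.insert_subset_iff, Set.singleton_subset_iff, SetLike.mem_coe,
    Ideal.mem_span_singleton] at hq
  obtain ⟨hpb, h1, h2⟩ := hq
  have hp0 : p ≠ 0 := by
    rintro rfl
    exact hb0 (zero_dvd_iff.1 hpb)
  have hp : Prime p := (Ideal.span_singleton_prime hp0).1 hqp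
  obtain ⟨c, rfl⟩ := hpb
  have hpc : ¬ p ∣ c := fun hc => hp.not_isUnit (hb p (mul_dvd_mul_left p hc))
  -- In d(pc) = p dc + c dp the factor c is prime to p, because b = pc is squarefree.
  have aux : ∀ d : Derivation k R R, p ∣ d (p * c) → p ∣ d p := fun d hd => by
    rw [d.leibniz, smul_eq_mul, smul_eq_mul, dvd_add_right (Dvd.intro _ rfl)] at hd
    exact (hp.dvd_or_dvd hd).resolve_left hpc
  exact h.not_dvd_derivation h₁x h₁y h₂x h₂y hp (aux _ h1) (aux _ h2)

/-- A reduced curve germ is not close to a non-reduced one. -/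
theorem exists_sub_sq_mul_not_mem_pow (h : IsRegularPair x y) {d₁ d₂ : Derivation k R R}
    (h₁x : d₁ x = 1) (h₁y : d₁ y = 0) (h₂x : d₂ x = 0) (h₂y : d₂ y = 1) {b : R} (hb0 : b ≠ 0)
    (hb : Squarefree b) :
    ∃ N, ∀ f ∈ maximalIdeal R, ∀ g, b - f ^ 2 * g ∉ maximalIdeal R ^ N := by
  obtain ⟨n, hn⟩ := h.exists_pow_le_span_derivation h₁x h₁y h₂x h₂y hb0 hb
  -- A derivation costs one order: if b ≡ f²g to order n + 2, then b, d₁b and d₂b are multiples of f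
  -- to order n + 1, against `not_pow_le_sup`.
  refine ⟨n + 2, fun f hf g hbf => h.not_pow_le_sup hf n (hn.trans ?_)⟩
  have aux : ∀ d : Derivation k R R, d b ∈ Ideal.span {f} ⊔ maximalIdeal R ^ (n + 1) := by
    intro d
    have h1 := d.apply_mem_pow _ _ hbf
    have : d b = f * (2 * g * d f + f * d g) + d (b - f ^ 2 * g) := by
      rw [map_sub, d.leibniz, pow_two, d.leibniz]
      simp only [smul_eq_mul]
      ring
    rw [this]
    exact Submodule.add_mem_sup (Ideal.mul_mem_right _ _ (Ideal.mem_span_singleton_self _)) h1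
  simp only [Ideal.span_le, Set.insert_subset_iff, Set.singleton_subset_iff, SetLike.mem_coe]
  refine ⟨?_, aux _, aux _⟩
  have : b = f * (f * g) + (b - f ^ 2 * g) := by ring
  rw [this]
  exact Submodule.add_mem_sup (Ideal.mul_mem_right _ _ (Ideal.mem_span_singleton_self _))
    (Ideal.pow_le_pow_right (Nat.le_succ _) hbf)

end IsRegularPair

end Derivations

/-! ### Transfer to the completed local ring. -/

section Completion

open IsLocalRing

/-- `D` is a completion of the local ring `R`. -/
structure IsLocalCompletion (R D : Type*) [CommRing R] [IsLocalRing R] [CommRing D] [IsLocalRing D]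
    [Algebra R D] : Prop where
  map_eq : (maximalIdeal R).map (algebraMap R D) = maximalIdeal D
  exists_sub_mem : ∀ (z : D) (n : ℕ), ∃ r, z - algebraMap R D r ∈ maximalIdeal D ^ n
  mem_of_algebraMap_mem : ∀ (r : R) (n : ℕ), algebraMap R D r ∈ maximalIdeal D ^ n →
    r ∈ maximalIdeal R ^ n
  isAdicComplete : IsAdicComplete (maximalIdeal D) D

theorem isLocalCompletion_adicCompletion (R : Type*) [CommRing R] [IsLocalRing R]
    [IsNoetherianRing R] : IsLocalCompletion R (AdicCompletion (maximalIdeal R) R) := by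
  have hker : ∀ (z : AdicCompletion (maximalIdeal R) R) (n : ℕ),
      AdicCompletion.eval (maximalIdeal R) R n z = 0 ↔
        z ∈ maximalIdeal (AdicCompletion (maximalIdeal R) R) ^ n := by
    intro z n
    rw [AdicCompletion.maximalIdeal_eq_map, ← Ideal.map_pow,
      ← Submodule.restrictScalars_mem R, ← Ideal.smul_top_eq_map,
      AdicCompletion.pow_smul_top_eq_ker_eval (maximalIdeal R).fg_of_isNoetherianRing]
    rfl
  refine ⟨AdicCompletion.maximalIdeal_eq_map.symm, fun z n => ?_, fun r n hr => ?_,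
    inferInstance⟩
  · obtain ⟨r, hr⟩ := Submodule.Quotient.mk_surjective _ (AdicCompletion.eval (maximalIdeal R) R n z)
    refine ⟨r, (hker _ _).1 ?_⟩
    rw [map_sub, ← hr, sub_eq_zero]
    rfl
  · rw [← hker] at hr
    have : (Submodule.Quotient.mk r : R ⧸ (maximalIdeal R ^ n • ⊤ : Ideal R)) = 0 := hr
    simpa using (Submodule.Quotient.mk_eq_zero _).1 this

namespace IsLocalCompletion

variable {R D : Type*} [CommRing R] [IsLocalRing R] [CommRing D] [IsLocalRing D] [Algebra R D]

theorem algebraMap_mem (hD : IsLocalCompletion R D) {r : R} {n : ℕ} (hr : r ∈ maximalIdeal R ^ n) :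
    algebraMap R D r ∈ maximalIdeal D ^ n := by
  rw [← hD.map_eq, ← Ideal.map_pow]
  exact Ideal.mem_map_of_mem _ hr

theorem eq_zero (hD : IsLocalCompletion R D) {z : D} (hz : ∀ n, z ∈ maximalIdeal D ^ n) :
    z = 0 := by
  have := hD.isAdicComplete
  exact IsHausdorff.haus' (I := maximalIdeal D) z fun n => by
    rw [SModEq.zero]
    simpa using hz n

variable [IsNoetherianRing R] [IsDomain R] {x y : R}

theorem mul_not_mem_pow (hD : IsLocalCompletion R D) (h : IsRegularPair x y) {m n : ℕ} {a b : D}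
    (ha : a ∉ maximalIdeal D ^ (m + 1)) (hb : b ∉ maximalIdeal D ^ (n + 1)) :
    a * b ∉ maximalIdeal D ^ (m + n + 1) := by
  obtain ⟨a', ha'⟩ := hD.exists_sub_mem a (m + n + 1)
  obtain ⟨b', hb'⟩ := hD.exists_sub_mem b (m + n + 1)
  intro hab
  refine h.mul_not_mem_pow (m := m) (n := n) (a := a') (b := b') (fun hc => ha ?_)
    (fun hc => hb ?_) (hD.mem_of_algebraMap_mem _ _ ?_)
  · have := Ideal.add_mem _ (Ideal.pow_le_pow_right (by lia) ha') (hD.algebraMap_mem hc)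
    rwa [sub_add_cancel] at this
  · have := Ideal.add_mem _ (Ideal.pow_le_pow_right (by lia) hb') (hD.algebraMap_mem hc)
    rwa [sub_add_cancel] at this
  · have : algebraMap R D (a' * b') = a * b - ((a - algebraMap R D a') * b +
      algebraMap R D a' * (b - algebraMap R D b')) := by rw [map_mul]; ring
    rw [this]
    exact Ideal.sub_mem _ hab (Ideal.add_mem _ (Ideal.mul_mem_right _ _ ha')
      (Ideal.mul_mem_left _ _ hb'))

theorem isDomain (hD : IsLocalCompletion R D) (h : IsRegularPair x y) : IsDomain D := by
  have : NoZeroDivisors D := ⟨fun {a b} hab => by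
    by_contra! hc
    obtain ⟨m, hm⟩ : ∃ m, a ∉ maximalIdeal D ^ m := by
      by_contra! h'
      exact hc.1 (hD.eq_zero h')
    obtain ⟨n, hn⟩ : ∃ n, b ∉ maximalIdeal D ^ n := by
      by_contra! h'
      exact hc.2 (hD.eq_zero h')
    refine hD.mul_not_mem_pow h (m := m) (n := n) (fun h' => hm ?_) (fun h' => hn ?_)
      (hab ▸ zero_mem _)
    · exact Ideal.pow_le_pow_right (Nat.le_succ _) h'
    · exact Ideal.pow_le_pow_right (Nat.le_succ _) h'⟩
  exact NoZeroDivisors.to_isDomain D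

theorem not_pow_le (hD : IsLocalCompletion R D) (h : IsRegularPair x y) {f : D}
    (hf : f ∈ maximalIdeal D) (n : ℕ) : ¬ maximalIdeal D ^ n ≤ Ideal.span {f} := by
  intro hle
  obtain ⟨f', hf'⟩ := hD.exists_sub_mem f (n + 1)
  have hf'm : f' ∈ maximalIdeal R := by
    rw [← pow_one (maximalIdeal R)]
    refine hD.mem_of_algebraMap_mem _ _ ?_
    rw [pow_one]
    have := Ideal.sub_mem _ hf (Ideal.pow_le_self (Nat.succ_ne_zero _) hf')
    rwa [sub_sub_cancel] at this
  refine h.not_pow_le_sup hf'm n fun z hz => ?_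
  obtain ⟨w, hw⟩ := Ideal.mem_span_singleton'.1 (hle (hD.algebraMap_mem hz))
  obtain ⟨w', hw'⟩ := hD.exists_sub_mem w (n + 1)
  have hz' : z - w' * f' ∈ maximalIdeal R ^ (n + 1) := by
    refine hD.mem_of_algebraMap_mem _ _ ?_
    have : algebraMap R D (z - w' * f') = (w - algebraMap R D w') * f +
      algebraMap R D w' * (f - algebraMap R D f') := by rw [map_sub, ← hw, map_mul]; ring
    rw [this]
    exact Ideal.add_mem _ (Ideal.mul_mem_right _ _ hw') (Ideal.mul_mem_left _ _ hf')
  have := Submodule.add_mem_sup (Ideal.mul_mem_left (Ideal.span {f'}) w'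
    (Ideal.mem_span_singleton_self f')) hz'
  rwa [add_sub_cancel] at this

/-- An element of order one has a unit coefficient at one of the two parameters and can replace it.
-/
theorem exists_isRegularPair (hD : IsLocalCompletion R D) (h : IsRegularPair x y) {f : D}
    (hf : f ∈ maximalIdeal D) (hf' : f ∉ maximalIdeal D ^ 2) : ∃ g : D, IsRegularPair f g := by
  have hspan : maximalIdeal D = Ideal.span {algebraMap R D x, algebraMap R D y} := by
    rw [← hD.map_eq, ← h.span_eq, Ideal.map_span, Set.image_pair]
  have aux : ∀ (s t a b : D), maximalIdeal D = Ideal.span {s, t} → f = a * s + b * t →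
      a ∉ maximalIdeal D → IsRegularPair f t := by
    intro s t a b hst hfa ha
    have hu : IsUnit a := by simpa using ha
    refine ⟨le_antisymm ?_ ?_, fun f hf n => hD.not_pow_le h hf n⟩
    · rw [Ideal.span_le, Set.pair_subset_iff]
      exact ⟨hf, hst ▸ Ideal.subset_span (by simp)⟩
    · rw [hst, Ideal.span_le, Set.pair_subset_iff]
      refine ⟨?_, Ideal.subset_span (by simp)⟩
      rw [SetLike.mem_coe, ← Ideal.unit_mul_mem_iff_mem _ hu, eq_sub_of_add_eq hfa.symm]
      exact Ideal.sub_mem _ (Ideal.subset_span (by simp))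
        (Ideal.mul_mem_left _ _ (Ideal.subset_span (by simp)))
  obtain ⟨a, b, hab⟩ := Ideal.mem_span_pair.1 (hspan ▸ hf)
  by_cases ha : a ∈ maximalIdeal D
  · refine ⟨_, aux (algebraMap R D y) (algebraMap R D x) b a (by rw [hspan, Set.pair_comm]) (by rw [← hab, add_comm])
      fun hb => hf' ?_⟩
    rw [← hab, pow_two]
    refine Ideal.add_mem _ (Ideal.mul_mem_mul ha ?_) (Ideal.mul_mem_mul hb ?_)
    · exact hspan ▸ Ideal.subset_span (by simp)
    · exact hspan ▸ Ideal.subset_span (by simp)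
  · exact ⟨_, aux _ _ a b hspan hab.symm ha⟩

/-- Closedness of (f) from completeness: multiplication by f raises orders by at most one, so
approximate quotients form a Cauchy sequence, whose limit is a quotient. -/
theorem mem_span_of_forall (hD : IsLocalCompletion R D) (h : IsRegularPair x y) {f : D}
    (hf' : f ∉ maximalIdeal D ^ 2) {z : D}
    (hz : ∀ n : ℕ, z ∈ Ideal.span {f} ⊔ maximalIdeal D ^ n) : z ∈ Ideal.span {f} := by
  have := hD.isAdicComplete
  -- The extra order n + 1 makes up for the one lost on dividing by f.
  have hz' : ∀ n, ∃ w, z - w * f ∈ maximalIdeal D ^ (n + 1) := by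
    intro n
    obtain ⟨a, ha, b, hb, rfl⟩ := Submodule.mem_sup.1 (hz (n + 1))
    obtain ⟨w, rfl⟩ := Ideal.mem_span_singleton'.1 ha
    exact ⟨w, by rwa [add_sub_cancel_left]⟩
  choose w hw using hz'
  have hcauchy : ∀ {m n : ℕ}, m ≤ n → w m ≡ w n [SMOD (maximalIdeal D ^ m • ⊤ : Ideal D)] := by
    intro m n hmn
    rw [SModEq.sub_mem]
    suffices w m - w n ∈ maximalIdeal D ^ m by simpa using this
    rcases m with - | m
    · simp
    by_contra hc
    refine hD.mul_not_mem_pow h hc hf' ?_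
    have := Ideal.sub_mem _ (Ideal.pow_le_pow_right (by lia) (hw n)) (hw (m + 1))
    convert! this using 1
    ring
  obtain ⟨L, hL⟩ := IsPrecomplete.prec' (I := maximalIdeal D) w hcauchy
  rw [Ideal.mem_span_singleton']
  refine ⟨L, (sub_eq_zero.1 (hD.eq_zero fun n => ?_)).symm⟩
  have h1 := hL n
  rw [SModEq.sub_mem] at h1
  have h1 : w n - L ∈ maximalIdeal D ^ n := by simpa using h1
  have : z - L * f = (z - w n * f) + (w n - L) * f := by ring
  rw [this]
  exact Ideal.add_mem _ (Ideal.pow_le_pow_right (Nat.le_succ _) (hw n)) (Ideal.mul_mem_right _ _ h1)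

theorem prime (hD : IsLocalCompletion R D) (h : IsRegularPair x y) {f : D}
    (hf : f ∈ maximalIdeal D) (hf' : f ∉ maximalIdeal D ^ 2) : Prime f := by
  obtain ⟨g, hg⟩ := hD.exists_isRegularPair h hf hf'
  exact hg.prime_left_of_closed fun z hz => hD.mem_span_of_forall h hf' hz

/-- If a germ has only two analytic branches, both smooth, then the multiplicity of a factor
without analytic multiple components is at most two. -/
theorem not_mem_pow_three_of_mul_eq (hD : IsLocalCompletion R D) (h : IsRegularPair x y)
    {f g u : D} (hf : f ∈ maximalIdeal D) (hf' : f ∉ maximalIdeal D ^ 2)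
    (hg : g ∈ maximalIdeal D) (hg' : g ∉ maximalIdeal D ^ 2) (hu : IsUnit u) {m n : ℕ} {b c : R}
    (hbc : algebraMap R D (b * c) = u * f ^ m * g ^ n)
    (hb : ∃ N, ∀ f ∈ maximalIdeal R, ∀ g, b - f ^ 2 * g ∉ maximalIdeal R ^ N) :
    b ∉ maximalIdeal R ^ 3 := by
  have := hD.isDomain h
  obtain ⟨N, hN⟩ := hb
  -- An analytic square factor of b, truncated to elements of R, would give an approximation of b
  -- excluded by `hb`.
  have hsq : ∀ f ∈ maximalIdeal D, ∀ g, algebraMap R D b ≠ f ^ 2 * g := by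
    intro f hf g hfg
    obtain ⟨f', hf'⟩ := hD.exists_sub_mem f (N + 1)
    obtain ⟨g', hg'⟩ := hD.exists_sub_mem g (N + 1)
    have hf'm : f' ∈ maximalIdeal R := by
      rw [← pow_one (maximalIdeal R)]
      refine hD.mem_of_algebraMap_mem _ _ ?_
      rw [pow_one]
      have := Ideal.sub_mem _ hf (Ideal.pow_le_self (Nat.succ_ne_zero _) hf')
      rwa [sub_sub_cancel] at this
    refine hN f' hf'm g' (hD.mem_of_algebraMap_mem _ _ ?_)
    refine Ideal.pow_le_pow_right (Nat.le_succ _) ?_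
    have : algebraMap R D (b - f' ^ 2 * g') = (f - algebraMap R D f') *
        ((f + algebraMap R D f') * g) + algebraMap R D f' ^ 2 * (g - algebraMap R D g') := by
      rw [map_sub, map_mul, map_pow, hfg]
      ring
    rw [this]
    exact Ideal.add_mem _ (Ideal.mul_mem_right _ _ hf') (Ideal.mul_mem_left _ _ hg')
  rw [map_mul] at hbc
  -- As g and f are prime, b is a unit times f^i g^j. By `hsq` both exponents are at most one, so b
  -- has order at most two.
  obtain ⟨j, j', b₁, c₁, -, h₁, hb₁, -⟩ := mul_eq_mul_prime_pow (hD.prime h hg hg') hbc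
  obtain ⟨i, i', b₂, c₂, -, h₂, hb₂, -⟩ := mul_eq_mul_prime_pow (hD.prime h hf hf') h₁.symm
  have hb₂u : IsUnit b₂ := isUnit_of_mul_isUnit_left (h₂ ▸ hu)
  have hone : (1 : D) ∉ maximalIdeal D := (Ideal.ne_top_iff_one _).1 (Ideal.IsPrime.ne_top')
  have hpow : ∀ (f : D) (i : ℕ), f ∉ maximalIdeal D ^ 2 → i ≤ 1 →
      f ^ i ∉ maximalIdeal D ^ (1 + 1) := by
    intro f i hf hi
    interval_cases i
    · rw [pow_zero]
      exact fun hc => hone (Ideal.pow_le_self two_ne_zero hc)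
    · rwa [pow_one]
  have hi : i ≤ 1 := by
    by_contra! hc
    obtain ⟨i, rfl⟩ := Nat.exists_eq_add_of_le (show 2 ≤ i by lia)
    exact hsq f hf (b₂ * f ^ i * g ^ j) (by rw [hb₁, hb₂]; ring)
  have hj : j ≤ 1 := by
    by_contra! hc
    obtain ⟨j, rfl⟩ := Nat.exists_eq_add_of_le (show 2 ≤ j by lia)
    exact hsq g hg (b₁ * g ^ j) (by rw [hb₁]; ring)
  have hb₂' : b₂ ∉ maximalIdeal D ^ (0 + 1) := by
    rw [zero_add, pow_one]
    simpa using hb₂u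
  have key := hD.mul_not_mem_pow h (hD.mul_not_mem_pow h hb₂' (hpow f i hf' hi)) (hpow g j hg' hj)
  rw [← hb₂, ← hb₁] at key
  exact fun hc => key (hD.algebraMap_mem hc)

end IsLocalCompletion

end Completion

/-! ### The rounding inequality and the valuation of the exceptional curve. -/

section ExceptionalValuation

open IsLocalRing Polynomial

/-- The numerical core, with c the coefficients and μ the multiplicities at P. Each round up adds
less than 1, so if some μ is nonzero the left side is strictly less than 2 plus the round up on the
right; for integers this gains one. -/
theorem sum_ceil_mul_le {ι : Type*} (s : Finset ι) (c μ : ι → ℕ) (hμ : ∑ i ∈ s, μ i ≤ 2) {t : ℝ}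
    (ht : 0 ≤ t) :
    ∑ i ∈ s, ⌈t * (c i : ℝ)⌉₊ * μ i ≤ 1 + ⌈t * ((∑ i ∈ s, c i * μ i : ℕ) : ℝ)⌉₊ := by
  by_cases h0 : ∀ i ∈ s, μ i = 0
  · rw [Finset.sum_eq_zero fun i hi => by rw [h0 i hi, mul_zero]]
    exact Nat.zero_le _
  push Not at h0
  obtain ⟨j, hj, hj0⟩ := h0
  have hlt : (∑ i ∈ s, (⌈t * (c i : ℝ)⌉₊ : ℝ) * μ i) < ∑ i ∈ s, (t * c i + 1) * (μ i : ℝ) := by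
    refine Finset.sum_lt_sum (fun i _ => ?_) ⟨j, hj, ?_⟩
    · exact mul_le_mul_of_nonneg_right (Nat.ceil_lt_add_one (by positivity)).le (by positivity)
    · exact mul_lt_mul_of_pos_right (Nat.ceil_lt_add_one (by positivity))
        (by exact_mod_cast Nat.pos_of_ne_zero hj0)
  have heq : ∑ i ∈ s, (t * c i + 1) * (μ i : ℝ) =
      t * ((∑ i ∈ s, c i * μ i : ℕ) : ℝ) + ((∑ i ∈ s, μ i : ℕ) : ℝ) := by
    push_cast
    rw [Finset.mul_sum, ← Finset.sum_add_distrib]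
    exact Finset.sum_congr rfl fun i _ => by ring
  have h1 := Nat.le_ceil (t * ((∑ i ∈ s, c i * μ i : ℕ) : ℝ))
  have h2 : ((∑ i ∈ s, μ i : ℕ) : ℝ) ≤ 2 := by exact_mod_cast hμ
  have : ((∑ i ∈ s, ⌈t * (c i : ℝ)⌉₊ * μ i : ℕ) : ℝ) <
      ((2 + ⌈t * ((∑ i ∈ s, c i * μ i : ℕ) : ℝ)⌉₊ : ℕ) : ℝ) := by
    push_cast at *
    linarith
  have := Nat.cast_lt.1 this
  lia

section DVR

variable {A : Type*} [CommRing A] [IsDomain A]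

theorem isDiscreteValuationRing_of_forall {ϖ : A} (hϖ : Irreducible ϖ)
    (h : ∀ z : A, z ≠ 0 → ∃ (n : ℕ) (u : A), IsUnit u ∧ z = u * ϖ ^ n) :
    IsDiscreteValuationRing A := by
  refine IsDiscreteValuationRing.ofHasUnitMulPowIrreducibleFactorization ⟨ϖ, hϖ, fun {z} hz => ?_⟩
  obtain ⟨n, u, hu, rfl⟩ := h z hz
  exact ⟨n, hu.unit, by rw [IsUnit.unit_spec, mul_comm]⟩

theorem ord_mul_pow [IsDiscreteValuationRing A] {ϖ u : A} (hϖ : Irreducible ϖ) (hu : IsUnit u)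
    (n : ℕ) : Ring.ord A (u * ϖ ^ n) = n := by
  rw [Ring.ord_mul_of_isUnit_left hu, Ring.ord_pow (mem_nonZeroDivisors_of_ne_zero hϖ.ne_zero),
    Ring.ord_of_irreducible hϖ, nsmul_eq_mul, mul_one]

end DVR

/-- A local ring of dimension one of the blow-up, at a point of the exceptional divisor: it is
obtained from `R` by adjoining `w = y / x` and localizing. -/
structure IsExceptionalChart {R A : Type*} [CommRing R] [IsLocalRing R] [CommRing A] [IsDomain A]
    [IsLocalRing A] [Algebra R A] (x y : R) (w : A) : Prop where
  injective : Function.Injective (algebraMap R A)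
  isLocalHom : IsLocalHom (algebraMap R A)
  eq_mul : algebraMap R A y = algebraMap R A x * w
  exists_mul_eq : ∀ z : A, ∃ P Q : R[X], IsUnit (aeval w Q) ∧ z * aeval w Q = aeval w P
  krullDimLE : Ring.KrullDimLE 1 A

namespace IsExceptionalChart

variable {R A : Type*} [CommRing R] [IsDomain R] [IsLocalRing R] [IsNoetherianRing R]
  [CommRing A] [IsDomain A] [IsLocalRing A] [Algebra R A] {x y : R} {w : A}

/-- Multiplying by xⁿ turns the relation into one in R: the form of P is x times a form of degree n,
hence has order above n, and its coefficients lie in the maximal ideal. -/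
theorem mem_map_of_aeval_eq (hA : IsExceptionalChart x y w) (h : IsRegularPair x y) {P Q : R[X]}
    (hPQ : aeval w P = algebraMap R A x * aeval w Q) :
    P ∈ (maximalIdeal R).map (C : R →+* R[X]) := by
  set n := max P.natDegree Q.natDegree with hn
  have hP : P.natDegree ≤ n := le_max_left _ _
  have hQ : Q.natDegree ≤ n := le_max_right _ _
  rw [← h.binaryForm_mem_pow_succ_iff hP]
  have : binaryForm x y n P = x * binaryForm x y n Q := by
    apply hA.injective
    rw [map_mul, aeval_binaryForm hA.eq_mul hP, aeval_binaryForm hA.eq_mul hQ, hPQ]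
    ring
  rw [this, pow_succ']
  exact Ideal.mul_mem_mul h.left_mem h.binaryForm_mem_pow

theorem algebraMap_mem_span (hA : IsExceptionalChart x y w) (h : IsRegularPair x y) {r : R}
    (hr : r ∈ maximalIdeal R) : algebraMap R A r ∈ Ideal.span {algebraMap R A x} := by
  rw [← h.span_eq] at hr
  obtain ⟨a, b, rfl⟩ := Ideal.mem_span_pair.1 hr
  rw [Ideal.mem_span_singleton', map_add, map_mul, map_mul, hA.eq_mul]
  exact ⟨algebraMap R A a + algebraMap R A b * w, by ring⟩

theorem aeval_mem_span (hA : IsExceptionalChart x y w) (h : IsRegularPair x y) {P : R[X]}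
    (hP : P ∈ (maximalIdeal R).map (C : R →+* R[X])) :
    aeval w P ∈ Ideal.span {algebraMap R A x} := by
  rw [Ideal.mem_map_C_iff] at hP
  rw [aeval_eq_sum_range]
  refine Ideal.sum_mem _ fun i _ => ?_
  rw [Algebra.smul_def]
  exact Ideal.mul_mem_right _ _ (hA.algebraMap_mem_span h (hP i))

theorem algebraMap_left_mem (hA : IsExceptionalChart x y w) (h : IsRegularPair x y) :
    algebraMap R A x ∈ maximalIdeal A := by
  have := hA.isLocalHom
  exact fun hu => h.left_mem (isUnit_of_map_unit _ _ hu)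

/-- In other words w is transcendental over the residue field modulo x, as a coordinate on E should
be. -/
theorem aeval_mem_span_iff (hA : IsExceptionalChart x y w) (h : IsRegularPair x y) {P : R[X]} :
    aeval w P ∈ Ideal.span {algebraMap R A x} ↔ P ∈ (maximalIdeal R).map (C : R →+* R[X]) := by
  refine ⟨fun hP => ?_, hA.aeval_mem_span h⟩
  obtain ⟨z, hz⟩ := Ideal.mem_span_singleton'.1 hP
  obtain ⟨S, Q, hQ, hzQ⟩ := hA.exists_mul_eq z
  have hPQ : P * Q ∈ (maximalIdeal R).map (C : R →+* R[X]) := by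
    refine hA.mem_map_of_aeval_eq h (Q := S) ?_
    rw [map_mul, ← hz, ← hzQ]
    ring
  have := Ideal.isPrime_map_C_of_isPrime (P := maximalIdeal R)
  refine (this.mem_or_mem hPQ).resolve_right fun hQ' => ?_
  exact (Ideal.span_singleton_le_iff_mem _ |>.2 (hA.algebraMap_left_mem h))
    (hA.aeval_mem_span h hQ') hQ

theorem isPrime_span (hA : IsExceptionalChart x y w) (h : IsRegularPair x y) :
    (Ideal.span {algebraMap R A x}).IsPrime := by
  refine ⟨fun ht => ?_, fun {z z'} hz => ?_⟩
  · have := (Ideal.span_singleton_le_iff_mem _).2 (hA.algebraMap_left_mem h)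
    rw [ht] at this
    exact Ideal.IsPrime.ne_top' (top_le_iff.1 this)
  obtain ⟨P, Q, hQ, hzP⟩ := hA.exists_mul_eq z
  obtain ⟨P', Q', hQ', hzP'⟩ := hA.exists_mul_eq z'
  rw [← Ideal.mul_unit_mem_iff_mem _ hQ, ← Ideal.mul_unit_mem_iff_mem (x := z') _ hQ', hzP, hzP',
    hA.aeval_mem_span_iff h, hA.aeval_mem_span_iff h]
  have := Ideal.isPrime_map_C_of_isPrime (P := maximalIdeal R)
  refine this.mem_or_mem ?_
  rw [← hA.aeval_mem_span_iff h, map_mul, ← hzP, ← hzP']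
  have : z * aeval w Q * (z' * aeval w Q') = z * z' * (aeval w Q * aeval w Q') := by ring
  rw [this]
  exact Ideal.mul_mem_right _ _ hz

theorem algebraMap_left_ne_zero (hA : IsExceptionalChart x y w) (h : IsRegularPair x y) :
    algebraMap R A x ≠ 0 := by
  rw [Ne, map_eq_zero_iff _ hA.injective]
  exact h.left_ne_zero

/-- Dimension at most one enters here: the nonzero prime (x) must be maximal. -/
theorem maximalIdeal_eq (hA : IsExceptionalChart x y w) (h : IsRegularPair x y) :
    maximalIdeal A = Ideal.span {algebraMap R A x} := by
  have := hA.krullDimLE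
  have hm := (hA.isPrime_span h).isMaximal_of_ne_bot
    (by simpa using hA.algebraMap_left_ne_zero h)
  exact (eq_maximalIdeal hm).symm

theorem irreducible (hA : IsExceptionalChart x y w) (h : IsRegularPair x y) :
    Irreducible (algebraMap R A x) :=
  ((Ideal.span_singleton_prime (hA.algebraMap_left_ne_zero h)).1 (hA.isPrime_span h)).irreducible

theorem isUnit_aeval (hA : IsExceptionalChart x y w) (h : IsRegularPair x y) {P : R[X]}
    (hP : P ∉ (maximalIdeal R).map (C : R →+* R[X])) : IsUnit (aeval w P) := by
  rw [← hA.aeval_mem_span_iff h, ← hA.maximalIdeal_eq h] at hP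
  simpa using hP

/-- The valuation of an exceptional curve is the order of vanishing at the point blown up. -/
theorem exists_algebraMap_eq (hA : IsExceptionalChart x y w) (h : IsRegularPair x y) {a : R}
    {n : ℕ} (ha : a ∉ maximalIdeal R ^ (n + 1)) :
    ∃ k ≤ n, ∃ u : A, IsUnit u ∧ algebraMap R A a = u * algebraMap R A x ^ k := by
  obtain ⟨k, hk, hak, hak'⟩ := IsRegularPair.exists_mem_pow_not_mem ha
  obtain ⟨P, hP, rfl⟩ := h.mem_pow_iff.1 hak
  rw [h.binaryForm_mem_pow_succ_iff hP] at hak'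
  exact ⟨k, hk, _, hA.isUnit_aeval h hak', by rw [aeval_binaryForm hA.eq_mul hP, mul_comm]⟩

theorem isDiscreteValuationRing (hA : IsExceptionalChart x y w) (h : IsRegularPair x y) :
    IsDiscreteValuationRing A := by
  refine isDiscreteValuationRing_of_forall (hA.irreducible h) fun z hz => ?_
  obtain ⟨P, Q, hQ, hzP⟩ := hA.exists_mul_eq z
  have hx0 := hA.algebraMap_left_ne_zero h
  have hP := aeval_binaryForm hA.eq_mul (le_refl P.natDegree)
  have hne : binaryForm x y P.natDegree P ≠ 0 := by
    intro h0
    rw [h0, map_zero, eq_comm, mul_eq_zero, or_iff_right (pow_ne_zero _ hx0), ← hzP] at hP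
    exact (mul_ne_zero hz hQ.ne_zero) hP
  obtain ⟨n, hn⟩ := IsRegularPair.exists_not_mem_pow hne
  obtain ⟨k, -, u, hu, huk⟩ := hA.exists_algebraMap_eq h hn
  rw [huk, ← hzP] at hP
  set N := P.natDegree
  -- x^N P(w) comes from R and has order k along E. If k were less than N, the unit u would be
  -- divisible by x.
  have hle : N ≤ k := by
    by_contra! hlt
    obtain ⟨j, hj⟩ := Nat.exists_eq_add_of_lt hlt
    rw [hj] at hP
    have h1 : u = algebraMap R A x * (algebraMap R A x ^ j * (z * aeval w Q)) := by
      apply mul_right_cancel₀ (pow_ne_zero k hx0)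
      rw [hP]
      ring
    exact hA.algebraMap_left_mem h (isUnit_of_mul_isUnit_left (h1 ▸ hu))
  obtain ⟨j, rfl⟩ := Nat.exists_eq_add_of_le hle
  refine ⟨j, u * ↑(hQ.unit⁻¹), hu.mul (Units.isUnit _), ?_⟩
  rw [mul_right_comm, Units.eq_mul_inv_iff_mul_eq, IsUnit.unit_spec]
  apply mul_left_cancel₀ (pow_ne_zero N hx0)
  rw [← hP]
  ring

end IsExceptionalChart

end ExceptionalValuation

namespace BlowUpRoundUp

open IsLocalRing Polynomial

/-! ### The blow-up off the centre, and minimality of its local rings. -/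

section Generic

variable {S' S : Scheme.{0}} {g : S' ⟶ S} {P : S}

namespace IsBlowUp

/-- The complement of the point blown up, as an open subscheme. -/
def complement (hg : IsBlowUp g P) : S.Opens := ⟨{P}ᶜ, hg.isClosed.isOpen_compl⟩

/-- The invertibility condition is empty for a morphism that misses P, so the universal property
gives both the inverse and its uniqueness. -/
theorem exists_lift_complement (hg : IsBlowUp g P) :
    ∃ k : hg.complement.toScheme ⟶ (g ⁻¹ᵁ hg.complement).toScheme,
      (g ∣_ hg.complement) ≫ k = 𝟙 _ ∧ k ≫ (g ∣_ hg.complement) = 𝟙 _ := by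
  set U := hg.complement with hU
  obtain ⟨h, hh, -⟩ := hg.universal U.toScheme U.ι fun y hy =>
    absurd hy (show U.ι y ∈ ({P}ᶜ : Set S) from y.2)
  have hrange : Set.range h ⊆ Set.range (g ⁻¹ᵁ U).ι := by
    rintro _ ⟨y, rfl⟩
    rw [Scheme.Opens.range_ι]
    have e : (h ≫ g) y = U.ι y := by rw [hh]
    exact (show U.ι y ∈ U from y.2) |> e.symm.subst (motive := fun z => z ∈ U)
  have hk := IsOpenImmersion.lift_fac (g ⁻¹ᵁ U).ι h hrange
  set k := IsOpenImmersion.lift (g ⁻¹ᵁ U).ι h hrange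
  have hgh : (g ∣_ U) ≫ h = (g ⁻¹ᵁ U).ι := by
    refine (hg.universal _ ((g ⁻¹ᵁ U).ι ≫ g) fun y hy => ?_).unique ?_ rfl
    · exact absurd hy (show ((g ⁻¹ᵁ U).ι ≫ g) y ∈ ({P}ᶜ : Set S) from y.2)
    · rw [Category.assoc, hh, morphismRestrict_ι]
  refine ⟨k, ?_, ?_⟩
  · rw [← cancel_mono (g ⁻¹ᵁ U).ι, Category.assoc, hk, hgh, Category.id_comp]
  · rw [← cancel_mono U.ι, Category.assoc, morphismRestrict_ι, reassoc_of% hk, hh,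
      Category.id_comp]

theorem isIso_morphismRestrict (hg : IsBlowUp g P) : IsIso (g ∣_ hg.complement) :=
  let ⟨k, h1, h2⟩ := hg.exists_lift_complement
  ⟨k, h1, h2⟩

/-- The blow-up is an isomorphism on local rings off the exceptional curve. -/
theorem isIso_stalkMap (hg : IsBlowUp g P) {x' : S'} (hx' : g x' ≠ P) : IsIso (g.stalkMap x') := by
  have := hg.isIso_morphismRestrict
  set U := hg.complement
  have hopen : IsOpenImmersion ((g ⁻¹ᵁ U).ι ≫ g) := by
    rw [← morphismRestrict_ι]
    infer_instance
  let z : (g ⁻¹ᵁ U).toScheme := ⟨x', hx'⟩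
  have h1 := Scheme.Hom.stalkMap_comp (g ⁻¹ᵁ U).ι g z
  have : IsIso (g.stalkMap ((g ⁻¹ᵁ U).ι z) ≫ (g ⁻¹ᵁ U).ι.stalkMap z) := by
    rw [← h1]
    exact inferInstanceAs (IsIso (Scheme.Hom.stalkMap ((g ⁻¹ᵁ U).ι ≫ g) z))
  exact IsIso.of_isIso_comp_right (g.stalkMap ((g ⁻¹ᵁ U).ι z)) ((g ⁻¹ᵁ U).ι.stalkMap z)

theorem exists_apply_eq (hg : IsBlowUp g P) {x : S} (hx : x ≠ P) : ∃ x', g x' = x := by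
  obtain ⟨k, -, h2⟩ := hg.exists_lift_complement
  let z : hg.complement.toScheme := ⟨x, hx⟩
  refine ⟨(k ≫ (g ⁻¹ᵁ hg.complement).ι) z, ?_⟩
  have e : (k ≫ (g ⁻¹ᵁ hg.complement).ι) ≫ g = hg.complement.ι := by
    rw [Category.assoc, ← morphismRestrict_ι, reassoc_of% h2]
  exact congrArg (fun f : hg.complement.toScheme ⟶ S => f z) e

theorem coheight_eq (hg : IsBlowUp g P) {x' : S'} (hx' : g x' ≠ P) :
    Order.coheight x' = Order.coheight (g x') := by
  have := hg.isIso_stalkMap hx'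
  have h := ringKrullDim_eq_of_ringEquiv (asIso (g.stalkMap x')).commRingCatIsoToRingEquiv
  rw [ringKrullDim_stalk_eq_coheight, ringKrullDim_stalk_eq_coheight] at h
  exact_mod_cast h.symm

end IsBlowUp

theorem exists_fromSpecStalk_eq (B : CommRingCat.{0}) [IsDomain B] (y : Spec B) :
    ∃ τ : B ⟶ (Spec B).presheaf.stalk y, (Spec B).fromSpecStalk y = Spec.map τ ∧
      Function.Injective τ.hom :=
  let z : PrimeSpectrum.Top B := y
  have _ : z.asIdeal.IsPrime := y.2
  ⟨_, Spec.fromSpecStalk_eq' B y,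
    IsLocalization.injective (R := B) ((structurePresheafInCommRingCat B).stalk z)
      z.asIdeal.primeCompl_le_nonZeroDivisors⟩

theorem isIso_stalkSpecializes {X : Scheme.{0}} {p q : X} (h : p ⤳ q) (h' : q ⤳ p) :
    IsIso (X.presheaf.stalkSpecializes h) :=
  ⟨X.presheaf.stalkSpecializes h', by simp, by simp⟩

/-- A morphism from an affine integral scheme through the local ring at `P`. -/
theorem pullsBackToInvertible_of_map_eq {p : S} (hp : p = P) {B : CommRingCat.{0}} [IsDomain B]
    (φ : S.presheaf.stalk p ⟶ B) {b : B} (hb : b ≠ 0)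
    (hφ : (maximalIdeal (S.presheaf.stalk p)).map φ.hom = Ideal.span {b}) :
    PullsBackToInvertible (Spec.map φ ≫ S.fromSpecStalk p) P := by
  subst hp
  intro y hy
  set f := Spec.map φ ≫ S.fromSpecStalk p with hf
  have hspec : f y ⤳ p := by rw [hy]
  have hspec' : p ⤳ f y := by rw [hy]
  obtain ⟨τ, hτ, hτi⟩ := exists_fromSpecStalk_eq B y
  have key : S.presheaf.stalkSpecializes hspec ≫ f.stalkMap y = φ ≫ τ := by
    apply Spec.map_injective
    rw [← cancel_mono (S.fromSpecStalk p), Spec.map_comp, Category.assoc,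
      Scheme.SpecMap_stalkSpecializes_fromSpecStalk, Scheme.SpecMap_stalkMap_fromSpecStalk,
      hτ, Spec.map_comp, Category.assoc]
  have := isIso_stalkSpecializes hspec hspec'
  have hm : (maximalIdeal (S.presheaf.stalk p)).map (S.presheaf.stalkSpecializes hspec).hom =
      maximalIdeal (S.presheaf.stalk (f y)) :=
    map_maximalIdeal_of_surjective _
      (asIso (S.presheaf.stalkSpecializes hspec)).commRingCatIsoToRingEquiv.surjective
  refine ⟨τ.hom b, mem_nonZeroDivisors_of_ne_zero ?_, ?_⟩
  · rwa [Ne, map_eq_zero_iff _ hτi]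
  · rw [← hm, Ideal.map_map, ← CommRingCat.hom_comp, key, CommRingCat.hom_comp, ← Ideal.map_map, hφ,
      Ideal.map_span, Set.image_singleton]

/-- A local ring of the blow-up is minimal among those in which the ideal of the point is
invertible. -/
theorem IsBlowUp.surjective_of_comp_eq (hg : IsBlowUp g P) {x' : S'} (hx' : g x' = P)
    [IsDomain (S'.presheaf.stalk x')]
    {B : CommRingCat.{0}} [IsDomain B] [IsLocalRing B] (α : S.presheaf.stalk (g x') ⟶ B)
    (β : B ⟶ S'.presheaf.stalk x') [IsLocalHom β.hom] (hαβ : α ≫ β = g.stalkMap x') {b : B}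
    (hb : β.hom b ≠ 0)
    (hα : (maximalIdeal (S.presheaf.stalk (g x'))).map α.hom = Ideal.span {b}) :
    Function.Surjective β.hom := by
  have hb0 : b ≠ 0 := by
    rintro rfl
    exact hb (map_zero _)
  obtain ⟨h, hh, -⟩ := hg.universal _ _ (pullsBackToInvertible_of_map_eq hx' α hb0 hα)
  have hcomp : Spec.map β ≫ h = S'.fromSpecStalk x' := by
    refine (hg.universal _ _ (pullsBackToInvertible_of_map_eq hx' (g.stalkMap x') hb ?_)).unique
      (y₁ := Spec.map β ≫ h) ?_ ?_
    · rw [← hαβ, CommRingCat.hom_comp, ← Ideal.map_map, hα, Ideal.map_span, Set.image_singleton]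
    · rw [Category.assoc, hh, ← hαβ, Spec.map_comp, Category.assoc]
    · rw [Scheme.SpecMap_stalkMap_fromSpecStalk]
  -- β is local, so closed points correspond, and h factors through the local ring at x'.
  have hcl : h (closedPoint B) = x' := by
    have e := congrArg (fun f : Spec (S'.presheaf.stalk x') ⟶ S' => f (closedPoint _)) hcomp
    refine Eq.trans ?_ (e.trans Scheme.fromSpecStalk_closedPoint)
    exact congrArg (fun z => h z) (Spec_closedPoint (f := β)).symm
  have hspec : h (closedPoint B) ⤳ x' := by rw [hcl]
  set ψ := S'.presheaf.stalkSpecializes hspec ≫ Scheme.stalkClosedPointTo h with hψ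
  have hhψ : Spec.map ψ ≫ S'.fromSpecStalk x' = h := by
    rw [hψ, Spec.map_comp, Category.assoc, Scheme.SpecMap_stalkSpecializes_fromSpecStalk,
      Scheme.Spec_stalkClosedPointTo_fromSpecStalk]
  -- The factorization ψ is a section of β, which is therefore surjective.
  have hid : ψ ≫ β = 𝟙 _ := by
    apply Spec.map_injective
    rw [← cancel_mono (S'.fromSpecStalk x'), Spec.map_comp, Category.assoc, hhψ, hcomp]
    simp
  intro z
  refine ⟨ψ.hom z, ?_⟩
  rw [← CommRingCat.comp_apply, hid]
  rfl

end Generic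

end BlowUpRoundUp

/-! ### The two charts of the blow-up. -/

section Chart

open IsLocalRing Polynomial

/-- Apply minimality to the localization of R[w] ⊆ A at the contraction of the maximal ideal of A.
There the maximal ideal of R generates the ideal (x), so this ring maps onto A. -/
theorem exists_isUnit_aeval_of_surjective {R A : Type} [CommRing R] [IsLocalRing R] [CommRing A]
    [IsDomain A] [IsLocalRing A] [Algebra R A] {x y : R}
    (hxy : Ideal.span {x, y} = maximalIdeal R) {w : A}
    (hw : algebraMap R A y = algebraMap R A x * w)
    (H : ∀ (B : Type) [CommRing B] [IsDomain B] [IsLocalRing B] (α : R →+* B) (β : B →+* A),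
      IsLocalHom β → β.comp α = algebraMap R A → (maximalIdeal R).map α = Ideal.span {α x} →
      Function.Surjective β) (z : A) :
    ∃ P Q : R[X], IsUnit (aeval w Q) ∧ z * aeval w Q = aeval w P := by
  let C₀ := (aeval w : R[X] →ₐ[R] A).range
  let q : Ideal C₀ := (maximalIdeal A).comap C₀.val
  have hq : q.IsPrime := Ideal.comap_isPrime _ _
  have hunit : ∀ c : q.primeCompl, IsUnit ((C₀.val : C₀ →+* A) c) := fun c => by
    have := c.2
    change ¬ ((c : C₀) : A) ∈ maximalIdeal A at this
    simpa using this
  let B := Localization.AtPrime q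
  let β : B →+* A := IsLocalization.lift hunit
  have hβ : ∀ (c : C₀) (s : q.primeCompl), β (IsLocalization.mk' B c s) * (s : C₀) = (c : A) := by
    intro c s
    have h1 : β (algebraMap C₀ B s) = ((s : C₀) : A) := IsLocalization.lift_eq hunit (s : C₀)
    have h2 : β (algebraMap C₀ B c) = (c : A) := IsLocalization.lift_eq hunit c
    rw [← h1, ← map_mul, IsLocalization.mk'_spec, h2]
  have hloc : IsLocalHom β := by
    refine ⟨fun b hb => ?_⟩
    obtain ⟨c, s, rfl⟩ := IsLocalization.exists_mk'_eq q.primeCompl b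
    have hc : IsUnit (c : A) := by
      rw [← hβ c s]
      exact hb.mul (hunit s)
    have : c ∈ q.primeCompl := fun hc' => hc' hc
    exact IsLocalization.AtPrime.isUnit_mk'_iff B q c s |>.2 this
  have hsurj := H B (algebraMap R B) β hloc ?_ ?_
  · obtain ⟨b, rfl⟩ := hsurj z
    obtain ⟨⟨_, P, rfl⟩, s, rfl⟩ := IsLocalization.exists_mk'_eq q.primeCompl b
    obtain ⟨Q, hQ⟩ := s.1.2
    refine ⟨P, Q, ?_, ?_⟩
    · have := hunit s
      rwa [show (C₀.val : C₀ →+* A) s = aeval w Q from hQ.symm] at this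
    · have := hβ ⟨_, P, rfl⟩ s
      rwa [show ((s : C₀) : A) = aeval w Q from hQ.symm] at this
  · ext r
    have : algebraMap R B r = algebraMap C₀ B (algebraMap R C₀ r) :=
      IsScalarTower.algebraMap_apply R C₀ B r
    rw [RingHom.comp_apply, this]
    exact IsLocalization.lift_eq hunit _
  · rw [← hxy, Ideal.map_span, Set.image_pair]
    refine le_antisymm (Ideal.span_le.2 (Set.pair_subset_iff.2
      ⟨Ideal.mem_span_singleton_self _, ?_⟩)) 
      (Ideal.span_mono (Set.singleton_subset_iff.2 (Set.mem_insert _ _)))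
    rw [SetLike.mem_coe, Ideal.mem_span_singleton]
    refine ⟨algebraMap C₀ B ⟨w, X, aeval_X w⟩, ?_⟩
    have e : algebraMap R C₀ y = algebraMap R C₀ x * ⟨w, X, aeval_X w⟩ := Subtype.ext hw
    have e' := congrArg (algebraMap C₀ B) e
    rw [RingHom.map_mul] at e'
    exact e'

/-- Writing x = as and y = at, the equality (x, y) = (a) in A makes s and t generate the unit ideal.
A is local, so one of them is a unit, and this selects the chart. -/
theorem exists_isExceptionalChart {R A : Type} [CommRing R] [IsLocalRing R] [CommRing A]
    [IsDomain A] [IsLocalRing A] [Algebra R A] {x y : R}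
    (hxy : Ideal.span {x, y} = maximalIdeal R) (hinj : Function.Injective (algebraMap R A))
    (hloc : IsLocalHom (algebraMap R A)) (hdim : Ring.KrullDimLE 1 A) {a : A} (ha : a ≠ 0)
    (hspan : (maximalIdeal R).map (algebraMap R A) = Ideal.span {a})
    (H : ∀ (B : Type) [CommRing B] [IsDomain B] [IsLocalRing B] (α : R →+* B) (β : B →+* A) (b : B),
      IsLocalHom β → β.comp α = algebraMap R A → β b ≠ 0 → (maximalIdeal R).map α = Ideal.span {b} →
      Function.Surjective β) :
    (∃ w : A, IsExceptionalChart x y w) ∨ ∃ w : A, IsExceptionalChart y x w := by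
  have hxy' := hxy
  have key : ∀ x y : R, Ideal.span {x, y} = maximalIdeal R →
      ∀ s t : A, algebraMap R A x = a * s → algebraMap R A y = a * t → IsUnit s →
        ∃ w : A, IsExceptionalChart x y w := by
    intro x y hxy s t hs ht hu
    have hw : algebraMap R A y = algebraMap R A x * (↑hu.unit⁻¹ * t) := by
      rw [hs, ht, mul_assoc, ← mul_assoc s, IsUnit.mul_val_inv, one_mul]
    have hx0 : algebraMap R A x ≠ 0 := hs ▸ mul_ne_zero ha hu.ne_zero
    refine ⟨_, hinj, hloc, hw, ?_, hdim⟩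
    refine exists_isUnit_aeval_of_surjective hxy hw fun B _ _ _ α β hβ hαβ hα => ?_
    refine H B α β (α x) hβ hαβ ?_ hα
    rwa [← RingHom.comp_apply, hαβ]
  rw [← hxy, Ideal.map_span, Set.image_pair] at hspan
  obtain ⟨s, hs⟩ := Ideal.mem_span_singleton.1 (hspan ▸ Ideal.subset_span (by simp) :
    algebraMap R A x ∈ Ideal.span {a})
  obtain ⟨t, ht⟩ := Ideal.mem_span_singleton.1 (hspan ▸ Ideal.subset_span (by simp) :
    algebraMap R A y ∈ Ideal.span {a})
  obtain ⟨c, d, hcd⟩ := Ideal.mem_span_pair.1 (hspan.symm ▸ Ideal.mem_span_singleton_self a :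
    a ∈ Ideal.span {algebraMap R A x, algebraMap R A y})
  have h1 : c * s + d * t = 1 := by
    apply mul_left_cancel₀ ha
    rw [hs, ht] at hcd
    linear_combination hcd
  rcases IsLocalRing.isUnit_or_isUnit_of_add_one h1 with hu | hu
  · exact .inl (key x y hxy' s t hs ht (isUnit_of_mul_isUnit_right hu))
  · exact .inr (key y x (by rw [Set.pair_comm, hxy']) t s ht hs (isUnit_of_mul_isUnit_right hu))

end Chart

namespace BlowUpRoundUp

open IsLocalRing

variable {S' S : Scheme.{0}} {g : S' ⟶ S} {P : S}

theorem IsBlowUp.exists_isExceptionalChart (hg : IsBlowUp g P) [IsIntegral S] [IsIntegral S']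
    {x' : S'} (hx' : g x' = P) (hinj : Function.Injective (g.stalkMap x').hom)
    (hdim : Order.coheight x' = 1) {x y : S.presheaf.stalk (g x')}
    (hxy : Ideal.span {x, y} = maximalIdeal (S.presheaf.stalk (g x'))) :
    letI := (g.stalkMap x').hom.toAlgebra
    (∃ w : S'.presheaf.stalk x', IsExceptionalChart x y w) ∨
      ∃ w : S'.presheaf.stalk x', IsExceptionalChart y x w := by
  let := (g.stalkMap x').hom.toAlgebra
  obtain ⟨a, ha, hspan⟩ := hg.invertible x' hx'
  refine _root_.exists_isExceptionalChart hxy hinj (inferInstanceAs (IsLocalHom (g.stalkMap x').hom))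
    (krullDimLE_of_coheight_le hdim.le) (nonZeroDivisors.ne_zero ha) hspan ?_
  intro B _ _ _ α β b hβ hαβ hb hα
  exact hg.surjective_of_comp_eq hx' (B := CommRingCat.of B) (CommRingCat.ofHom α)
    (CommRingCat.ofHom β) (CommRingCat.hom_ext hαβ) hb hα

end BlowUpRoundUp

/-! ### Local coordinates at a smooth rational point. -/

section SmoothPoint

open IsLocalRing Polynomial KaehlerDifferential

/-- Independence of the monomials without knowing regularity: the dual derivations lower the degree
and multiply coefficients by nonzero integers, which are units. -/
theorem Derivation.coeff_mem_of_sum_mem_pow {k R : Type*} [CommRing k] [CommRing R] [Algebra k R]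
    [IsLocalRing R] [Algebra ℚ R] {x y : R} (hxy : Ideal.span {x, y} = maximalIdeal R)
    {d₁ d₂ : Derivation k R R} (h₁x : d₁ x = 1) (h₁y : d₁ y = 0) (h₂x : d₂ x = 0) (h₂y : d₂ y = 1)
    (n : ℕ) (c : ℕ → R)
    (hc : ∑ i ∈ Finset.range (n + 1), c i * (y ^ i * x ^ (n - i)) ∈ maximalIdeal R ^ (n + 1)) :
    ∀ i ≤ n, c i ∈ maximalIdeal R := by
  have hx : x ∈ maximalIdeal R := hxy ▸ Ideal.subset_span (by simp)
  have hy : y ∈ maximalIdeal R := hxy ▸ Ideal.subset_span (by simp)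
  have hcast : ∀ (m : ℕ) (r : R), m ≠ 0 → (m : R) * r ∈ maximalIdeal R → r ∈ maximalIdeal R := by
    intro m r hm
    refine (Ideal.unit_mul_mem_iff_mem _ ?_).1
    rw [← _root_.map_natCast (algebraMap ℚ R)]
    exact (IsUnit.mk0 _ (by exact_mod_cast hm)).map _
  induction n generalizing c with
  | zero =>
    intro i hi
    obtain rfl : i = 0 := by lia
    simpa using hc
  | succ n ih =>
    have hmem : ∀ i ∈ Finset.range (n + 2), ∀ r : R,
        r * (y ^ i * x ^ (n + 1 - i)) ∈ maximalIdeal R ^ (n + 1) := by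
      intro i hi r
      have hi : i ≤ n + 1 := Nat.lt_succ_iff.1 (Finset.mem_range.1 hi)
      refine Ideal.mul_mem_left _ _ ?_
      rw [← Nat.add_sub_of_le hi, pow_add, Nat.add_sub_of_le hi]
      exact Ideal.mul_mem_mul (Ideal.pow_mem_pow hy _) (Ideal.pow_mem_pow hx _)
    have h1 : ∑ i ∈ Finset.range (n + 1), ((n + 1 - i : ℕ) * c i) * (y ^ i * x ^ (n - i)) ∈
        maximalIdeal R ^ (n + 1) := by
      have hd := d₁.apply_mem_pow _ _ hc
      rw [map_sum] at hd
      have : ∀ i ∈ Finset.range (n + 2), d₁ (c i * (y ^ i * x ^ (n + 1 - i))) =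
          ((n + 1 - i : ℕ) * c i) * (y ^ i * x ^ (n - i)) +
            d₁ (c i) * (y ^ i * x ^ (n + 1 - i)) := by
        intro i hi
        rw [d₁.leibniz, d₁.leibniz, d₁.leibniz_pow, d₁.leibniz_pow, h₁x, h₁y,
          show n + 1 - i - 1 = n - i by lia]
        simp only [smul_eq_mul, nsmul_eq_mul]
        ring
      rw [Finset.sum_congr rfl this, Finset.sum_add_distrib, Ideal.add_mem_iff_left _
        (Ideal.sum_mem _ fun i hi => hmem i hi _), Finset.sum_range_succ] at hd
      simpa using hd
    have h2 : ∑ i ∈ Finset.range (n + 1), ((i + 1 : ℕ) * c (i + 1)) * (y ^ i * x ^ (n - i)) ∈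
        maximalIdeal R ^ (n + 1) := by
      have hd := d₂.apply_mem_pow _ _ hc
      rw [map_sum] at hd
      have : ∀ i ∈ Finset.range (n + 2), d₂ (c i * (y ^ i * x ^ (n + 1 - i))) =
          ((i : ℕ) * c i) * (y ^ (i - 1) * x ^ (n + 1 - i)) +
            d₂ (c i) * (y ^ i * x ^ (n + 1 - i)) := by
        intro i hi
        rw [d₂.leibniz, d₂.leibniz, d₂.leibniz_pow, d₂.leibniz_pow, h₂x, h₂y]
        simp only [smul_eq_mul, nsmul_eq_mul]
        ring
      rw [Finset.sum_congr rfl this, Finset.sum_add_distrib, Ideal.add_mem_iff_left _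
        (Ideal.sum_mem _ fun i hi => hmem i hi _), Finset.sum_range_succ'] at hd
      simpa using hd
    intro i hi
    -- Differentiating along x reaches every coefficient except that of the pure power of y, which
    -- needs d₂.
    rcases Nat.lt_or_eq_of_le hi with hi | rfl
    · exact hcast (n + 1 - i) _ (by lia) (ih _ h1 i (by lia))
    · exact hcast (n + 1) _ (by lia) (ih _ h2 n le_rfl)

/-- If xᵏ = fg and yᵏ = fh, then xᵏh = yᵏg. Comparing leading forms, yᵏ would divide the leading
form of h; but h has order less than k, since yᵏ has order exactly k and f is not a unit. -/
theorem isRegularPair_of_derivation {k R : Type*} [CommRing k] [CommRing R] [Algebra k R]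
    [IsLocalRing R] [IsNoetherianRing R] [Algebra ℚ R] {x y : R}
    (hxy : Ideal.span {x, y} = maximalIdeal R)
    {d₁ d₂ : Derivation k R R} (h₁x : d₁ x = 1) (h₁y : d₁ y = 0) (h₂x : d₂ x = 0)
    (h₂y : d₂ y = 1) : IsRegularPair x y := by
  have hform : ∀ (n : ℕ) (P : R[X]), binaryForm x y n P ∈ maximalIdeal R ^ (n + 1) →
      ∀ i ≤ n, P.coeff i ∈ maximalIdeal R := by
    intro n P hP
    rw [binaryForm_eq_sum] at hP
    exact Derivation.coeff_mem_of_sum_mem_pow hxy h₁x h₁y h₂x h₂y n _ hP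
  have hone : (1 : R) ∉ maximalIdeal R := (Ideal.ne_top_iff_one _).1 (Ideal.IsPrime.ne_top')
  have hxk : ∀ k, binaryForm x y k 1 = x ^ k := fun k => by simp [binaryForm]
  have hyk : ∀ k, binaryForm x y k (X ^ k) = y ^ k := fun k => by
    rw [binaryForm, homogenize_X_pow le_rfl]
    simp
  refine ⟨hxy, fun f hf k hk => ?_⟩
  have hxm : x ∈ maximalIdeal R := hxy ▸ Ideal.subset_span (by simp)
  have hym : y ∈ maximalIdeal R := hxy ▸ Ideal.subset_span (by simp)
  obtain ⟨g, hg⟩ := Ideal.mem_span_singleton.1 (hk (Ideal.pow_mem_pow hxm k))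
  obtain ⟨h, hh⟩ := Ideal.mem_span_singleton.1 (hk (Ideal.pow_mem_pow hym k))
  have hy0 : y ^ k ∉ maximalIdeal R ^ (k + 1) := fun hc => by
    rw [← hyk] at hc
    have := hform k _ hc k le_rfl
    rw [coeff_X_pow_self] at this
    exact hone this
  have hhk : h ∉ maximalIdeal R ^ k := fun hc => hy0 <| by
    rw [hh, pow_succ']
    exact Ideal.mul_mem_mul hf hc
  obtain ⟨n, rfl⟩ : ∃ n, k = n + 1 := Nat.exists_eq_succ_of_ne_zero (by
    rintro rfl
    exact hhk (by simp))
  obtain ⟨j, hj, hhj, hhj'⟩ := IsRegularPair.exists_mem_pow_not_mem hhk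
  have heq : x ^ (n + 1) * h = y ^ (n + 1) * g := by rw [hg, hh]; ring
  have hpow : ∀ {n : ℕ} {z : R}, z ∈ maximalIdeal R ^ n ↔
      ∃ P : R[X], P.natDegree ≤ n ∧ binaryForm x y n P = z := fun {n z} => by
    rw [← hxy, mem_span_pair_pow_iff]
  have hmem : ∀ (n : ℕ) (P : R[X]), P.natDegree ≤ n → (∀ i ≤ n, P.coeff i ∈ maximalIdeal R) →
      binaryForm x y n P ∈ maximalIdeal R ^ (n + 1) := by
    intro n P _ hP
    rw [binaryForm_eq_sum, pow_succ']
    refine Ideal.sum_mem _ fun i hi => ?_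
    have hi : i ≤ n := Nat.lt_succ_iff.1 (Finset.mem_range.1 hi)
    refine Ideal.mul_mem_mul (hP i hi) ?_
    rw [← Nat.add_sub_of_le hi, pow_add, Nat.add_sub_of_le hi]
    exact Ideal.mul_mem_mul (Ideal.pow_mem_pow hym _) (Ideal.pow_mem_pow hxm _)
  -- Multiplication by a power of y only shifts coefficients, so it preserves the order defect of g;
  -- hence g vanishes at least to the order j of h.
  have hgj : g ∈ maximalIdeal R ^ j := by
    rcases j with - | j
    · simp
    by_contra hgj
    obtain ⟨l, hl, hgl, hgl'⟩ := IsRegularPair.exists_mem_pow_not_mem hgj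
    obtain ⟨G, hG, rfl⟩ := hpow.1 hgl
    refine hgl' (hmem l G hG fun i hi => ?_)
    have h1 : binaryForm x y (n + 1 + l) (X ^ (n + 1) * G) ∈ maximalIdeal R ^ (n + 1 + l + 1) := by
      rw [binaryForm_mul x y (natDegree_X_pow_le _) hG, hyk, ← heq]
      refine Ideal.pow_le_pow_right (show n + 1 + l + 1 ≤ (n + 1) + (j + 1) by lia) ?_
      rw [pow_add]
      exact Ideal.mul_mem_mul (Ideal.pow_mem_pow hxm _) hhj
    have := hform _ _ h1 (n + 1 + i) (by lia)
    rwa [add_comm (n + 1) i, coeff_X_pow_mul] at this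
  obtain ⟨G, hG, rfl⟩ := hpow.1 hgj
  obtain ⟨H, hH, rfl⟩ := hpow.1 hhj
  -- Since i ≤ j ≤ n, the form yⁿ⁺¹G does not contribute to the i-th coefficient.
  refine hhj' (hmem j H hH fun i hi => ?_)
  have h0 : binaryForm x y (n + 1 + j) (1 * H - X ^ (n + 1) * G) ∈
      maximalIdeal R ^ (n + 1 + j + 1) := by
    rw [binaryForm_sub, binaryForm_mul x y (by simp) hH,
      binaryForm_mul x y (natDegree_X_pow_le _) hG, hxk, hyk, heq, sub_self]
    exact zero_mem _
  have := hform _ _ h0 i (by lia)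
  rwa [one_mul, coeff_sub, coeff_X_pow_mul', if_neg (by lia), sub_zero] at this

/-- The derivation `r ↦ r - r(P)` to the cotangent space, at a rational point. -/
theorem mem_pow_two_of_D_mem {k R : Type*} [Field k] [CommRing R] [Algebra k R] [IsLocalRing R]
    (hk : ∀ r : R, ∃ c : k, r - algebraMap k R c ∈ maximalIdeal R) {z : R}
    (hz : z ∈ maximalIdeal R)
    (hdz : D k R z ∈ (maximalIdeal R) • (⊤ : Submodule R Ω[R⁄k])) : z ∈ maximalIdeal R ^ 2 := by
  choose c hc using hk
  have huniq : ∀ (r : R) (a : k), r - algebraMap k R a ∈ maximalIdeal R → c r = a := by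
    intro r a ha
    by_contra hne
    have h1 := Ideal.sub_mem _ ha (hc r)
    rw [sub_sub_sub_cancel_left, ← map_sub] at h1
    exact h1 ((IsUnit.mk0 _ (sub_ne_zero.2 hne)).map _)
  have hadd : ∀ r s, c (r + s) = c r + c s := fun r s => huniq _ _ <| by
    have := Ideal.add_mem _ (hc r) (hc s)
    rw [map_add]
    convert! this using 1
    ring
  have hsmul : ∀ (a : k) r, c (a • r) = a * c r := fun a r => huniq _ _ <| by
    have := Ideal.mul_mem_left _ (algebraMap k R a) (hc r)
    rw [Algebra.smul_def, map_mul]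
    convert! this using 1
    ring
  let e : R →ₗ[k] (maximalIdeal R).Cotangent :=
    { toFun := fun r => (maximalIdeal R).toCotangent ⟨r - algebraMap k R (c r), hc r⟩
      map_add' := fun r s => by
        rw [← map_add]
        congr 1
        apply Subtype.ext
        simp only [hadd, map_add, Submodule.coe_add]
        ring
      map_smul' := fun a r => by
        rw [RingHom.id_apply, ← algebraMap_smul R a ((maximalIdeal R).toCotangent _), ← map_smul]
        congr 1
        apply Subtype.ext
        simp only [hsmul, map_mul, Submodule.coe_smul, smul_eq_mul]
        rw [Algebra.smul_def, mul_sub] }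
  let δ : Derivation k R (maximalIdeal R).Cotangent := Derivation.mk' e fun r s => by
    change (maximalIdeal R).toCotangent _ = r • (maximalIdeal R).toCotangent _ +
      s • (maximalIdeal R).toCotangent _
    rw [← map_smul, ← map_smul, ← map_add, Ideal.toCotangent_eq]
    have hcm : c (r * s) = c r * c s := huniq _ _ <| by
      have := Ideal.add_mem _ (Ideal.mul_mem_left _ r (hc s))
        (Ideal.mul_mem_left _ (algebraMap k R (c s)) (hc r))
      rw [map_mul]
      convert! this using 1
      ring
    have := Ideal.mul_mem_mul (hc r) (hc s)
    rw [← pow_two, ← Ideal.neg_mem_iff] at this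
    convert! this using 1
    simp only [hcm, map_mul, Submodule.coe_add, Submodule.coe_smul, smul_eq_mul]
    ring
  have hcz : c z = 0 := huniq _ _ (by simpa using hz)
  have hδz : δ z = (maximalIdeal R).toCotangent ⟨z, hz⟩ := by
    change (maximalIdeal R).toCotangent _ = _
    congr 1
    apply Subtype.ext
    simp [hcz]
  rw [← Ideal.toCotangent_eq_zero _ ⟨z, hz⟩, ← hδz, ← δ.liftKaehlerDifferential_comp_D]
  -- The linear map induced by δ carries 𝔪Ω into 𝔪 · (𝔪/𝔪²) = 0.
  have h1 : δ.liftKaehlerDifferential (D k R z) ∈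
      (maximalIdeal R) • (⊤ : Submodule R (maximalIdeal R).Cotangent) := by
    have := Submodule.mem_map_of_mem (f := δ.liftKaehlerDifferential) hdz
    rw [Submodule.map_smul''] at this
    exact Submodule.smul_mono le_rfl le_top this
  refine (Submodule.mem_bot R).1 (Submodule.smul_le.2 (fun a ha b _ => ?_) h1)
  obtain ⟨b, rfl⟩ := (maximalIdeal R).toCotangent_surjective b
  rw [← map_smul, Submodule.mem_bot, Ideal.toCotangent_eq_zero, pow_two]
  exact Ideal.mul_mem_mul ha b.2

end SmoothPoint

section SmoothPoint

open IsLocalRing KaehlerDifferential Module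

/-- Local coordinates at a smooth point of a surface, with the dual derivations. -/
structure IsCoordinatePair {k R : Type*} [CommRing k] [CommRing R] [Algebra k R] [IsLocalRing R]
    (x y : R) (d₁ d₂ : Derivation k R R) : Prop where
  isRegularPair : IsRegularPair x y
  left_left : d₁ x = 1
  left_right : d₁ y = 0
  right_left : d₂ x = 0
  right_right : d₂ y = 1
  D_eq : ∀ a, D k R a = d₁ a • D k R x + d₂ a • D k R y

variable {k R : Type*} [Field k] [CommRing R] [Algebra k R] [IsLocalRing R]

/-- Modulo 𝔪Ω every form is exact: r dz ≡ d(rz) for z in 𝔪, and constants have zero differential. -/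
theorem exists_sub_D_mem (hk : ∀ r : R, ∃ c : k, r - algebraMap k R c ∈ maximalIdeal R)
    (ω : Ω[R⁄k]) :
    ∃ z ∈ maximalIdeal R, ω - D k R z ∈ (maximalIdeal R) • (⊤ : Submodule R Ω[R⁄k]) := by
  have hω : ω ∈ Submodule.span R (Set.range (D k R)) := by
    rw [KaehlerDifferential.span_range_derivation]
    trivial
  induction hω using Submodule.span_induction with
  | mem ω hω =>
    obtain ⟨r, rfl⟩ := hω
    obtain ⟨c, hc⟩ := hk r
    refine ⟨_, hc, ?_⟩
    rw [map_sub, Derivation.map_algebraMap, sub_zero, sub_self]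
    exact zero_mem _
  | zero => exact ⟨0, zero_mem _, by simp⟩
  | add ω η _ _ hω hη =>
    obtain ⟨z, hz, hωz⟩ := hω
    obtain ⟨w, hw, hηw⟩ := hη
    refine ⟨z + w, Ideal.add_mem _ hz hw, ?_⟩
    rw [map_add, add_sub_add_comm]
    exact Submodule.add_mem _ hωz hηw
  | smul r ω _ hω =>
    obtain ⟨z, hz, hωz⟩ := hω
    refine ⟨r * z, Ideal.mul_mem_left _ _ hz, ?_⟩
    rw [Derivation.leibniz, ← sub_sub, ← smul_sub]
    exact Submodule.sub_mem _ (Submodule.smul_mem _ _ hωz)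
      (Submodule.smul_mem_smul hz Submodule.mem_top)

/-- At a rational point with free differentials of rank two there are local coordinates. -/
theorem exists_isCoordinatePair [IsNoetherianRing R] [Algebra ℚ R]
    (hk : ∀ r : R, ∃ c : k, r - algebraMap k R c ∈ maximalIdeal R) (b : Basis (Fin 2) R Ω[R⁄k]) :
    ∃ (x y : R) (d₁ d₂ : Derivation k R R), IsCoordinatePair x y d₁ d₂ := by
  obtain ⟨x, hx, hbx⟩ := exists_sub_D_mem hk (b 0)
  obtain ⟨y, hy, hby⟩ := exists_sub_D_mem hk (b 1)
  have : Module.Finite R Ω[R⁄k] := Module.Finite.of_basis b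
  let v : Fin 2 → Ω[R⁄k] := ![D k R x, D k R y]
  have hspan : (⊤ : Submodule R Ω[R⁄k]) ≤ Submodule.span R (Set.range v) := by
    refine Submodule.le_of_le_smul_of_le_jacobson_bot (I := maximalIdeal R) Module.Finite.fg_top
      (maximalIdeal_le_jacobson _) ?_
    rw [← b.span_eq, Submodule.span_le]
    have hv : ∀ i, b i - v i ∈ (maximalIdeal R) • (⊤ : Submodule R Ω[R⁄k]) := by
      intro i
      fin_cases i
      · exact hbx
      · exact hby
    rintro _ ⟨i, rfl⟩
    rw [b.span_eq, ← add_sub_cancel (v i) (b i)]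
    exact Submodule.add_mem_sup (Submodule.subset_span ⟨i, rfl⟩) (hv i)
  have hsurj : Function.Surjective (Fintype.linearCombination R v) := by
    rw [← LinearMap.range_eq_top, Fintype.range_linearCombination]
    exact top_le_iff.1 hspan
  -- A surjective endomorphism of a finite free module is injective, so the generators dx, dy form a
  -- basis.
  have hinj : Function.Injective (Fintype.linearCombination R v) := by
    have h1 : Function.Surjective ((b.equivFun : Ω[R⁄k] →ₗ[R] (Fin 2 → R)) ∘ₗ
        Fintype.linearCombination R v) := b.equivFun.surjective.comp hsurj
    have h2 := OrzechProperty.injective_of_surjective_endomorphism _ h1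
    exact Function.Injective.of_comp (f := b.equivFun) h2
  have hli : LinearIndependent R v := linearIndependent_iff_injective_fintypeLinearCombination.2 hinj
  let e := Basis.mk hli hspan
  have he0 : e 0 = D k R x := Basis.mk_apply hli hspan 0
  have he1 : e 1 = D k R y := Basis.mk_apply hli hspan 1
  let d : Fin 2 → Derivation k R R := fun i => (e.coord i).compDer (D k R)
  have hd : ∀ i a, d i a = e.repr (D k R a) i := fun i a => rfl
  have h₁x : d 0 x = 1 := by rw [hd, ← he0]; simp
  have h₁y : d 0 y = 0 := by rw [hd, ← he1]; simp
  have h₂x : d 1 x = 0 := by rw [hd, ← he0]; simp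
  have h₂y : d 1 y = 1 := by rw [hd, ← he1]; simp
  have hD : ∀ a, D k R a = d 0 a • D k R x + d 1 a • D k R y := by
    intro a
    rw [← he0, ← he1, hd, hd]
    conv_lhs => rw [← e.sum_repr (D k R a)]
    rw [Fin.sum_univ_two]
  have hspan : Ideal.span {x, y} = maximalIdeal R := by
    refine le_antisymm (Ideal.span_le.2 (Set.pair_subset_iff.2 ⟨hx, hy⟩)) ?_
    refine Submodule.le_of_le_smul_of_le_jacobson_bot (I := maximalIdeal R)
      (IsNoetherian.noetherian _) (maximalIdeal_le_jacobson _) fun z hz => ?_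
    -- The linear Taylor remainder of z has differential in 𝔪Ω, hence lies in 𝔪²; Nakayama then
    -- shows that x and y generate 𝔪.
    have hz' : z - (d 0 z * x + d 1 z * y) ∈ maximalIdeal R ^ 2 := by
      refine mem_pow_two_of_D_mem hk (Ideal.sub_mem _ hz (Ideal.add_mem _
        (Ideal.mul_mem_left _ _ hx) (Ideal.mul_mem_left _ _ hy))) ?_
      have : D k R (z - (d 0 z * x + d 1 z * y)) = -(x • D k R (d 0 z) + y • D k R (d 1 z)) := by
        rw [map_sub, map_add, Derivation.leibniz, Derivation.leibniz]
        nth_rewrite 1 [hD z]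
        abel
      rw [this]
      exact Submodule.neg_mem _ (Submodule.add_mem _
        (Submodule.smul_mem_smul hx Submodule.mem_top)
        (Submodule.smul_mem_smul hy Submodule.mem_top))
    have h1 : d 0 z * x + d 1 z * y ∈ Ideal.span {x, y} := Ideal.mem_span_pair.2 ⟨_, _, rfl⟩
    rw [pow_two, ← smul_eq_mul] at hz'
    have := Submodule.add_mem_sup h1 hz'
    rwa [add_sub_cancel] at this
  exact ⟨x, y, d 0, d 1, isRegularPair_of_derivation hspan h₁x h₁y h₂x h₂y, h₁x, h₁y, h₂x, h₂y, hD⟩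

end SmoothPoint

/-! ### Two-forms in coordinates and under field isomorphisms. -/

section TwoForms

open IsLocalRing KaehlerDifferential Module

theorem ιMulti_pair {K M : Type*} [CommRing K] [AddCommGroup M] [Module K M] (X Y : M)
    (α β γ δ : K) :
    exteriorPower.ιMulti K 2 ![α • X + β • Y, γ • X + δ • Y] =
      (α * δ - β * γ) • exteriorPower.ιMulti K 2 ![X, Y] := by
  set f := exteriorPower.ιMulti K 2 (M := M)
  have e0 (u v : M) : Function.update ![0, v] 0 u = ![u, v] := by
    ext i
    fin_cases i <;> rfl
  have e1 (u v : M) : Function.update ![u, 0] 1 v = ![u, v] := by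
    ext i
    fin_cases i <;> rfl
  have h0 (u u' v : M) : f ![u + u', v] = f ![u, v] + f ![u', v] := by
    rw [← e0 (u + u'), ← e0 u, ← e0 u']
    exact f.map_update_add _ _ _ _
  have h1 (u v v' : M) : f ![u, v + v'] = f ![u, v] + f ![u, v'] := by
    rw [← e1 u (v + v'), ← e1 u v, ← e1 u v']
    exact f.map_update_add _ _ _ _
  have h2 (c : K) (u v : M) : f ![c • u, v] = c • f ![u, v] := by
    rw [← e0 (c • u), ← e0 u]
    exact f.map_update_smul _ _ _ _
  have h3 (c : K) (u v : M) : f ![u, c • v] = c • f ![u, v] := by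
    rw [← e1 u (c • v), ← e1 u v]
    exact f.map_update_smul _ _ _ _
  have h4 (u : M) : f ![u, u] = 0 := f.map_eq_zero_of_eq _ (i := 0) (j := 1) rfl (by decide)
  have h5 : f ![Y, X] = -f ![X, Y] := by
    have := f.map_swap ![X, Y] (i := 0) (j := 1) (by decide)
    rw [← this]
    congr 1
    ext i
    fin_cases i <;> rfl
  rw [h0, h1, h1]
  simp only [h2, h3, h4, h5]
  module

theorem exists_exteriorPower_equiv {K M : Type*} [CommRing K] [AddCommGroup M] [Module K M]
    (e : Basis (Fin 2) K M) :
    ∃ L : ⋀[K]^2 M ≃ₗ[K] K, L (exteriorPower.ιMulti K 2 ![e 0, e 1]) = 1 := by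
  have he : ![e 0, e 1] = e := by
    ext i
    fin_cases i <;> rfl
  let F := exteriorPower.alternatingMapLinearEquiv e.det
  have hF : F (exteriorPower.ιMulti K 2 e) = 1 := by
    rw [exteriorPower.alternatingMapLinearEquiv_apply_ιMulti, e.det_self]
  let G := LinearMap.toSpanSingleton K (⋀[K]^2 M) (exteriorPower.ιMulti K 2 e)
  refine ⟨LinearEquiv.ofLinearMap F G ?_ ?_, ?_⟩
  · ext
    simp [G, hF]
  · ext v
    have hv : ∀ i, v i = e.repr (v i) 0 • e 0 + e.repr (v i) 1 • e 1 := fun i => by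
      conv_lhs => rw [← e.sum_repr (v i), Fin.sum_univ_two]
    have : exteriorPower.ιMulti K 2 v = e.det v • exteriorPower.ιMulti K 2 e := by
      have hv' : v = ![v 0, v 1] := by
        ext i
        fin_cases i <;> rfl
      conv_lhs => rw [hv', hv 0, hv 1, ιMulti_pair, he]
      rw [Basis.det_apply, Matrix.det_fin_two]
      simp only [Basis.toMatrix_apply]
      congr 1
      ring
    simp only [LinearMap.compAlternatingMap_apply, LinearMap.comp_apply, LinearMap.id_apply, F, G,
      exteriorPower.alternatingMapLinearEquiv_apply_ιMulti, LinearMap.toSpanSingleton_apply]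
    rw [this]
  · exact (congrArg F (congrArg _ he)).trans hF

section Localization

variable {k R : Type*} [CommRing k] [CommRing R] [Algebra k R] [IsLocalRing R] {x y : R}
  {d₁ d₂ : Derivation k R R}

theorem IsCoordinatePair.exists_basis (h : IsCoordinatePair x y d₁ d₂) :
    ∃ e : Basis (Fin 2) R Ω[R⁄k], e 0 = D k R x ∧ e 1 = D k R y := by
  let v : Fin 2 → Ω[R⁄k] := ![D k R x, D k R y]
  have hli : LinearIndependent R v := by
    rw [LinearIndependent.pair_iff]
    intro s t hst
    have h1 := congrArg d₁.liftKaehlerDifferential hst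
    have h2 := congrArg d₂.liftKaehlerDifferential hst
    simp only [map_add, map_smul, Derivation.liftKaehlerDifferential_comp_D, map_zero, h.left_left,
      h.left_right, h.right_left, h.right_right, smul_eq_mul, mul_one, mul_zero, add_zero,
      zero_add] at h1 h2
    exact ⟨h1, h2⟩
  have hsp : (⊤ : Submodule R Ω[R⁄k]) ≤ Submodule.span R (Set.range v) := by
    rw [← span_range_derivation, Submodule.span_le]
    rintro _ ⟨a, rfl⟩
    rw [h.D_eq a]
    exact Submodule.add_mem _ (Submodule.smul_mem _ _ (Submodule.subset_span ⟨0, rfl⟩))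
      (Submodule.smul_mem _ _ (Submodule.subset_span ⟨1, rfl⟩))
  exact ⟨Basis.mk hli hsp, Basis.mk_apply hli hsp 0, Basis.mk_apply hli hsp 1⟩

theorem IsCoordinatePair.exists_basis_localization (h : IsCoordinatePair x y d₁ d₂) {T : Type*}
    [CommRing T] [Algebra k T] [Algebra R T] [IsScalarTower k R T] (M : Submonoid R)
    [IsLocalization M T] :
    ∃ e : Basis (Fin 2) T Ω[T⁄k], e 0 = D k T (algebraMap R T x) ∧
      e 1 = D k T (algebraMap R T y) := by
  obtain ⟨e, he0, he1⟩ := h.exists_basis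
  refine ⟨e.ofIsLocalizedModule T M (KaehlerDifferential.map k k R T), ?_, ?_⟩
  · rw [Basis.ofIsLocalizedModule_apply, he0, map_D]
  · rw [Basis.ofIsLocalizedModule_apply, he1, map_D]

end Localization

theorem D_algebraMap_eq {k T K : Type*} [CommRing k] [CommRing T] [CommRing K] [Algebra k T]
    [Algebra k K] [Algebra T K] [IsScalarTower k T K] {x y : T} (e : Basis (Fin 2) T Ω[T⁄k])
    (he0 : e 0 = D k T x) (he1 : e 1 = D k T y) (a : T) :
    D k K (algebraMap T K a) = algebraMap T K (e.repr (D k T a) 0) • D k K (algebraMap T K x) +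
      algebraMap T K (e.repr (D k T a) 1) • D k K (algebraMap T K y) := by
  have h := congrArg (KaehlerDifferential.map k k T K) (e.sum_repr (D k T a))
  rw [Fin.sum_univ_two, he0, he1, map_add, map_smul, map_smul, map_D, map_D, map_D] at h
  rw [← h, algebraMap_smul, algebraMap_smul]

/-- Isomorphic fields have isomorphic spaces of two-forms. -/
theorem exists_twoForm_equiv {k K K' : Type*} [CommRing k] [Field K] [Field K'] [Algebra k K]
    [Algebra k K'] (σ : K ≃ₐ[k] K') {x y : K} (e : Basis (Fin 2) K Ω[K⁄k]) (he0 : e 0 = D k K x)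
    (he1 : e 1 = D k K y) (e' : Basis (Fin 2) K' Ω[K'⁄k]) (he0' : e' 0 = D k K' (σ x))
    (he1' : e' 1 = D k K' (σ y)) :
    ∃ Φ : ⋀[K]^2 Ω[K⁄k] ≃ₗ[k] ⋀[K']^2 Ω[K'⁄k], (∀ (c : K) ω, Φ (c • ω) = σ c • Φ ω) ∧
      ∀ a b, Φ (exteriorPower.ιMulti K 2 ![D k K a, D k K b]) =
        exteriorPower.ιMulti K' 2 ![D k K' (σ a), D k K' (σ b)] := by
  obtain ⟨L, hL⟩ := exists_exteriorPower_equiv e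
  obtain ⟨L', hL'⟩ := exists_exteriorPower_equiv e'
  let Φ : ⋀[K]^2 Ω[K⁄k] ≃ₗ[k] ⋀[K']^2 Ω[K'⁄k] :=
    (L.restrictScalars k).trans (σ.toLinearEquiv.trans (L'.restrictScalars k).symm)
  have hΦ : ∀ ω, L' (Φ ω) = σ (L ω) := fun ω => L'.apply_symm_apply _
  have hs : ∀ (c : K) ω, Φ (c • ω) = σ c • Φ ω := fun c ω => L'.injective <| by
    rw [hΦ, L.map_smul, L'.map_smul, hΦ, smul_eq_mul, map_mul, smul_eq_mul]
  refine ⟨Φ, hs, fun a b => ?_⟩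
  let : Algebra K K' := σ.toRingEquiv.toRingHom.toAlgebra
  have : IsScalarTower k K K' := .of_algebraMap_eq fun r => (σ.commutes r).symm
  have hD : ∀ a, ∃ α β : K, D k K a = α • e 0 + β • e 1 ∧
      D k K' (σ a) = σ α • e' 0 + σ β • e' 1 := by
    intro a
    refine ⟨_, _, by conv_lhs => rw [← e.sum_repr (D k K a), Fin.sum_univ_two], ?_⟩
    rw [he0', he1']
    exact D_algebraMap_eq (K := K') e he0 he1 a
  obtain ⟨α, β, h1, h2⟩ := hD a
  obtain ⟨γ, δ, h3, h4⟩ := hD b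
  rw [h1, h2, h3, h4, ιMulti_pair, ιMulti_pair, hs, ← map_mul, ← map_mul, ← map_sub]
  congr 1
  exact L'.injective (by rw [hΦ, hL, hL', map_one])

end TwoForms

/-! ### Divisors and prime factorizations in a factorial ring. -/

section PrimeSystem

open IsLocalRing

section AtPrime

variable {R O : Type*} [CommRing R] [IsDomain R] [WfDvdMonoid R] [CommRing O] [IsDomain O]
  [Algebra R O] {p : R} [hP : (Ideal.span {p}).IsPrime] [IsLocalization.AtPrime O (Ideal.span {p})]

theorem isUnit_algebraMap_of_not_dvd (O : Type*) [CommRing O] [Algebra R O]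
    [IsLocalization.AtPrime O (Ideal.span {p})] {c : R} (hc : ¬ p ∣ c) :
    IsUnit (algebraMap R O c) :=
  (IsLocalization.AtPrime.isUnit_to_map_iff O (Ideal.span {p}) c).2
    fun h => hc (Ideal.mem_span_singleton.1 h)

variable (O) in
theorem irreducible_algebraMap (hp : Prime p) : Irreducible (algebraMap R O p) := by
  have hinj : Function.Injective (algebraMap R O) :=
    IsLocalization.injective O (Ideal.span {p}).primeCompl_le_nonZeroDivisors
  have := IsLocalization.AtPrime.isLocalRing O (Ideal.span {p})
  refine Prime.irreducible ((Ideal.span_singleton_prime ?_).1 ?_)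
  · rw [Ne, map_eq_zero_iff _ hinj]
    exact hp.ne_zero
  · rw [← Set.image_singleton, ← Ideal.map_span, IsLocalization.AtPrime.map_eq_maximalIdeal]
    infer_instance

variable (O) in
theorem exists_algebraMap_eq_mul_pow (hp : Prime p) {a : R} (ha : a ≠ 0) :
    ∃ (n : ℕ) (u : O), IsUnit u ∧ algebraMap R O a = u * algebraMap R O p ^ n ∧
      emultiplicity p a = n := by
  have hf : FiniteMultiplicity p a := FiniteMultiplicity.of_prime_left hp ha
  obtain ⟨c, hc, hpc⟩ := hf.exists_eq_pow_mul_and_not_dvd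
  refine ⟨multiplicity p a, _, isUnit_algebraMap_of_not_dvd O hpc, ?_,
    hf.emultiplicity_eq_multiplicity⟩
  conv_lhs => rw [hc, map_mul, map_pow, mul_comm]

variable (O) in
theorem isDiscreteValuationRing_of_atPrime (hp : Prime p) : IsDiscreteValuationRing O := by
  refine isDiscreteValuationRing_of_forall (irreducible_algebraMap O hp) fun z hz => ?_
  obtain ⟨⟨r, s⟩, hrs⟩ := IsLocalization.surj (Ideal.span {p}).primeCompl z
  have hs : IsUnit (algebraMap R O s) := IsLocalization.map_units O s
  have hr : r ≠ 0 := by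
    rintro rfl
    rw [map_zero] at hrs
    exact mul_ne_zero hz hs.ne_zero hrs
  obtain ⟨n, u, hu, hru, -⟩ := exists_algebraMap_eq_mul_pow O hp hr
  refine ⟨n, u * ↑hs.unit⁻¹, hu.mul (Units.isUnit _), ?_⟩
  rw [mul_right_comm, ← hru, ← hrs, mul_assoc, IsUnit.mul_val_inv, mul_one]

variable (O) in
theorem ord_algebraMap_eq (hp : Prime p) {a : R} (ha : a ≠ 0) :
    Ring.ord O (algebraMap R O a) = emultiplicity p a := by
  have := isDiscreteValuationRing_of_atPrime O hp
  obtain ⟨n, u, hu, h, hn⟩ := exists_algebraMap_eq_mul_pow O hp ha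
  rw [h, hn, ord_mul_pow (irreducible_algebraMap O hp) hu]

end AtPrime

/-- A family of representatives of the primes up to units. -/
structure IsPrimeSystem {R I : Type*} [CommRing R] (p : I → R) : Prop where
  prime : ∀ i, Prime (p i)
  exists_associated : ∀ q, Prime q → ∃ i, Associated q (p i)
  injective : ∀ i j, Associated (p i) (p j) → i = j

namespace IsPrimeSystem

variable {R I : Type*} [CommRing R] [IsDomain R] [UniqueFactorizationMonoid R] {p : I → R}

theorem emultiplicity_self (h : IsPrimeSystem p) (i : I) : emultiplicity (p i) (p i) = 1 := by
  have := emultiplicity_pow_self (h.prime i).ne_zero (h.prime i).not_isUnit 1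
  simpa using this

theorem emultiplicity_of_ne (h : IsPrimeSystem p) {i j : I} (hij : i ≠ j) :
    emultiplicity (p i) (p j) = 0 :=
  emultiplicity_eq_zero.2 fun hd =>
    hij (h.injective i j ((h.prime i).associated_of_dvd (h.prime j) hd))

/-- The element with prescribed multiplicities. -/
noncomputable def _root_.primeProd (p : I → R) (D : I →₀ ℕ) : R := D.prod fun i n => p i ^ n

theorem primeProd_ne_zero (h : IsPrimeSystem p) (D : I →₀ ℕ) : primeProd p D ≠ 0 :=
  Finset.prod_ne_zero_iff.2 fun i _ => pow_ne_zero _ (h.prime i).ne_zero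

theorem emultiplicity_primeProd (h : IsPrimeSystem p) (D : I →₀ ℕ) (i : I) :
    emultiplicity (p i) (primeProd p D) = D i := by
  rw [primeProd, Finsupp.prod, Finset.emultiplicity_prod (h.prime i)]
  simp only [emultiplicity_pow (h.prime i)]
  rw [Finset.sum_eq_single i]
  · rw [h.emultiplicity_self, mul_one]
  · intro j _ hj
    rw [h.emultiplicity_of_ne hj.symm, mul_zero]
  · intro hi
    rw [Finsupp.notMem_support_iff.1 hi]
    simp

theorem dvd_of_emultiplicity_le (h : IsPrimeSystem p) {a b : R} (ha : a ≠ 0)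
    (hab : ∀ i, emultiplicity (p i) a ≤ emultiplicity (p i) b) : a ∣ b := by
  rw [UniqueFactorizationMonoid.dvd_iff_emultiplicity_le ha]
  intro q hq
  obtain ⟨i, hi⟩ := h.exists_associated q hq
  rw [emultiplicity_eq_of_associated_left hi.symm, emultiplicity_eq_of_associated_left hi.symm]
  exact hab i

theorem associated_primeProd (h : IsPrimeSystem p) {D : I →₀ ℕ} {a : R} (ha : a ≠ 0)
    (haD : ∀ i, emultiplicity (p i) a = D i) : Associated a (primeProd p D) :=
  associated_of_dvd_dvd
    (h.dvd_of_emultiplicity_le ha fun i => by rw [haD, h.emultiplicity_primeProd])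
    (h.dvd_of_emultiplicity_le (h.primeProd_ne_zero D)
      fun i => by rw [haD, h.emultiplicity_primeProd])

theorem primeProd_dvd (p : I → R) {D E : I →₀ ℕ} (hDE : D ≤ E) :
    primeProd p D ∣ primeProd p E := by
  obtain ⟨F, rfl⟩ := exists_add_of_le hDE
  rw [primeProd, primeProd, Finsupp.prod_add_index' (fun i => pow_zero _) fun i m n => pow_add _ _ _]
  exact dvd_mul_right _ _

theorem squarefree_primeProd (h : IsPrimeSystem p) {D : I →₀ ℕ} (hD : ∀ i, D i ≤ 1) :
    Squarefree (primeProd p D) := by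
  intro z hz
  by_contra hzu
  have hz0 : z ≠ 0 := by
    rintro rfl
    rw [zero_mul, zero_dvd_iff] at hz
    exact h.primeProd_ne_zero D hz
  obtain ⟨q, hq, hqz⟩ := WfDvdMonoid.exists_irreducible_factor hzu hz0
  obtain ⟨i, hi⟩ := h.exists_associated q hq.prime
  have h1 : p i ^ 2 ∣ primeProd p D := by
    rw [pow_two]
    exact (mul_dvd_mul (hi.symm.dvd.trans hqz) (hi.symm.dvd.trans hqz)).trans hz
  have h2 := le_emultiplicity_of_pow_dvd h1
  rw [h.emultiplicity_primeProd] at h2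
  have h3 := hD i
  norm_cast at h2
  omega

/-- An element of the fraction field that is integral at all primes is integral. -/
theorem exists_algebraMap_eq_of_forall (h : IsPrimeSystem p) {K : Type*} [Field K] [Algebra R K]
    [IsFractionRing R K] {z : K}
    (hz : ∀ i, ∃ r s : R, ¬ p i ∣ s ∧ algebraMap R K s * z = algebraMap R K r) :
    ∃ r, algebraMap R K r = z := by
  obtain ⟨u, ⟨v, hv⟩, huv, rfl⟩ := IsFractionRing.exists_reduced_fraction R z
  have hv0 : v ≠ 0 := nonZeroDivisors.ne_zero hv
  have hvK : algebraMap R K v ≠ 0 := by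
    rwa [Ne, map_eq_zero_iff _ (IsFractionRing.injective R K)]
  by_cases hvu : IsUnit v
  · refine ⟨u * ↑hvu.unit⁻¹, ?_⟩
    rw [IsFractionRing.mk'_eq_div, eq_div_iff hvK, ← map_mul, mul_assoc, IsUnit.val_inv_mul,
      mul_one]
  obtain ⟨q, hq, hqv⟩ := WfDvdMonoid.exists_irreducible_factor hvu hv0
  obtain ⟨i, hi⟩ := h.exists_associated q hq.prime
  obtain ⟨r, s, hs, hrs⟩ := hz i
  have h1 : s * u = r * v := by
    apply IsFractionRing.injective R K
    rw [IsFractionRing.mk'_eq_div, mul_div_assoc', div_eq_iff hvK] at hrs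
    rw [map_mul, map_mul, hrs]
  have h2 : p i ∣ v := hi.symm.dvd.trans hqv
  have h3 : p i ∣ u := ((h.prime i).dvd_or_dvd (h1 ▸ Dvd.dvd.mul_left h2 r)).resolve_left hs
  exact absurd (huv h3 h2) (h.prime i).not_isUnit

end IsPrimeSystem

end PrimeSystem

/-! ### The order of a rounded divisor along the exceptional curve. -/

section Exceptional

open IsLocalRing

variable {R I : Type*} [CommRing R] [IsDomain R] [IsLocalRing R] [IsNoetherianRing R]
  [UniqueFactorizationMonoid R] {p : I → R} {x y : R}

/-- The reduction of a divisor. -/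
noncomputable def reducedFinsupp (C : I →₀ ℕ) : I →₀ ℕ := C.mapRange (fun n => min n 1) rfl

theorem reducedFinsupp_le (C : I →₀ ℕ) : reducedFinsupp C ≤ C :=
  fun i => min_le_left (C i) 1

theorem primeProd_reducedFinsupp (p : I → R) (C : I →₀ ℕ) :
    primeProd p (reducedFinsupp C) = ∏ i ∈ C.support, p i := by
  have hs : (reducedFinsupp C).support = C.support := by
    ext i
    simp only [Finsupp.mem_support_iff, reducedFinsupp, Finsupp.mapRange_apply]
    omega
  rw [primeProd, Finsupp.prod, hs]
  refine Finset.prod_congr rfl fun i hi => ?_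
  have : reducedFinsupp C i = 1 := by
    rw [Finsupp.mem_support_iff] at hi
    simp only [reducedFinsupp, Finsupp.mapRange_apply]
    omega
  rw [this, pow_one]

/-- The order along the exceptional curve of the round up of `tC` exceeds the round up of `t` times
the order of `C` by at most one, if the reduction of `C` has multiplicity at most two. -/
theorem IsExceptionalChart.exists_algebraMap_primeProd_eq {A : Type*} [CommRing A] [IsDomain A]
    [IsLocalRing A] [Algebra R A] {w : A} (hA : IsExceptionalChart x y w) (h : IsRegularPair x y)
    (hp : IsPrimeSystem p) {C : I →₀ ℕ}
    (hC : primeProd p (reducedFinsupp C) ∉ maximalIdeal R ^ 3) {t : ℝ} (ht : 0 ≤ t) :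
    ∃ m n : ℕ, Ring.ord A (algebraMap R A (primeProd p C)) = n ∧ m ≤ 1 + ⌈t * (n : ℝ)⌉₊ ∧
      ∃ u : A, IsUnit u ∧ algebraMap R A (primeProd p
        (C.mapRange (fun n : ℕ => ⌈t * (n : ℝ)⌉₊) (by simp))) = u * algebraMap R A x ^ m := by
  have := hA.isDiscreteValuationRing h
  have hirr := hA.irreducible h
  have hμ : ∀ i, ∃ (k : ℕ) (u : A), IsUnit u ∧ algebraMap R A (p i) = u * algebraMap R A x ^ k := by
    intro i
    obtain ⟨n, hn⟩ := IsRegularPair.exists_not_mem_pow (hp.prime i).ne_zero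
    obtain ⟨k, -, u, hu, hk⟩ := hA.exists_algebraMap_eq h hn
    exact ⟨k, u, hu, hk⟩
  choose μ u hu hμu using hμ
  have key : ∀ (s : Finset I) (c : I → ℕ), algebraMap R A (∏ i ∈ s, p i ^ c i) =
      (∏ i ∈ s, u i ^ c i) * algebraMap R A x ^ ∑ i ∈ s, c i * μ i := by
    intro s c
    rw [← Finset.prod_pow_eq_pow_sum, ← Finset.prod_mul_distrib, map_prod]
    refine Finset.prod_congr rfl fun i _ => ?_
    rw [map_pow, hμu, mul_pow, ← pow_mul, mul_comm (c i)]
  have hunit : ∀ (s : Finset I) (c : I → ℕ), IsUnit (∏ i ∈ s, u i ^ c i) := fun s c =>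
    IsUnit.prod_iff.2 fun i _ => (hu i).pow _
  -- The sum of the μ is the order along E of the reduced equation, which is at most its order at P.
  have hsum : ∑ i ∈ C.support, μ i ≤ 2 := by
    obtain ⟨k, hk, v, hv, hkv⟩ := hA.exists_algebraMap_eq h hC
    rw [primeProd_reducedFinsupp] at hkv
    have h1 := key C.support 1
    simp only [Pi.one_apply, pow_one, one_mul] at h1
    have h2 := congrArg (Ring.ord A) (h1.symm.trans hkv)
    have h3 := hunit C.support 1
    simp only [Pi.one_apply, pow_one] at h3
    rw [ord_mul_pow hirr h3, ord_mul_pow hirr hv] at h2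
    have : ∑ i ∈ C.support, μ i = k := by exact_mod_cast h2
    omega
  refine ⟨∑ i ∈ C.support, ⌈t * (C i : ℝ)⌉₊ * μ i, ∑ i ∈ C.support, C i * μ i, ?_,
    sum_ceil_mul_le _ _ _ hsum ht, _, hunit C.support fun i => ⌈t * (C i : ℝ)⌉₊, ?_⟩
  · rw [primeProd, Finsupp.prod, key, ord_mul_pow hirr (hunit _ _)]
  · rw [← key, primeProd, Finsupp.prod_mapRange_index fun i => pow_zero _]
    rfl

end Exceptional

/-! ### The multiplicity of the reduced divisor. -/

section Multiplicity

open IsLocalRing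

variable {R I : Type*} [CommRing R] [IsDomain R] [IsLocalRing R] [IsNoetherianRing R]
  [UniqueFactorizationMonoid R] [Algebra ℚ R] {p : I → R} {k : Type*} [CommRing k] [Algebra k R]
  {x y : R} {d₁ d₂ : Derivation k R R} {D : Type*} [CommRing D] [Algebra R D]

/-- A divisor whose completed equation is `f ^ m * g ^ n` with `f` and `g` smooth has reduction of
multiplicity at most two. -/
theorem IsCoordinatePair.primeProd_not_mem [IsLocalRing D] (h : IsCoordinatePair x y d₁ d₂)
    (hD : IsLocalCompletion R D) (hp : IsPrimeSystem p) {C : I →₀ ℕ} {f g : D} {m n : ℕ}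
    (hf : f ∈ maximalIdeal D) (hf' : f ∉ maximalIdeal D ^ 2) (hg : g ∈ maximalIdeal D)
    (hg' : g ∉ maximalIdeal D ^ 2)
    (hfg : Associated (algebraMap R D (primeProd p C)) (f ^ m * g ^ n)) :
    primeProd p (reducedFinsupp C) ∉ maximalIdeal R ^ 3 := by
  obtain ⟨c, hc⟩ := IsPrimeSystem.primeProd_dvd p (reducedFinsupp_le C)
  obtain ⟨u, hu⟩ := hfg.symm
  refine hD.not_mem_pow_three_of_mul_eq h.isRegularPair hf hf' hg hg' u.isUnit (c := c)
    (m := m) (n := n) ?_ ?_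
  · rw [← hc, ← hu]
    ring
  · exact h.isRegularPair.exists_sub_sq_mul_not_mem_pow h.left_left h.left_right h.right_left
      h.right_right (hp.primeProd_ne_zero _)
      (hp.squarefree_primeProd fun i => min_le_right (C i) 1)

end Multiplicity

/-! ### Pole bounds along the exceptional curve. -/

section Forms

open IsLocalRing KaehlerDifferential Module

theorem exists_eq_smul_of_mem_span {k T K : Type*} [CommRing k] [CommRing T] [CommRing K]
    [Algebra k T] [Algebra k K] [Algebra T K] [IsScalarTower k T K] {x y : T}
    (e : Basis (Fin 2) T Ω[T⁄k]) (he0 : e 0 = D k T x) (he1 : e 1 = D k T y) {ω : ⋀[K]^2 Ω[K⁄k]}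
    (hω : ω ∈ Submodule.span (algebraMap T K).range
      {ω | ∃ a ∈ (algebraMap T K).range, ∃ b ∈ (algebraMap T K).range,
        ω = exteriorPower.ιMulti K 2 ![D k K a, D k K b]}) :
    ∃ c : T, ω = algebraMap T K c •
      exteriorPower.ιMulti K 2 ![D k K (algebraMap T K x), D k K (algebraMap T K y)] := by
  induction hω using Submodule.span_induction with
  | mem ω hω =>
    obtain ⟨_, ⟨a, rfl⟩, _, ⟨b, rfl⟩, rfl⟩ := hω
    rw [D_algebraMap_eq e he0 he1 a, D_algebraMap_eq e he0 he1 b, ιMulti_pair, ← map_mul, ← map_mul,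
      ← map_sub]
    exact ⟨_, rfl⟩
  | zero => exact ⟨0, by rw [map_zero, zero_smul]⟩
  | add ω η _ _ hω hη =>
    obtain ⟨c, rfl⟩ := hω
    obtain ⟨d, rfl⟩ := hη
    exact ⟨c + d, by rw [map_add, add_smul]⟩
  | smul r ω _ hω =>
    obtain ⟨c, rfl⟩ := hω
    obtain ⟨_, ⟨r, rfl⟩⟩ := r
    exact ⟨r * c, by rw [map_mul, mul_smul]; rfl⟩

/-- The formula K_{S'} = g^*K_S + E in a chart. -/
theorem ιMulti_D_mul {k K : Type*} [CommRing k] [CommRing K] [Algebra k K] (a w : K) :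
    exteriorPower.ιMulti K 2 ![D k K a, D k K (a * w)] =
      a • exteriorPower.ιMulti K 2 ![D k K a, D k K w] := by
  have h := ιMulti_pair (D k K a) (D k K w) 1 0 w a
  rw [one_smul, zero_smul, add_zero, add_comm, ← Derivation.leibniz] at h
  rw [h]
  simp

variable {R I : Type*} [CommRing R] [IsDomain R] [IsLocalRing R] [IsNoetherianRing R]
  [UniqueFactorizationMonoid R] {p : I → R} {x y : R}

/-- A rational function with poles bounded by the round up of `tC`, multiplied by an equation of the
exceptional curve, has poles along this curve bounded by the round up of the pull-back of `tC`. -/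
theorem IsExceptionalChart.exists_mul_eq_algebraMap {A : Type*} [CommRing A] [IsDomain A]
    [IsLocalRing A] [Algebra R A] {w : A} (hA : IsExceptionalChart x y w) (h : IsRegularPair x y)
    (hp : IsPrimeSystem p) {C : I →₀ ℕ}
    (hC : primeProd p (reducedFinsupp C) ∉ maximalIdeal R ^ 3) {t : ℝ} (ht : 0 ≤ t) {n : ℕ}
    (hn : Ring.ord A (algebraMap R A (primeProd p C)) = n) {K K' : Type*} [Field K] [Field K']
    [Algebra R K] [IsFractionRing R K] [Algebra A K']
    (σ : K →+* K') (hσ : ∀ r, σ (algebraMap R K r) = algebraMap A K' (algebraMap R A r)) {z : K}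
    (hz : ∀ i, ∃ r s : R, ¬ p i ∣ s ∧
      algebraMap R K s * (algebraMap R K (p i ^ ⌈t * (C i : ℝ)⌉₊) * z) = algebraMap R K r)
    {b : A} (hb : b ∈ maximalIdeal A ^ ⌈t * (n : ℝ)⌉₊) :
    ∃ c : A, algebraMap A K' b * (σ z * algebraMap A K' (algebraMap R A x)) =
      algebraMap A K' c := by
  obtain ⟨m, n', hn', hm, u, hu, hum⟩ := hA.exists_algebraMap_primeProd_eq h hp hC ht
  obtain rfl : n' = n := by
    rw [hn] at hn'
    exact_mod_cast hn'.symm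
  set Θ : I →₀ ℕ := C.mapRange (fun n : ℕ => ⌈t * (n : ℝ)⌉₊) (by simp) with hΘ
  -- Multiplied by an equation of the rounded divisor, z has no pole along any prime divisor through
  -- P, so it lies in R by factoriality.
  obtain ⟨v, hv⟩ : ∃ v, algebraMap R K v = algebraMap R K (primeProd p Θ) * z := by
    refine hp.exists_algebraMap_eq_of_forall fun i => ?_
    obtain ⟨r, s, hs, hrs⟩ := hz i
    obtain ⟨c, hc⟩ : p i ^ Θ i ∣ primeProd p Θ := pow_dvd_of_le_emultiplicity
      (hp.emultiplicity_primeProd Θ i).ge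
    refine ⟨c * r, s, hs, ?_⟩
    rw [map_mul _ c, ← hrs, hc, map_mul]
    simp only [Θ, Finsupp.mapRange_apply]
    ring
  have h1 := congrArg σ hv
  rw [map_mul, hσ, hσ, hum] at h1
  rw [hA.maximalIdeal_eq h, Ideal.span_singleton_pow, Ideal.mem_span_singleton'] at hb
  obtain ⟨c, rfl⟩ := hb
  -- The additional factor x supplies the 1 in `hm`; d is the slack.
  obtain ⟨d, hd⟩ := exists_add_of_le hm
  refine ⟨c * algebraMap R A x ^ d * (↑hu.unit⁻¹ * algebraMap R A v), ?_⟩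
  have h2 : algebraMap A K' u * algebraMap A K' ↑hu.unit⁻¹ = 1 := by
    rw [← map_mul, IsUnit.mul_val_inv, map_one]
  have h3 : algebraMap A K' (algebraMap R A x) *
      algebraMap A K' (algebraMap R A x) ^ ⌈t * (n' : ℝ)⌉₊ =
        algebraMap A K' (algebraMap R A x) ^ m * algebraMap A K' (algebraMap R A x) ^ d := by
    rw [← pow_succ', ← pow_add, ← hd, add_comm]
  simp only [map_mul, map_pow] at h1 ⊢
  rw [h1]
  linear_combination (algebraMap A K' c * σ z) * h3 -
    (algebraMap A K' c * algebraMap A K' (algebraMap R A x) ^ d * σ z *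
      algebraMap A K' (algebraMap R A x) ^ m) * h2

end Forms

namespace BlowUpRoundUp

open IsLocalRing KaehlerDifferential Module

/-! ### The complex structure and differentials of local rings. -/

section Constants

variable (S : Scheme.{0}) [S.Over SpecC]

/-- The constants in a local ring. -/
noncomputable def stalkConst (x : S) : CommRingCat.of ℂ ⟶ S.presheaf.stalk x :=
  (Scheme.ΓSpecIso (CommRingCat.of ℂ)).inv ≫ (S ↘ SpecC).appTop ≫ S.presheaf.germ ⊤ x (TopologicalSpace.Opens.mem_top x)

/-- The local rings are algebras over the complex numbers. -/
@[reducible]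
noncomputable def stalkAlgebra (x : S) : Algebra ℂ (S.presheaf.stalk x) :=
  (stalkConst S x).hom.toAlgebra

theorem stalkConst_stalkSpecializes {x y : S} (h : x ⤳ y) :
    stalkConst S y ≫ S.presheaf.stalkSpecializes h = stalkConst S x := by
  simp only [stalkConst, Category.assoc]
  rw [TopCat.Presheaf.germ_stalkSpecializes]

theorem SpecMap_stalkConst (x : S) :
    Spec.map (stalkConst S x) = S.fromSpecStalk x ≫ (S ↘ SpecC) := by
  have h1 : (S ↘ SpecC) = S.toSpecΓ ≫ Spec.map (S ↘ SpecC).appTop ≫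
      Spec.map (Scheme.ΓSpecIso (CommRingCat.of ℂ)).inv := by
    rw [← Scheme.toSpecΓ_naturality_assoc, toSpecΓ_SpecMap_ΓSpecIso_inv, Category.comp_id]
  have h2 := Scheme.fromSpecStalk_toSpecΓ S x
  rw [stalkConst, Spec.map_comp, Spec.map_comp, Category.assoc, ← h2, Category.assoc, ← h1]

theorem stalkConst_stalkMap {S' : Scheme.{0}} [S'.Over SpecC] (g : S' ⟶ S) [g.IsOver SpecC]
    (x' : S') : stalkConst S (g x') ≫ g.stalkMap x' = stalkConst S' x' := by
  have h : g ≫ (S ↘ SpecC) = S' ↘ SpecC := comp_over g SpecC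
  simp only [stalkConst, Category.assoc]
  rw [Scheme.Hom.germ_stalkMap, ← h, Scheme.Hom.comp_appTop, Category.assoc]
  rfl

end Constants

section SmoothPoint

variable (S : Scheme.{0}) [S.Over SpecC] [h : IsSmoothSurface S]

theorem smooth_over : Smooth (S ↘ SpecC) :=
  have := h.smooth
  SmoothOfRelativeDimension.smooth 2 _

theorem isLocallyNoetherian : IsLocallyNoetherian S :=
  have := smooth_over S
  LocallyOfFiniteType.isLocallyNoetherian (S ↘ SpecC)

/-- Nullstellensatz: the residue field at a closed point is ℂ. -/
theorem exists_sub_const_mem {P : S} (hP : IsClosed ({P} : Set S)) (r : S.presheaf.stalk P) :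
    ∃ c : ℂ, r - (stalkConst S P).hom c ∈ maximalIdeal (S.presheaf.stalk P) := by
  have := smooth_over S
  have h1 := SpecMap_residueFieldIsoBase_inv (K := ℂ) (S ↘ SpecC) P hP
  have h2 : (residueFieldIsoBase (K := ℂ) (S ↘ SpecC) P hP).inv =
      stalkConst S P ≫ S.residue P := by
    apply Spec.map_injective
    rw [h1, Spec.map_comp, SpecMap_stalkConst]
    rfl
  obtain ⟨c, hc⟩ := (residueFieldIsoBase (K := ℂ) (S ↘ SpecC) P
    hP).symm.commRingCatIsoToRingEquiv.surjective ((S.residue P).hom r)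
  refine ⟨c, ?_⟩
  have h3 : (S.residue P).hom ((stalkConst S P).hom c) = (S.residue P).hom r := by
    rw [← hc]
    exact congrArg (fun f => f.hom c) h2.symm
  rw [← IsLocalRing.residue_eq_zero_iff, map_sub, sub_eq_zero]
  exact h3.symm

/-- The differentials are free of rank two at every point of a smooth surface. -/
theorem exists_basis_kaehlerDifferential (P : S) :
    letI := stalkAlgebra S P
    Nonempty (Basis (Fin 2) (S.presheaf.stalk P) Ω[S.presheaf.stalk P⁄ℂ]) := by
  have := h.smooth
  obtain ⟨U, hU, V, hV, hPV, e, hst⟩ :=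
    SmoothOfRelativeDimension.exists_isStandardSmoothOfRelativeDimension (n := 2)
      (f := S ↘ SpecC) P
  -- The base is a single point.
  obtain rfl : U = ⊤ := by
    ext z
    have : z = (S ↘ SpecC) P := Subsingleton.elim (α := PrimeSpectrum ℂ) _ _
    simp only [this, TopologicalSpace.Opens.coe_top, Set.mem_univ, iff_true]
    exact e hPV
  let φ : CommRingCat.of ℂ ⟶ Γ(S, V) :=
    (Scheme.ΓSpecIso (CommRingCat.of ℂ)).inv ≫ (S ↘ SpecC).appLE ⊤ V e
  let := stalkAlgebra S P
  algebraize [φ.hom, ((S ↘ SpecC).appLE ⊤ V e).hom, (Scheme.ΓSpecIso (CommRingCat.of ℂ)).inv.hom]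
  have : IsScalarTower ℂ Γ(SpecC, ⊤) Γ(S, V) := .of_algebraMap_eq fun _ => rfl
  have h0 : Algebra.IsStandardSmoothOfRelativeDimension 0 ℂ Γ(SpecC, ⊤) :=
    .of_algebraMap_bijective
      (Scheme.ΓSpecIso (CommRingCat.of ℂ)).symm.commRingCatIsoToRingEquiv.bijective
  have h2 : Algebra.IsStandardSmoothOfRelativeDimension 2 Γ(SpecC, ⊤) Γ(S, V) := hst
  have h2' : Algebra.IsStandardSmoothOfRelativeDimension 2 ℂ Γ(S, V) :=
    Algebra.IsStandardSmoothOfRelativeDimension.trans ℂ Γ(SpecC, ⊤) Γ(S, V) (n := 0) (m := 2)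
  have := Algebra.IsStandardSmoothOfRelativeDimension.isStandardSmooth 2 (R := ℂ) (S := Γ(S, V))
  have : Nontrivial Γ(S, V) := (S.presheaf.germ V P hPV).hom.domain_nontrivial
  have hr := Algebra.IsStandardSmoothOfRelativeDimension.rank_kaehlerDifferential (R := ℂ)
    (S := Γ(S, V)) 2
  have hfr : Module.finrank Γ(S, V) Ω[Γ(S, V)⁄ℂ] = 2 := by
    rw [Module.finrank, hr]
    simp
  let b := Module.finBasisOfFinrankEq Γ(S, V) Ω[Γ(S, V)⁄ℂ] hfr
  let := TopCat.Presheaf.algebra_section_stalk S.presheaf (⟨P, hPV⟩ : V)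
  have := hV.isLocalization_stalk ⟨P, hPV⟩
  have : IsScalarTower ℂ Γ(S, V) (S.presheaf.stalk P) := .of_algebraMap_eq' <| by
    have : stalkConst S P = φ ≫ S.presheaf.germ V P hPV := by
      simp only [stalkConst, φ, Scheme.Hom.appLE, Scheme.Hom.appTop, Category.assoc,
        TopCat.Presheaf.germ_res]
      rfl
    exact congrArg CommRingCat.Hom.hom this
  exact ⟨b.ofIsLocalizedModule (S.presheaf.stalk P)
    (hV.primeIdealOf ⟨P, hPV⟩).asIdeal.primeCompl
    (KaehlerDifferential.map ℂ ℂ Γ(S, V) (S.presheaf.stalk P))⟩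

end SmoothPoint

end BlowUpRoundUp

namespace BlowUpRoundUp

open IsLocalRing

/-! ### Generizations of a point and primes of its local ring. -/

section Generization

variable {S : Scheme.{0}} {P x : S}

theorem stalkSpecializes_injective [IsIntegral S] (h : x ⤳ P) :
    Function.Injective (S.presheaf.stalkSpecializes h).hom := by
  have h1 : S.presheaf.stalkSpecializes h ≫ S.presheaf.stalkSpecializes
      ((genericPoint_spec S).specializes (Set.mem_univ x)) = S.presheaf.stalkSpecializes
      ((genericPoint_spec S).specializes (Set.mem_univ P)) := by simp
  have h2 : Function.Injective (algebraMap (S.presheaf.stalk P) S.functionField) :=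
    IsFractionRing.injective _ _
  refine Function.Injective.of_comp (f := algebraMap (S.presheaf.stalk x) S.functionField) ?_
  rw [← RingHom.coe_comp]
  convert h2
  exact congrArg CommRingCat.Hom.hom h1

/-- The prime ideal of the local ring at `P` that belongs to a generization of `P`. -/
noncomputable def genericPrime (h : x ⤳ P) : Ideal (S.presheaf.stalk P) :=
  (maximalIdeal (S.presheaf.stalk x)).comap (S.presheaf.stalkSpecializes h).hom

instance (h : x ⤳ P) : (genericPrime h).IsPrime := Ideal.comap_isPrime _ _

theorem fromSpecStalk_genericPrime (h : x ⤳ P) :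
    S.fromSpecStalk P (show PrimeSpectrum (S.presheaf.stalk P) from
      ⟨genericPrime h, inferInstance⟩) = x := by
  have h1 := Scheme.SpecMap_stalkSpecializes_fromSpecStalk h
  have h2 : (Spec.map (S.presheaf.stalkSpecializes h) ≫ S.fromSpecStalk P) (closedPoint _) = x := by
    rw [h1, Scheme.fromSpecStalk_closedPoint]
  exact h2

theorem eq_of_genericPrime_eq {x' : S} {h : x ⤳ P} {h' : x' ⤳ P}
    (hq : genericPrime h = genericPrime h') : x = x' := by
  rw [← fromSpecStalk_genericPrime h, ← fromSpecStalk_genericPrime h']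
  congr 1
  exact PrimeSpectrum.ext hq

theorem exists_genericPrime_eq (q : Ideal (S.presheaf.stalk P)) [hq : q.IsPrime] :
    ∃ (x : S) (h : x ⤳ P), genericPrime h = q := by
  let z : PrimeSpectrum (S.presheaf.stalk P) := ⟨q, hq⟩
  have h : S.fromSpecStalk P z ⤳ P := by
    have : S.fromSpecStalk P z ∈ Set.range (S.fromSpecStalk P) := ⟨z, rfl⟩
    rwa [Scheme.range_fromSpecStalk] at this
  refine ⟨_, h, ?_⟩
  have := (S.fromSpecStalk P).isEmbedding.injective (fromSpecStalk_genericPrime h)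
  exact congrArg PrimeSpectrum.asIdeal this

/-- The local ring at a generization is a localization. -/
theorem isLocalization_genericPrime [IsIntegral S] (h : x ⤳ P) :
    letI := (S.presheaf.stalkSpecializes h).hom.toAlgebra
    IsLocalization.AtPrime (S.presheaf.stalk x) (genericPrime h) := by
  let := (S.presheaf.stalkSpecializes h).hom.toAlgebra
  refine (isLocalization_iff _ _).2 ⟨?_, ?_, ?_⟩
  · rintro ⟨y, hy⟩
    by_contra hu
    exact hy hu
  · intro z
    obtain ⟨_, ⟨U, hU, rfl⟩, hPU, -⟩ :=
      S.isBasis_affineOpens.exists_subset_of_mem_open (Set.mem_univ P) isOpen_univ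
    have hxU : x ∈ U := h.mem_open U.2 hPU
    let := TopCat.Presheaf.algebra_section_stalk S.presheaf (⟨x, hxU⟩ : U)
    have := hU.isLocalization_stalk ⟨x, hxU⟩
    obtain ⟨⟨a, s⟩, has⟩ := IsLocalization.surj
      (hU.primeIdealOf ⟨x, hxU⟩).asIdeal.primeCompl z
    have hs := IsLocalization.map_units (S.presheaf.stalk x) s
    have hgerm : ∀ f : Γ(S, U), (S.presheaf.stalkSpecializes h).hom
        ((S.presheaf.germ U P hPU).hom f) = algebraMap Γ(S, U) (S.presheaf.stalk x) f := fun f =>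
      congrArg (fun φ => φ.hom f) (S.presheaf.germ_stalkSpecializes hPU h)
    refine ⟨⟨(S.presheaf.germ U P hPU).hom a, (S.presheaf.germ U P hPU).hom s, fun hm => ?_⟩, ?_⟩
    · refine hm ?_
      rw [hgerm]
      exact hs
    · exact (congrArg (z * ·) (hgerm s)).trans (has.trans (hgerm a).symm)
  · intro a b hab
    exact ⟨1, by rw [stalkSpecializes_injective h hab]⟩

end Generization

end BlowUpRoundUp

namespace BlowUpRoundUp

open IsLocalRing

/-! ### Prime divisors through a point as prime elements. -/

section PrimeDivisors

variable {S : Scheme.{0}} [IsIntegral S] {P : S}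

/-- In dimension one the nonzero prime (a) would be maximal. Hence no prime divisor has P as its
generic point. -/
theorem coheight_ne_one [IsNoetherianRing (S.presheaf.stalk P)] {a b : S.presheaf.stalk P}
    (h : IsRegularPair a b) : Order.coheight P ≠ 1 := by
  intro hP
  have := krullDimLE_of_coheight_le (z := P) (n := 1) hP.le
  have h1 : (Ideal.span {a}).IsPrime := (Ideal.span_singleton_prime h.left_ne_zero).2 h.prime_left
  have h2 := h1.isMaximal_of_ne_bot (by simpa using h.left_ne_zero)
  exact h.not_le a h.left_mem 1 (by rw [pow_one, eq_maximalIdeal h2])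

variable (P) in
/-- The prime divisors through a point. -/
abbrev PrimeDivisorsThrough : Type := {x : PrimeDivisor S // x.1 ⤳ P}

theorem isLocalization_span {x : S} (h : x ⤳ P) {p : S.presheaf.stalk P}
    (hp : genericPrime h = Ideal.span {p}) :
    letI := (S.presheaf.stalkSpecializes h).hom.toAlgebra
    ∃ _ : (Ideal.span {p}).IsPrime, IsLocalization.AtPrime (S.presheaf.stalk x) (Ideal.span {p}) := by
  let := (S.presheaf.stalkSpecializes h).hom.toAlgebra
  refine ⟨hp ▸ inferInstance, ?_⟩
  have h1 := isLocalization_genericPrime h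
  have h2 : (genericPrime h).primeCompl = (Ideal.span {p}).primeCompl (hp := hp ▸ inferInstance) := by
    ext z
    show z ∉ genericPrime h ↔ z ∉ Ideal.span {p}
    rw [hp]
  show IsLocalization _ _
  rw [← h2]
  exact h1

/-- On a surface the prime divisors through a point correspond to the primes of the local ring. -/
theorem exists_isPrimeSystem [IsNoetherianRing (S.presheaf.stalk P)] {a b : S.presheaf.stalk P}
    (h : IsRegularPair a b) :
    ∃ p : PrimeDivisorsThrough P → S.presheaf.stalk P, IsPrimeSystem p ∧
      ∀ i, genericPrime i.2 = Ideal.span {p i} := by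
  have hp : ∀ i : PrimeDivisorsThrough P, ∃ p, Prime p ∧ genericPrime i.2 = Ideal.span {p} := by
    intro i
    let := (S.presheaf.stalkSpecializes i.2).hom.toAlgebra
    have hloc := isLocalization_genericPrime i.2
    have hdim := ringKrullDim_stalk_eq_coheight i.1.1
    -- The extreme primes are excluded: for the maximal ideal P itself would have coheight one, and
    -- for the zero ideal the stalk would be a field.
    rcases h.eq_maximalIdeal_or_exists (genericPrime i.2) with hm | ⟨p, hp⟩
    · exfalso
      have hu : (genericPrime i.2).primeCompl ≤ IsUnit.submonoid (S.presheaf.stalk P) := by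
        intro z hz
        by_contra hzu
        exact hz (hm ▸ hzu)
      have e := IsLocalization.atUnits _ (genericPrime i.2).primeCompl
        (S := S.presheaf.stalk i.1.1) hu
      rw [← ringKrullDim_eq_of_ringEquiv e.toRingEquiv, ringKrullDim_stalk_eq_coheight] at hdim
      refine coheight_ne_one h ?_
      rw [← i.1.2]
      exact_mod_cast hdim
    · refine ⟨p, (Ideal.span_singleton_prime ?_).1 (hp ▸ inferInstance), hp⟩
      rintro rfl
      have hbot : maximalIdeal (S.presheaf.stalk i.1.1) = ⊥ := by
        rw [← IsLocalization.AtPrime.map_eq_maximalIdeal (genericPrime i.2), hp]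
        simp
      have hf : IsField (S.presheaf.stalk i.1.1) := IsLocalRing.isField_iff_maximalIdeal_eq.2 hbot
      rw [ringKrullDim_eq_zero_of_isField hf, i.1.2] at hdim
      exact absurd hdim (by simp)
  choose p hpp hp using hp
  refine ⟨p, ⟨hpp, fun q hq => ?_, fun i j hij => ?_⟩, hp⟩
  -- Localizing at (q) gives a discrete valuation ring, so the corresponding point has coheight one.
  · have hqI : (Ideal.span {q}).IsPrime := (Ideal.span_singleton_prime hq.ne_zero).2 hq
    obtain ⟨x, hx, hxq⟩ := exists_genericPrime_eq (Ideal.span {q})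
    let := (S.presheaf.stalkSpecializes hx).hom.toAlgebra
    obtain ⟨_, hloc⟩ := isLocalization_span hx hxq
    have := h.uniqueFactorizationMonoid
    have := isDiscreteValuationRing_of_atPrime (S.presheaf.stalk x) hq
    have hdim := ringKrullDim_stalk_eq_coheight x
    rw [IsPrincipalIdealRing.ringKrullDim_eq_one _
      (IsDiscreteValuationRing.not_isField _)] at hdim
    have hx1 : Order.coheight x = 1 := by exact_mod_cast hdim.symm
    let i : PrimeDivisorsThrough P := ⟨⟨x, hx1⟩, hx⟩
    have hi : genericPrime hx = Ideal.span {p i} := hp i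
    exact ⟨i, Ideal.span_singleton_eq_span_singleton.1 (hxq.symm.trans hi)⟩
  · refine Subtype.ext (Subtype.ext (eq_of_genericPrime_eq (h := i.2) (h' := j.2) ?_))
    rw [hp, hp, Ideal.span_singleton_eq_span_singleton.2 hij]

variable [IsNoetherianRing (S.presheaf.stalk P)] {a b : S.presheaf.stalk P}
  {p : PrimeDivisorsThrough P → S.presheaf.stalk P}

theorem ord_stalkSpecializes (h : IsRegularPair a b) (hp : IsPrimeSystem p)
    (hpp : ∀ i, genericPrime i.2 = Ideal.span {p i}) (i : PrimeDivisorsThrough P)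
    {z : S.presheaf.stalk P} (hz : z ≠ 0) :
    Ring.ord i.1.localRing ((S.presheaf.stalkSpecializes i.2).hom z) = emultiplicity (p i) z := by
  let := (S.presheaf.stalkSpecializes i.2).hom.toAlgebra
  obtain ⟨_, hloc⟩ := isLocalization_span i.2 (hpp i)
  have := h.uniqueFactorizationMonoid
  exact ord_algebraMap_eq (S.presheaf.stalk i.1.1) (hp.prime i) hz

variable (P) in
/-- The part of a divisor that passes through a point. -/
noncomputable def divisorThrough (C : EffDivisor S) : PrimeDivisorsThrough P →₀ ℕ :=
  C.subtypeDomain fun x => x.1 ⤳ P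

theorem associated_of_isLocalEquation (h : IsRegularPair a b) (hp : IsPrimeSystem p)
    (hpp : ∀ i, genericPrime i.2 = Ideal.span {p i}) {C : EffDivisor S} {f : S.presheaf.stalk P}
    (hf : IsLocalEquation C P f) : Associated f (primeProd p (divisorThrough P C)) := by
  have := h.uniqueFactorizationMonoid
  refine hp.associated_primeProd hf.1 fun i => ?_
  rw [← ord_stalkSpecializes h hp hpp i hf.1, hf.2]
  rfl

end PrimeDivisors

end BlowUpRoundUp

namespace BlowUpRoundUp

open IsLocalRing

/-! ### The three hypotheses bound the multiplicity of the reduction. -/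

section Coordinates

variable (S : Scheme.{0}) [S.Over SpecC] [IsSmoothSurface S] {P : S}

instance isNoetherianRing_stalk (x : S) : IsNoetherianRing (S.presheaf.stalk x) :=
  have := isLocallyNoetherian S
  inferInstance

/-- The rational numbers in a local ring. -/
@[reducible]
noncomputable def stalkRatAlgebra (x : S) : Algebra ℚ (S.presheaf.stalk x) :=
  ((stalkConst S x).hom.comp (algebraMap ℚ ℂ)).toAlgebra

theorem exists_isCoordinatePair_stalk (hP : IsClosed ({P} : Set S)) :
    letI := stalkAlgebra S P
    ∃ (x y : S.presheaf.stalk P) (d₁ d₂ : Derivation ℂ (S.presheaf.stalk P) (S.presheaf.stalk P)),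
      IsCoordinatePair x y d₁ d₂ := by
  let := stalkAlgebra S P
  let := stalkRatAlgebra S P
  obtain ⟨b⟩ := exists_basis_kaehlerDifferential S P
  exact exists_isCoordinatePair (exists_sub_const_mem S hP) b

variable {S}

/-- The reduction of the divisor has multiplicity at most two. -/
theorem primeProd_not_mem_of_cases (hP : IsClosed ({P} : Set S)) {C : EffDivisor S}
    (hC : IsNormalCrossing C ∨ HasTwoSmoothBranches C P ∨ HasOneDoubleBranch C P)
    {a b : S.presheaf.stalk P} (h : IsRegularPair a b)
    {p : PrimeDivisorsThrough P → S.presheaf.stalk P} (hp : IsPrimeSystem p)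
    (hpp : ∀ i, genericPrime i.2 = Ideal.span {p i}) :
    primeProd p (reducedFinsupp (divisorThrough P C)) ∉
      maximalIdeal (S.presheaf.stalk P) ^ 3 := by
  have := h.uniqueFactorizationMonoid
  let := stalkAlgebra S P
  let := stalkRatAlgebra S P
  obtain ⟨x, y, d₁, d₂, hxy⟩ := exists_isCoordinatePair_stalk S hP
  have hD := isLocalCompletion_adicCompletion (S.presheaf.stalk P)
  have hmax : completedMaximalIdeal S P = maximalIdeal (CompletedStalk S P) := hD.map_eq
  have hassoc : ∀ {f : S.presheaf.stalk P} {z : CompletedStalk S P}, IsLocalEquation C P f →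
      Associated (algebraMap _ (CompletedStalk S P) f) z →
      Associated (algebraMap _ (CompletedStalk S P) (primeProd p (divisorThrough P C))) z :=
    fun hf hz => (((associated_of_isLocalEquation h hp hpp hf).map _).symm).trans hz
  rcases hC with hC | ⟨f, n, hf, hf1⟩ | ⟨f, hf, hf2⟩
  · obtain ⟨f, g, m, n, c, hfg, hc, hc'⟩ := hC P hP
    have key : ∀ {f g : CompletedStalk S P}, Ideal.span {f, g} = completedMaximalIdeal S P →
        f ∈ maximalIdeal (CompletedStalk S P) ∧ f ∉ maximalIdeal (CompletedStalk S P) ^ 2 := by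
      intro f g hfg
      rw [hmax] at hfg
      have hf : f ∈ maximalIdeal (CompletedStalk S P) :=
        hfg ▸ Ideal.subset_span (Set.mem_insert _ _)
      have hg : g ∈ maximalIdeal (CompletedStalk S P) :=
        hfg ▸ Ideal.subset_span (Set.mem_insert_of_mem _ rfl)
      -- A coordinate f in the square of the maximal ideal would be superfluous by Nakayama, leaving
      -- that ideal generated by g alone.
      refine ⟨hf, fun hf2 => hD.not_pow_le h hg 1 ?_⟩
      rw [pow_one]
      refine Submodule.le_of_le_smul_of_le_jacobson_bot (I := maximalIdeal _)
        (hfg ▸ Submodule.fg_span (Set.toFinite _)) (maximalIdeal_le_jacobson _) ?_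
      rw [smul_eq_mul, ← pow_two]
      conv_lhs => rw [← hfg]
      rw [Ideal.span_le, Set.pair_subset_iff]
      exact ⟨Ideal.mem_sup_right hf2, Ideal.mem_sup_left (Ideal.mem_span_singleton_self g)⟩
    have hf := key hfg
    have hg := key (Set.pair_comm f g ▸ hfg)
    exact hxy.primeProd_not_mem hD hp hf.1 hf.2 hg.1 hg.2 (hassoc hc hc')
  · obtain ⟨c, hc, hc'⟩ := hf.equation
    have hf1' : ∀ i, f i ∈ maximalIdeal (CompletedStalk S P) ∧
        f i ∉ maximalIdeal (CompletedStalk S P) ^ 2 := by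
      intro i
      have := hf1 i
      rwa [HasMultiplicity, hmax, pow_one] at this
    refine hxy.primeProd_not_mem hD hp (hf1' 0).1 (hf1' 0).2 (hf1' 1).1 (hf1' 1).2
      (m := n 0) (n := n 1) (hassoc hc ?_)
    rwa [Fin.prod_univ_two] at hc'
  · obtain ⟨c, hc, hc'⟩ := hf.equation
    -- The reduced equation divides that of C, which has order exactly two.
    intro hmem
    refine hf2.2 ?_
    have h1 := hassoc hc hc'
    rw [Fin.prod_univ_one, pow_one] at h1
    refine Ideal.mem_of_dvd _ h1.dvd ?_
    rw [hmax]
    exact hD.algebraMap_mem (Ideal.mem_of_dvd _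
      (IsPrimeSystem.primeProd_dvd p (reducedFinsupp_le _)) hmem)

end Coordinates

end BlowUpRoundUp

namespace BlowUpRoundUp

open IsLocalRing KaehlerDifferential Module

/-! ### Function fields and rational two-forms under the blow-up. -/

section FunctionField

variable {S' S : Scheme.{0}} [S.Over SpecC] [S'.Over SpecC] {g : S' ⟶ S} {P : S}

theorem IsBlowUp.apply_genericPoint [IsIntegral S] [IsIntegral S'] (hg : IsBlowUp g P)
    (hP : genericPoint S ≠ P) : g (genericPoint S') = genericPoint S := by
  obtain ⟨y, hy⟩ := hg.exists_apply_eq hP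
  have h1 : g (genericPoint S') ⤳ genericPoint S := by
    rw [← hy]
    exact ((genericPoint_spec S').specializes (Set.mem_univ y)).map g.continuous
  have h2 : genericPoint S ⤳ g (genericPoint S') :=
    (genericPoint_spec S).specializes (Set.mem_univ _)
  exact (h1.antisymm h2).eq

/-- A blow-up does not change the function field. -/
theorem IsBlowUp.exists_functionField_equiv [IsIntegral S] [IsIntegral S'] [g.IsOver SpecC]
    (hg : IsBlowUp g P) (hP : genericPoint S ≠ P) :
    ∃ σ : S.functionField ≃ₐ[ℂ] S'.functionField, ∀ (x' : S') (z : S.presheaf.stalk (g x')),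
      σ (algebraMap _ S.functionField z) =
        algebraMap (S'.presheaf.stalk x') S'.functionField ((g.stalkMap x').hom z) := by
  have hη := hg.apply_genericPoint hP
  have h1 : g (genericPoint S') ⤳ genericPoint S := by rw [hη]
  have h2 : genericPoint S ⤳ g (genericPoint S') := by rw [hη]
  have := isIso_stalkSpecializes h1 h2
  have : IsIso (g.stalkMap (genericPoint S')) := hg.isIso_stalkMap (by rwa [hη])
  let e : S.functionField ≅ S'.functionField :=
    asIso (S.presheaf.stalkSpecializes h1 ≫ g.stalkMap (genericPoint S'))
  have hconst : stalkConst S (genericPoint S) ≫ e.hom = stalkConst S' (genericPoint S') := by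
    rw [asIso_hom, ← Category.assoc, stalkConst_stalkSpecializes, stalkConst_stalkMap]
  refine ⟨AlgEquiv.ofRingEquiv (f := e.commRingCatIsoToRingEquiv)
    fun c => congrArg (fun f => f.hom c) hconst, fun x' z => ?_⟩
  have h3 := Scheme.Hom.stalkSpecializes_stalkMap g (genericPoint S') x'
    ((genericPoint_spec S').specializes (Set.mem_univ x'))
  have h4 : S.presheaf.stalkSpecializes ((genericPoint_spec S).specializes (Set.mem_univ (g x'))) ≫
      e.hom = g.stalkMap x' ≫ S'.presheaf.stalkSpecializes
        ((genericPoint_spec S').specializes (Set.mem_univ x')) := by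
    rw [← h3, asIso_hom, ← Category.assoc, TopCat.Presheaf.stalkSpecializes_comp]
  exact congrArg (fun f => f.hom z) h4

theorem genericPoint_ne [IsIntegral S] {a b : S.presheaf.stalk P} (h : IsRegularPair a b) :
    genericPoint S ≠ P := by
  rintro rfl
  have hu : ¬ IsUnit a := h.left_mem
  exact hu (isUnit_iff_ne_zero (G₀ := S.functionField).2 h.left_ne_zero)

/-- The isomorphism of function fields induces an isomorphism on rational two-forms. -/
theorem exists_rationalTwoForm_equiv [IsIntegral S] [IsIntegral S']
    (σ : S.functionField ≃ₐ[ℂ] S'.functionField) {x y : S.presheaf.stalk P} :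
    letI := stalkAlgebra S P
    ∀ {d₁ d₂ : Derivation ℂ (S.presheaf.stalk P) (S.presheaf.stalk P)}
      (_ : IsCoordinatePair x y d₁ d₂),
    ∃ Φ : RationalTwoForm S ≃ₗ[ℂ] RationalTwoForm S',
      (∀ (c : S.functionField) ω, Φ (c • ω) = σ c • Φ ω) ∧
      ∀ a b, Φ (wedgeD S a b) = wedgeD S' (σ a) (σ b) := by
  let := stalkAlgebra S P
  intro d₁ d₂ h
  have : IsScalarTower ℂ (S.presheaf.stalk P) S.functionField := .of_algebraMap_eq' <|
    congrArg CommRingCat.Hom.hom (stalkConst_stalkSpecializes S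
      ((genericPoint_spec S).specializes (Set.mem_univ P))).symm
  obtain ⟨e, he0, he1⟩ := h.exists_basis_localization (T := S.functionField)
    (nonZeroDivisors (S.presheaf.stalk P))
  let : Algebra (S.presheaf.stalk P) S'.functionField :=
    ((σ : S.functionField →+* S'.functionField).comp (algebraMap _ S.functionField)).toAlgebra
  have : IsScalarTower ℂ (S.presheaf.stalk P) S'.functionField := .of_algebraMap_eq fun c => by
    rw [← σ.commutes, IsScalarTower.algebraMap_apply ℂ (S.presheaf.stalk P) S.functionField]
    rfl
  have : IsFractionRing (S.presheaf.stalk P) S'.functionField :=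
    IsLocalization.isLocalization_of_algEquiv _
      (AlgEquiv.ofRingEquiv (R := S.presheaf.stalk P) (f := σ.toRingEquiv) fun r => rfl)
  obtain ⟨e', he0', he1'⟩ := h.exists_basis_localization (T := S'.functionField)
    (nonZeroDivisors (S.presheaf.stalk P))
  exact exists_twoForm_equiv σ e he0 he1 e' he0' he1'

end FunctionField

end BlowUpRoundUp

theorem ord_ringEquiv {A B : Type*} [CommRing A] [IsDomain A] [CommRing B] [IsDomain B]
    (e : A ≃+* B) (a : A) : Ring.ord B (e a) = Ring.ord A a := by
  let := e.toRingHom.toAlgebra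
  let f := Ideal.quotientEquiv (Ideal.span {a}) (Ideal.span {e a}) e
    (by rw [Ideal.map_span, Set.image_singleton]; rfl)
  let f' : (A ⧸ Ideal.span {a}) ≃ₗ[A] (B ⧸ Ideal.span {e a}) :=
    { f with
      map_smul' := fun r z => by
        obtain ⟨z, rfl⟩ := Ideal.Quotient.mk_surjective z
        exact map_mul f (Ideal.Quotient.mk _ r) (Ideal.Quotient.mk _ z) }
  rw [Ring.ord, Ring.ord, f'.length_eq]
  exact (Module.length_eq_of_surjective (S := A) (R := B) e.surjective).symm

theorem ord_eq_of_associated {A : Type*} [CommRing A] [IsDomain A] {a b : A}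
    (h : Associated a b) : Ring.ord A a = Ring.ord A b := by
  rw [Ring.ord, Ring.ord, Ideal.span_singleton_eq_span_singleton.2 h]

namespace BlowUpRoundUp

open IsLocalRing KaehlerDifferential Module

/-! ### Regular forms and coefficients off the centre. -/

section Comparison

variable {S' S : Scheme.{0}} [S.Over SpecC] [S'.Over SpecC] [IsIntegral S] [IsIntegral S']

theorem map_mem_regularTwoForms {σ : S.functionField →+* S'.functionField}
    {Φ : RationalTwoForm S →+ RationalTwoForm S'}
    (hΦ : ∀ (c : S.functionField) ω, Φ (c • ω) = σ c • Φ ω)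
    (hΦ' : ∀ a b, Φ (wedgeD S a b) = wedgeD S' (σ a) (σ b)) {x : S} {x' : S'}
    (hσ : ∀ z ∈ localSubring S x, σ z ∈ localSubring S' x') {ω : RationalTwoForm S}
    (hω : ω ∈ regularTwoForms S x) : Φ ω ∈ regularTwoForms S' x' := by
  rw [regularTwoForms] at hω
  induction hω using Submodule.span_induction with
  | mem ω hω =>
    obtain ⟨a, ha, b, hb, rfl⟩ := hω
    rw [hΦ']
    exact Submodule.subset_span ⟨_, hσ a ha, _, hσ b hb, rfl⟩
  | zero =>
    rw [map_zero]
    exact zero_mem _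
  | add ω η _ _ hω hη =>
    rw [map_add]
    exact add_mem hω hη
  | smul r ω _ hω =>
    have h1 : Φ (r • ω) = σ r • Φ ω := hΦ r ω
    have h2 := (regularTwoForms S' x').smul_mem ⟨σ r, hσ r r.2⟩ hω
    exact (congrArg (· ∈ regularTwoForms S' x') h1).mpr h2

variable {g : S' ⟶ S} {P : S} {σ : S.functionField ≃ₐ[ℂ] S'.functionField}
  {Φ : RationalTwoForm S ≃ₗ[ℂ] RationalTwoForm S'}

theorem IsBlowUp.mem_regularTwoForms_iff (hg : IsBlowUp g P)
    (hσ : ∀ (x' : S') (z : S.presheaf.stalk (g x')),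
      σ (algebraMap _ S.functionField z) =
        algebraMap (S'.presheaf.stalk x') S'.functionField ((g.stalkMap x').hom z))
    (hΦ : ∀ (c : S.functionField) ω, Φ (c • ω) = σ c • Φ ω)
    (hΦ' : ∀ a b, Φ (wedgeD S a b) = wedgeD S' (σ a) (σ b)) {x' : S'} (hx' : g x' ≠ P)
    {ω : RationalTwoForm S} :
    Φ ω ∈ regularTwoForms S' x' ↔ ω ∈ regularTwoForms S (g x') := by
  have := hg.isIso_stalkMap hx'
  constructor
  · intro h
    have h1 := map_mem_regularTwoForms (σ := (σ.symm : S'.functionField →+* S.functionField))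
      (Φ := (Φ.symm : RationalTwoForm S' →+ RationalTwoForm S)) (x := x') (x' := g x')
      (fun c ω => Φ.injective ?_) (fun a b => Φ.injective ?_) ?_ h
    · simpa using h1
    · simp [hΦ]
    · simp [hΦ']
    · rintro _ ⟨z, rfl⟩
      obtain ⟨z, rfl⟩ :=
        (asIso (g.stalkMap x')).commRingCatIsoToRingEquiv.surjective z
      exact ⟨z, ((σ.symm_apply_eq).2 (hσ x' z).symm).symm⟩
  · refine map_mem_regularTwoForms (σ := (σ : S.functionField →+* S'.functionField))
      (Φ := (Φ : RationalTwoForm S →+ RationalTwoForm S')) hΦ hΦ' ?_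
    rintro _ ⟨z, rfl⟩
    exact ⟨_, (hσ x' z).symm⟩

theorem IsBlowUp.pullback_apply_eq (hg : IsBlowUp g P) {C : EffDivisor S} {C' : EffDivisor S'}
    (hC' : IsPullback g C C') (x' : PrimeDivisor S') (hx' : g x'.1 ≠ P)
    (hx : Order.coheight (g x'.1) = 1) : C' x' = C ⟨g x'.1, hx⟩ := by
  have := hg.isIso_stalkMap hx'
  obtain ⟨a, ha, hax⟩ := hC' x'
  have h1 := ha.2 ⟨g x'.1, hx⟩ specializes_rfl
  have h2 := ord_ringEquiv (asIso (g.stalkMap x'.1)).commRingCatIsoToRingEquiv a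
  rw [TopCat.Presheaf.stalkSpecializes_refl] at h1
  have h3 : (C' x' : ℕ∞) = C ⟨g x'.1, hx⟩ := hax.symm.trans (h2.trans h1)
  exact_mod_cast h3

end Comparison

end BlowUpRoundUp

namespace BlowUpRoundUp

open IsLocalRing KaehlerDifferential Module

/-! ### Adjoint forms near the exceptional curve. -/

section Main

variable {S' S : Scheme.{0}} [S.Over SpecC] [S'.Over SpecC] {g : S' ⟶ S} {P : S}

theorem _root_.IsCoordinatePair.symm {k R : Type*} [CommRing k] [CommRing R] [Algebra k R]
    [IsLocalRing R] {x y : R} {d₁ d₂ : Derivation k R R} (h : IsCoordinatePair x y d₁ d₂) :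
    IsCoordinatePair y x d₂ d₁ where
  isRegularPair := h.isRegularPair.symm
  left_left := h.right_right
  left_right := h.right_left
  right_left := h.left_right
  right_right := h.left_left
  D_eq a := by rw [h.D_eq a, add_comm]

theorem algebraMap_stalkSpecializes [IsIntegral S] {x : S} (h : x ⤳ P) (z : S.presheaf.stalk P) :
    algebraMap (S.presheaf.stalk x) S.functionField ((S.presheaf.stalkSpecializes h).hom z) =
      algebraMap (S.presheaf.stalk P) S.functionField z := by
  have : S.presheaf.stalkSpecializes h ≫ S.presheaf.stalkSpecializes
      ((genericPoint_spec S).specializes (Set.mem_univ x)) = S.presheaf.stalkSpecializes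
      ((genericPoint_spec S).specializes (Set.mem_univ P)) := by simp
  exact congrArg (fun f => f.hom z) this

theorem isScalarTower_functionField [IsIntegral S] (x : S) :
    letI := stalkAlgebra S x
    IsScalarTower ℂ (S.presheaf.stalk x) S.functionField :=
  letI := stalkAlgebra S x
  .of_algebraMap_eq' <| congrArg CommRingCat.Hom.hom (stalkConst_stalkSpecializes S
      ((genericPoint_spec S).specializes (Set.mem_univ x))).symm

/-- A rational two-form is a multiple of the standard one, with the obvious bound on poles. -/
theorem exists_eq_smul_of_mem_adjointSections [IsSmoothSurface S] {x y : S.presheaf.stalk P} :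
    letI := stalkAlgebra S P
    ∀ {d₁ d₂ : Derivation ℂ (S.presheaf.stalk P) (S.presheaf.stalk P)}
      (_ : IsCoordinatePair x y d₁ d₂) {p : PrimeDivisorsThrough P → S.presheaf.stalk P}
      (_ : IsPrimeSystem p) (_ : ∀ i, genericPrime i.2 = Ideal.span {p i}) {D : EffDivisor S}
      {ω : RationalTwoForm S} (_ : ω ∈ adjointSections S D),
    ∃ z : S.functionField, ω = z • wedgeD S (algebraMap _ _ x) (algebraMap _ _ y) ∧
      ∀ i : PrimeDivisorsThrough P, ∃ r s : S.presheaf.stalk P, ¬ p i ∣ s ∧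
        algebraMap _ S.functionField s * (algebraMap _ S.functionField (p i ^ D i.1) * z) =
          algebraMap _ S.functionField r := by
  let := stalkAlgebra S P
  intro d₁ d₂ h p hp hpp D ω hω
  have := isScalarTower_functionField P
  obtain ⟨e, he0, he1⟩ := h.exists_basis_localization (T := S.functionField)
    (nonZeroDivisors (S.presheaf.stalk P))
  obtain ⟨L, hL⟩ := exists_exteriorPower_equiv e
  rw [he0, he1] at hL
  have hLw : ∀ c : S.functionField,
      L (c • wedgeD S (algebraMap _ _ x) (algebraMap _ _ y)) = c := by
    intro c
    rw [map_smul]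
    exact (congrArg (c * ·) hL).trans (mul_one c)
  have hω' : ω = L ω • wedgeD S (algebraMap _ _ x) (algebraMap _ _ y) := L.injective (hLw _).symm
  refine ⟨L ω, hω', fun i => ?_⟩
  let := (S.presheaf.stalkSpecializes i.2).hom.toAlgebra
  let := stalkAlgebra S i.1.1
  have := isScalarTower_functionField i.1.1
  have : IsScalarTower ℂ (S.presheaf.stalk P) (S.presheaf.stalk i.1.1) :=
    .of_algebraMap_eq' <| congrArg CommRingCat.Hom.hom (stalkConst_stalkSpecializes S i.2).symm
  obtain ⟨_, hloc⟩ := isLocalization_span i.2 (hpp i)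
  obtain ⟨f, hf0, hf1⟩ := h.exists_basis_localization (T := S.presheaf.stalk i.1.1)
    (Ideal.span {p i}).primeCompl
  have hpm : (S.presheaf.stalkSpecializes i.2).hom (p i ^ D i.1) ∈
      maximalIdeal i.1.localRing ^ D i.1 := by
    rw [map_pow]
    refine Ideal.pow_mem_pow ?_ _
    have : p i ∈ genericPrime i.2 := hpp i ▸ Ideal.mem_span_singleton_self _
    exact this
  obtain ⟨c, hc⟩ := exists_eq_smul_of_mem_span f hf0 hf1 (hω i.1 _ hpm)
  obtain ⟨⟨r, s⟩, hrs⟩ := IsLocalization.surj (Ideal.span {p i}).primeCompl c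
  refine ⟨r, s, fun hs => s.2 (Ideal.mem_span_singleton.2 hs), ?_⟩
  have h1 : algebraMap i.1.localRing S.functionField
      ((S.presheaf.stalkSpecializes i.2).hom (p i ^ D i.1)) • ω =
        algebraMap i.1.localRing S.functionField c •
          wedgeD S (algebraMap _ _ x) (algebraMap _ _ y) := by
    rw [← algebraMap_stalkSpecializes i.2 x, ← algebraMap_stalkSpecializes i.2 y]
    exact hc
  have h2 : algebraMap _ S.functionField (p i ^ D i.1) * L ω =
      algebraMap i.1.localRing S.functionField c := by
    rw [← algebraMap_stalkSpecializes i.2, ← hLw (algebraMap i.1.localRing S.functionField c), ← h1,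
      L.map_smul, smul_eq_mul]
  have h3 := congrArg (algebraMap i.1.localRing S.functionField) hrs
  rw [map_mul] at h3
  rw [h2, mul_comm, ← algebraMap_stalkSpecializes i.2 r, ← algebraMap_stalkSpecializes i.2 s.1]
  exact h3

/-- An adjoint form extends over the exceptional curve. -/
theorem smul_mem_regularTwoForms_of_isExceptionalChart [IsSmoothSurface S] [IsIntegral S']
    {σ : S.functionField ≃ₐ[ℂ] S'.functionField} {Φ : RationalTwoForm S ≃ₗ[ℂ] RationalTwoForm S'}
    (hσ : ∀ (x' : S') (z : S.presheaf.stalk (g x')),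
      σ (algebraMap _ S.functionField z) =
        algebraMap (S'.presheaf.stalk x') S'.functionField ((g.stalkMap x').hom z))
    (hΦ : ∀ (c : S.functionField) ω, Φ (c • ω) = σ c • Φ ω)
    (hΦ' : ∀ a b, Φ (wedgeD S a b) = wedgeD S' (σ a) (σ b)) {C : EffDivisor S}
    {C' : EffDivisor S'} (hC' : IsPullback g C C') {x' : PrimeDivisor S'}
    (hP : IsClosed ({g x'.1} : Set S))
    (hC : IsNormalCrossing C ∨ HasTwoSmoothBranches C (g x'.1) ∨ HasOneDoubleBranch C (g x'.1))
    {t : ℝ} (ht : 0 ≤ t) {ω : RationalTwoForm S} (hω : ω ∈ adjointSections S (roundUp t C))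
    {x y : S.presheaf.stalk (g x'.1)} :
    letI := stalkAlgebra S (g x'.1)
    letI := (g.stalkMap x'.1).hom.toAlgebra
    ∀ {d₁ d₂ : Derivation ℂ (S.presheaf.stalk (g x'.1)) (S.presheaf.stalk (g x'.1))}
      (_ : IsCoordinatePair x y d₁ d₂) {w : S'.presheaf.stalk x'.1}
      (_ : IsExceptionalChart x y w) {b : S'.presheaf.stalk x'.1}
      (_ : b ∈ maximalIdeal x'.localRing ^ roundUp t C' x'),
    algebraMap x'.localRing S'.functionField b • Φ ω ∈ regularTwoForms S' x'.1 := by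
  let := stalkAlgebra S (g x'.1)
  let := (g.stalkMap x'.1).hom.toAlgebra
  intro d₁ d₂ h w hw b hb
  have := h.isRegularPair.uniqueFactorizationMonoid
  obtain ⟨p, hp, hpp⟩ := exists_isPrimeSystem h.isRegularPair
  obtain ⟨z, rfl, hz⟩ := exists_eq_smul_of_mem_adjointSections h hp hpp hω
  have hred := primeProd_not_mem_of_cases hP hC h.isRegularPair hp hpp
  obtain ⟨f, hf, hfx⟩ := hC' x'
  have hn : Ring.ord x'.localRing (algebraMap (S.presheaf.stalk (g x'.1)) x'.localRing
      (primeProd p (divisorThrough (g x'.1) C))) = (C' x' : ℕ∞) := by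
    rw [← hfx]
    exact (ord_eq_of_associated
      ((associated_of_isLocalEquation h.isRegularPair hp hpp hf).map (g.stalkMap x'.1).hom)).symm
  obtain ⟨c, hc⟩ := hw.exists_mul_eq_algebraMap h.isRegularPair hp hred ht hn
    (σ : S.functionField →+* S'.functionField) (hσ x'.1) hz hb
  have hy : σ (algebraMap _ S.functionField y) = σ (algebraMap _ S.functionField x) *
      algebraMap x'.localRing S'.functionField w := by
    rw [hσ, hσ, ← map_mul]
    exact congrArg _ hw.eq_mul
  -- The zero of dx ∧ dy along E provides the one order by which rounding may exceed the bound.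
  have hwedge : wedgeD S' (σ (algebraMap _ _ x)) (σ (algebraMap _ _ y)) =
      σ (algebraMap _ _ x) • wedgeD S' (σ (algebraMap _ _ x))
        (algebraMap x'.localRing S'.functionField w) := by
    rw [hy]
    exact ιMulti_D_mul _ _
  have hx : σ (algebraMap _ S.functionField x) = algebraMap x'.localRing S'.functionField
    (algebraMap (S.presheaf.stalk (g x'.1)) x'.localRing x) := hσ x'.1 x
  rw [hΦ, hΦ', hwedge, smul_smul, smul_smul]
  have hc' : algebraMap x'.localRing S'.functionField b *
      (σ z * σ (algebraMap _ S.functionField x)) = algebraMap x'.localRing S'.functionField c := by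
    rw [hx]
    exact hc
  rw [mul_assoc, hc']
  refine (regularTwoForms S' x'.1).smul_mem ⟨_, c, rfl⟩ (Submodule.subset_span ⟨_, ?_, _, ?_, rfl⟩)
  · exact ⟨_, hx.symm⟩
  · exact ⟨w, rfl⟩

end Main

end BlowUpRoundUp

theorem map_mem_maximalIdeal_pow_iff {A B : Type*} [CommRing A] [IsLocalRing A] [CommRing B]
    [IsLocalRing B] (e : A ≃+* B) (n : ℕ) {a : A} :
    e a ∈ IsLocalRing.maximalIdeal B ^ n ↔ a ∈ IsLocalRing.maximalIdeal A ^ n := by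
  have h : (IsLocalRing.maximalIdeal A ^ n).map (e : A →+* B) = IsLocalRing.maximalIdeal B ^ n := by
    rw [Ideal.map_pow]
    congr 1
    exact IsLocalRing.map_maximalIdeal_of_surjective _ e.surjective
  rw [← h]
  refine ⟨fun ha => ?_, Ideal.mem_map_of_mem _⟩
  obtain ⟨b, hb, hab⟩ := (Ideal.mem_map_of_equiv e _).1 ha
  rwa [← e.injective hab]

namespace BlowUpRoundUp

open IsLocalRing KaehlerDifferential Module

section Main

variable {S' S : Scheme.{0}} [S.Over SpecC] [S'.Over SpecC] [IsSmoothSurface S] [IsIntegral S']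
  {g : S' ⟶ S} {P : S}

/-- Adjoint forms correspond under a blow-up. -/
theorem IsBlowUp.mem_adjointSections_iff (hg : IsBlowUp g P)
    {σ : S.functionField ≃ₐ[ℂ] S'.functionField} {Φ : RationalTwoForm S ≃ₗ[ℂ] RationalTwoForm S'}
    (hσ : ∀ (x' : S') (z : S.presheaf.stalk (g x')),
      σ (algebraMap _ S.functionField z) =
        algebraMap (S'.presheaf.stalk x') S'.functionField ((g.stalkMap x').hom z))
    (hΦ : ∀ (c : S.functionField) ω, Φ (c • ω) = σ c • Φ ω)
    (hΦ' : ∀ a b, Φ (wedgeD S a b) = wedgeD S' (σ a) (σ b)) {C : EffDivisor S}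
    {C' : EffDivisor S'} (hC' : IsPullback g C C')
    (hC : IsNormalCrossing C ∨ HasTwoSmoothBranches C P ∨ HasOneDoubleBranch C P)
    {t : ℝ} (ht : 0 ≤ t) {ω : RationalTwoForm S} :
    ω ∈ adjointSections S (roundUp t C) ↔ Φ ω ∈ adjointSections S' (roundUp t C') := by
  have hround : ∀ (x' : PrimeDivisor S') (_ : g x'.1 ≠ P) (hx : Order.coheight (g x'.1) = 1),
      roundUp t C' x' = roundUp t C ⟨g x'.1, hx⟩ := by
    intro x' hx' hx
    simp only [roundUp, Finsupp.mapRange_apply, hg.pullback_apply_eq hC' x' hx' hx]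
    rfl
  have hmem : ∀ {x' : S'} (_ : g x' ≠ P) (z : S.presheaf.stalk (g x')) {η : RationalTwoForm S},
      algebraMap (S'.presheaf.stalk x') S'.functionField ((g.stalkMap x').hom z) • Φ η ∈
        regularTwoForms S' x' ↔
      algebraMap _ S.functionField z • η ∈ regularTwoForms S (g x') := by
    intro x' hx' z η
    rw [← hσ, ← hΦ]
    exact hg.mem_regularTwoForms_iff hσ hΦ hΦ' hx'
  constructor
  · intro hω x' b hb
    -- Only exceptional divisors need the multiplicity bound; elsewhere the two conditions
    -- correspond under an isomorphism of local rings.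
    by_cases hx' : g x'.1 = P
    · subst hx'
      let := stalkAlgebra S (g x'.1)
      obtain ⟨x, y, d₁, d₂, h⟩ := exists_isCoordinatePair_stalk S hg.isClosed
      have hinj : Function.Injective (g.stalkMap x'.1).hom := by
        refine Function.Injective.of_comp
          (f := algebraMap (S'.presheaf.stalk x'.1) S'.functionField) fun z z' hz => ?_
        refine IsFractionRing.injective (S.presheaf.stalk (g x'.1)) S.functionField
          (σ.injective ?_)
        rw [hσ, hσ]
        exact hz
      rcases hg.exists_isExceptionalChart rfl hinj x'.2 h.isRegularPair.span_eq with
        ⟨w, hw⟩ | ⟨w, hw⟩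
      · exact smul_mem_regularTwoForms_of_isExceptionalChart hσ hΦ hΦ' hC' hg.isClosed hC ht hω
          h hw hb
      · exact smul_mem_regularTwoForms_of_isExceptionalChart hσ hΦ hΦ' hC' hg.isClosed hC ht hω
          h.symm hw hb
    · have := hg.isIso_stalkMap hx'
      have hx : Order.coheight (g x'.1) = 1 := by rw [← hg.coheight_eq hx', x'.2]
      obtain ⟨a, rfl⟩ := (asIso (g.stalkMap x'.1)).commRingCatIsoToRingEquiv.surjective b
      refine (hmem hx' a).2 (hω ⟨g x'.1, hx⟩ a ?_)
      rw [hround x' hx' hx] at hb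
      exact (map_mem_maximalIdeal_pow_iff _ _).1 hb
  -- Every prime divisor of S lifts to S', so the conditions on S are among those on S'.
  · rintro hω ⟨x, hx⟩ a ha
    have hxP : x ≠ P := by
      rintro rfl
      let := stalkAlgebra S x
      obtain ⟨x, y, d₁, d₂, h⟩ := exists_isCoordinatePair_stalk S hg.isClosed
      exact coheight_ne_one h.isRegularPair hx
    obtain ⟨x', rfl⟩ := hg.exists_apply_eq hxP
    have := hg.isIso_stalkMap hxP
    let y' : PrimeDivisor S' := ⟨x', by rw [hg.coheight_eq hxP, hx]⟩
    refine (hmem hxP a).1 (hω y' _ ?_)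
    rw [hround y' hxP hx]
    exact (map_mem_maximalIdeal_pow_iff
      (asIso (g.stalkMap x')).commRingCatIsoToRingEquiv _).2 ha

end Main

end BlowUpRoundUp

open BlowUpRoundUp in
theorem lemma3p3 (S S' : Scheme.{0}) [S.Over SpecC] [S'.Over SpecC]
    [IsSmoothSurface S] [IsIntegral S']
    (g : S' ⟶ S) [g.IsOver SpecC] (P : S) (hg : IsBlowUp g P)
    (C : EffDivisor S) (C' : EffDivisor S') (hC' : IsPullback g C C')
    (hC : IsNormalCrossing C ∨ HasTwoSmoothBranches C P ∨ HasOneDoubleBranch C P)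
    (t : ℝ) (ht : t ∈ Set.Ioo (0 : ℝ) 1) :
    h0K S (roundUp t C) = h0K S' (roundUp t C') := by
  let := stalkAlgebra S P
  obtain ⟨x, y, d₁, d₂, h⟩ := exists_isCoordinatePair_stalk S hg.isClosed
  obtain ⟨σ, hσ⟩ := hg.exists_functionField_equiv (genericPoint_ne h.isRegularPair)
  obtain ⟨Φ, hΦ, hΦ'⟩ := exists_rationalTwoForm_equiv σ h
  refine LinearEquiv.rank_eq (Φ.ofSubmodules _ _ ?_)
  ext η
  obtain ⟨ω, rfl⟩ := Φ.surjective η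
  rw [← hg.mem_adjointSections_iff hσ hΦ hΦ' hC' hC ht.1.le]
  simp
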